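/- Conventions. All spins $a,b,c,\dots$ run over $\{0,\tfrac12,1,\tfrac32,\dots\}$; $(abc)$ is a triad if $a+b+c\in\mathbb Z$ and each of $a,b,c$ is at most the sum of the other two. Let $h$ be a formal parameter, and let $\mathcal U_h(sl(2))$ be the algebra over $\mathbb C[[h]]$ with $[J_0,J_\pm]=\pm2J_\pm$, $[J_+,J_-]=J_0$ and coproduct $\tilde\Delta=\mathcal F\Delta\mathcal F^{-1}$, where $\Delta(J)=J\otimes1+1\otimes J$, $\mathcal F=\exp(-\tfrac12J_0\otimes\sigma)$, $\sigma=-\ln(1-2hJ_+)$. $V^j$ is the spin $j$ representation with basis $e^j_m$, $-j\le m\le j$: $J_\pm e^j_m=\sqrt{(j\mp m)(j\pm m+1)}\,e^j_{m\pm1}$, $J_0e^j_m=2m\,e^j_m$. $C^{j_1,j_2,j}_{m_1,m_2,m}$ are the Clebsch-Gordan coefficients of $sl(2)$. Racah coefficients. In $V^a\otimes V^b$ put $e^{(ab)d}_\delta=\sum_{\alpha,\beta} C^{a,b,d}_{\alpha,\beta,\delta}\,\mathcal F\,(e^a_\alpha\otimes e^b_\beta)$. In $V^a\otimes V^b\otimes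 V^c$ put $$\psi^{(ab)d,c;e}_\epsilon=\sum C^{d,c,e}_{\delta,\gamma,\epsilon}\,(\tilde\Delta\otimes\mathrm{id})(\mathcal F)\,(e^{(ab)d}_\delta\otimes e^c_\gamma),\qquad \psi^{a,(bc)f;e}_\epsilon=\sum C^{a,f,e}_{\alpha,\rho,\epsilon}\,(\mathrm{id}\otimes\tilde\Delta)(\mathcal F)\,(e^a_\alpha\otimes e^{(bc)f}_\rho).$$ The Racah coefficients $W_h$ of $\mathcal U_h(sl(2))$ are the coefficients in $$\psi^{(ab)d,c;e}_\epsilon=\sum_f\sqrt{(2d+1)(2f+1)}\;W_h(abec;df)\;\psi^{a,(bc)f;e}_\epsilon ,$$ where $W_h(abcd;ef)=0$ unless $(abe),(cde),(acf),(bdf)$ are triads. The Racah coefficients $W$ of $sl(2)$ are defined in the same way with $\mathcal F=1$. $h$-symplectons. Let $\bar a,a$ be boson operators, $[\bar a,a]=1$, and $J_+=-\tfrac12a^2$, $J_-=\tfrac12\bar a^2$, $J_0=\tfrac12(a\bar a+\bar aa)$. An $h$-symplecton is a family of nonzero $\tilde P_j^m$ ($-j\le m\le j$), formal power series in $h$ whose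 coefficients are polynomials in $a,\bar a$, with $\mathrm{ad}J_\pm(\tilde P_j^m)=\sqrt{(j\mp m)(j\pm m+1)}\,\tilde P_j^{m\pm1}$ and $\mathrm{ad}J_0(\tilde P_j^m)=2m\tilde P_j^m$, where $$\mathrm{ad}J_0(t)=[J_0,t]e^{-\sigma},\qquad \mathrm{ad}J_+(t)=e^{-\sigma}[J_+e^{\sigma},t],$$ $$\mathrm{ad}J_-(t)=[J_-+hJ_0+\tfrac h2J_0^2,t]e^{-\sigma}-h[J_0,t]e^{-2\sigma}-\tfrac h2[J_0,[J_0,t]]e^{-2\sigma}.$$ A $\mathbb C[[h]]$-valued function $T$ is called a triangle function of $\tilde P$ if $$\tilde P_j^m\tilde P_{j'}^{m'}=\sum_{k=|j-j'|}^{j+j'}\sum_{n,n'}2^{k-j-j'}(2k+1)^{-1/2}\,T(kjj')\,(F^{-1})^{\;j,j'}_{n,n'\,m,m'}\,C^{j',j,k}_{n',m,n'+m}\,\tilde P_k^{n'+m}$$ for all $j,j',m,m'$, where $(F^{-1})^{\;j,j'}_{n,n'\,m,m'}$ are the matrix elements of $\mathcal F^{-1}$ on $V^j\otimes V^{j'}$.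 Statement. Let $$\nabla(abc)=\left[\frac{(a+b+c+1)!}{(a+b-c)!\,(a-b+c)!\,(-a+b+c)!}\right]^{1/2}$$ if $(abc)$ is a triad, and $\nabla(abc)=0$ otherwise. The Racah coefficients $W$ and $W_h$ exist and are unique, and $\nabla$ is a triangle function of some $h$-symplecton. If $T$ is a triangle function of any $h$-symplecton (in any normalization), then, for all $a,b,c,d,f$ such that $(acf)$ and $(bdf)$ are triads, $$T(cfa)\,T(fdb)=(2f+1)\sum_eW_h(abcd;ef)\,T(eba)\,T(cde),$$ where $e$ runs over the spins for which $(abe)$ and $(cde)$ are triads. In particular, for all $a,b,c,d,f$, $$\nabla(acf)\nabla(bdf)=(2f+1)\sum_eW_h(abcd;ef)\,\nabla(abe)\nabla(cde),$$ and this is the same relation as the one for $sl(2)$: $W_h(abcd;ef)=W(abcd;ef)$ for all arguments, so that also $\nabla(acf)\nabla(bdf)=(2f+1)\sum_eW(abcd;ef)\nabla(abe)\nabla(cde)$. -/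

import Mathlib

/-! Conventions.  A spin `j ∈ {0, 1/2, 1, …}` is represented by the natural number `n = 2 j`, and a
magnetic number `m ∈ {-j, …, j}` by the index `i = j + m : Fin (n + 1)`, so `2 m = 2 i - n`. -/

namespace Jordanian

open scoped Kronecker PowerSeries

noncomputable section

/-- The triangle condition for three spins (given by their doubles): `a + b + c` is an integer and
each spin is at most the sum of the other two. -/
abbrev Triad (a b c : ℕ) : Prop :=
  Even (a + b + c) ∧ a ≤ b + c ∧ b ≤ a + c ∧ c ≤ a + b

/-- `1 / z!`, with the convention that it vanishes for negative integers `z`. -/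
def invFact (z : ℤ) : ℝ := if z < 0 then 0 else ((z.toNat.factorial : ℝ))⁻¹

/-- The triangle function
`∇(abc) = [(a+b+c+1)! / ((a+b-c)! (a-b+c)! (-a+b+c)!)]^{1/2}` (zero if `a, b, c` is no triad). -/
def nabla (a b c : ℕ) : ℝ :=
  if Triad a b c then
    Real.sqrt ((((a + b + c) / 2 + 1).factorial : ℝ) /
      (((a + b - c) / 2).factorial * ((a + c - b) / 2).factorial * ((b + c - a) / 2).factorial))
  else 0

/-- The Clebsch-Gordan coefficient `C^{j₁, j₂, j}_{m₁, m₂, m}` of `sl(2)`, by Racah's formula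
(Condon-Shortley phases).  Here `A = 2 j₁`, `B = 2 j₂`, `K = 2 j`, `i = j₁ + m₁`, `l = j₂ + m₂`,
`r = j + m`; with `s = j₁ + j₂ - j` the condition `m = m₁ + m₂` reads `r + s = i + l`. -/
def cg (A B K : ℕ) (i : Fin (A + 1)) (l : Fin (B + 1)) (r : Fin (K + 1)) : ℝ :=
  let s : ℕ := (A + B - K) / 2
  if Triad A B K ∧ (r : ℕ) + s = i + l then
    Real.sqrt (((K + 1 : ℕ) : ℝ) * (((K + A - B) / 2).factorial * ((K + B - A) / 2).factorial *
        s.factorial) / ((A + B + K) / 2 + 1).factorial) *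
    Real.sqrt ((r : ℕ).factorial * (K - r : ℕ).factorial * (A - i : ℕ).factorial *
        (i : ℕ).factorial * (B - l : ℕ).factorial * (l : ℕ).factorial) *
    ∑ k ∈ Finset.range (s + 1), (-1 : ℝ) ^ k *
      (invFact k * invFact ((s : ℤ) - k) * invFact ((A : ℤ) - i - k) * invFact ((l : ℤ) - k) *
        invFact ((i : ℤ) - s + k) * invFact ((B : ℤ) - s - l + k))
  else 0

/-! ### Finite-dimensional representations and the twist -/

/-- The matrices of `J₊, J₋, J₀` in some (free, finite) representation. -/
structure Generators (ι R : Type*) where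
  Jp : Matrix ι ι R
  Jm : Matrix ι ι R
  J0 : Matrix ι ι R

section Reps

variable {R : Type*} [CommRing R] [Algebra ℝ R] [Algebra ℚ R]

/-- The spin `n / 2` irreducible representation: `J± |jm⟩ = √((j∓m)(j±m+1)) |j m±1⟩`,
`J₀ |jm⟩ = 2m |jm⟩`. -/
def spin (R : Type*) [CommRing R] [Algebra ℝ R] (n : ℕ) : Generators (Fin (n + 1)) R where
  Jp := Matrix.of fun k i =>
    if (k : ℕ) = i + 1 then algebraMap ℝ R (Real.sqrt (((n : ℝ) - i) * (i + 1))) else 0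
  Jm := Matrix.of fun k i =>
    if (i : ℕ) = k + 1 then algebraMap ℝ R (Real.sqrt ((i : ℝ) * (n - i + 1))) else 0
  J0 := Matrix.diagonal fun i => 2 * (i : R) - n

variable {ι κ μ : Type*} [Fintype ι] [DecidableEq ι] [Fintype κ] [DecidableEq κ]
  [Fintype μ] [DecidableEq μ]

/-- `σ = -ln(1 - 2 h J₊) = ∑_{n ≥ 1} (2 h J₊)ⁿ / n`, for a nilpotent matrix `J₊`. -/
def sigma (h : R) (Jp : Matrix ι ι R) : Matrix ι ι R :=
  ∑ n ∈ Finset.range (nilpotencyClass ((2 * h) • Jp)),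
    ((n + 1 : ℚ)⁻¹) • ((2 * h) • Jp) ^ (n + 1)

/-- The twist element `𝓕 = exp(-½ J₀ ⊗ σ)` in the tensor product of two representations. -/
def twist (h : R) (M : Generators ι R) (N : Generators κ R) : Matrix (ι × κ) (ι × κ) R :=
  IsNilpotent.exp (-((2 : ℚ)⁻¹ • (M.J0 ⊗ₖ sigma h N.Jp)))

/-- The inverse `𝓕⁻¹ = exp(½ J₀ ⊗ σ)` of the twist element. -/
def twistInv (h : R) (M : Generators ι R) (N : Generators κ R) : Matrix (ι × κ) (ι × κ) R :=
  IsNilpotent.exp ((2 : ℚ)⁻¹ • (M.J0 ⊗ₖ sigma h N.Jp))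

/-- The tensor product of two representations of `U_h(sl(2))`: the action through the twisted
coproduct `Δ̃(J) = 𝓕 (J ⊗ 1 + 1 ⊗ J) 𝓕⁻¹`. -/
def tensor (h : R) (M : Generators ι R) (N : Generators κ R) : Generators (ι × κ) R where
  Jp := twist h M N * (M.Jp ⊗ₖ 1 + 1 ⊗ₖ N.Jp) * twistInv h M N
  Jm := twist h M N * (M.Jm ⊗ₖ 1 + 1 ⊗ₖ N.Jm) * twistInv h M N
  J0 := twist h M N * (M.J0 ⊗ₖ 1 + 1 ⊗ₖ N.J0) * twistInv h M N

/-- Given families `u` (spin `A / 2`) in `M` and `v` (spin `B / 2`) in `N`, the family of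
spin `K / 2` in `M ⊗ N`: `∑ C^{A,B,K}_{α,β,r} 𝓕 (u_α ⊗ v_β)`. -/
def couple (h : R) (M : Generators ι R) (N : Generators κ R) {A B : ℕ}
    (u : Fin (A + 1) → ι → R) (v : Fin (B + 1) → κ → R) (K : ℕ) (r : Fin (K + 1)) : ι × κ → R :=
  (twist h M N).mulVec
    (∑ α, ∑ β, algebraMap ℝ R (cg A B K α β r) • fun p : ι × κ => u α p.1 * v β p.2)

/-- The standard basis of the spin `n / 2` representation. -/
def stdBasis (R : Type*) [CommRing R] (n : ℕ) : Fin (n + 1) → Fin (n + 1) → R :=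
  fun i => Pi.single i 1

/-- The basis of spin `e` in `(Vᵃ ⊗ Vᵇ) ⊗ Vᶜ` obtained by first coupling `Vᵃ` and `Vᵇ` to
spin `d`. -/
def coupleLeft (h : R) (a b c d e : ℕ) (ε : Fin (e + 1)) :
    (Fin (a + 1) × Fin (b + 1)) × Fin (c + 1) → R :=
  couple h (tensor h (spin R a) (spin R b)) (spin R c)
    (couple h (spin R a) (spin R b) (stdBasis R a) (stdBasis R b) d) (stdBasis R c) e ε

/-- The basis of spin `e` in `Vᵃ ⊗ (Vᵇ ⊗ Vᶜ)` obtained by first coupling `Vᵇ` and `Vᶜ` to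
spin `f`. -/
def coupleRight (h : R) (a b c f e : ℕ) (ε : Fin (e + 1)) :
    Fin (a + 1) × (Fin (b + 1) × Fin (c + 1)) → R :=
  couple h (spin R a) (tensor h (spin R b) (spin R c))
    (stdBasis R a) (couple h (spin R b) (spin R c) (stdBasis R b) (stdBasis R c) f) e ε

/-- `W` is the system of Racah coefficients `W a b c d e f = W(abcd;ef)` for the deformation
parameter `h` (for `h = 0` the twist is trivial and these are those of `sl(2)`): it is supported on
the arguments for which `(abe)`, `(cde)`, `(acf)`, `(bdf)` are triads, and
`ψ^{(ab)d,c;e}_ε = ∑_f √((2d+1)(2f+1)) W(abec;df) ψ^{a,(bc)f;e}_ε`. -/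
def IsRacah (h : R) (W : ℕ → ℕ → ℕ → ℕ → ℕ → ℕ → R) : Prop :=
  (∀ a b c d e f, ¬(Triad a b e ∧ Triad c d e ∧ Triad a c f ∧ Triad b d f) →
    W a b c d e f = 0) ∧
  ∀ a b c d e, Triad a b d → Triad d c e →
    ∀ (ε : Fin (e + 1)) (i : Fin (a + 1)) (k : Fin (b + 1)) (l : Fin (c + 1)),
      coupleLeft h a b c d e ε ((i, k), l) =
        ∑ f ∈ (Finset.range (b + c + 1)).filter (fun f => Triad b c f ∧ Triad a f e),
          algebraMap ℝ R (Real.sqrt (((d : ℝ) + 1) * (f + 1))) * W a b e c d f *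
            coupleRight h a b c f e ε (i, (k, l))

end Reps

/-! ### The boson algebra and the h-symplecton -/

/-- The boson commutation relation `ā a = a ā + 1`; the generator `a` is `true`, and `ā` is
`false`. -/
inductive BosonRel : FreeAlgebra ℂ Bool → FreeAlgebra ℂ Bool → Prop
  | comm : BosonRel (FreeAlgebra.ι ℂ false * FreeAlgebra.ι ℂ true)
      (FreeAlgebra.ι ℂ true * FreeAlgebra.ι ℂ false + 1)

/-- The boson (Weyl) algebra: polynomials in `a`, `ā` with `[ā, a] = 1`. -/
abbrev Boson : Type := RingQuot BosonRel

/-- The creation operator `a`. -/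
def Boson.a : Boson := RingQuot.mkAlgHom ℂ BosonRel (FreeAlgebra.ι ℂ true)

/-- The annihilation operator `ā`. -/
def Boson.abar : Boson := RingQuot.mkAlgHom ℂ BosonRel (FreeAlgebra.ι ℂ false)

/-- Formal power series in the (central) deformation parameter `h = PowerSeries.X` with
coefficients in the boson algebra. -/
abbrev BosonH : Type := Boson⟦X⟧

/-- Scalars `ℂ⟦h⟧` as elements of `BosonH`. -/
def scalar : ℂ⟦X⟧ →+* BosonH := PowerSeries.map (algebraMap ℂ Boson)

/-- The deformation parameter `h`, as an element of `BosonH`. -/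
def hh : BosonH := PowerSeries.X

/-- `J₊ = -½ a²`. -/
def Jp : BosonH := PowerSeries.C (-((2 : ℂ)⁻¹ • Boson.a ^ 2))

/-- `J₋ = ½ ā²`. -/
def Jm : BosonH := PowerSeries.C ((2 : ℂ)⁻¹ • Boson.abar ^ 2)

/-- `J₀ = ½ (a ā + ā a)`. -/
def J0 : BosonH := PowerSeries.C ((2 : ℂ)⁻¹ • (Boson.a * Boson.abar + Boson.abar * Boson.a))

/-- `e^{-σ} = 1 - 2 h J₊`, where `σ = -ln(1 - 2 h J₊)`. -/
def expNegSigma : BosonH := 1 - 2 * hh * Jp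

/-- `e^{σ} = (1 - 2 h J₊)⁻¹ = ∑ₙ (2 h J₊)ⁿ`, where `2 J₊ = -a²`. -/
def expSigma : BosonH := PowerSeries.mk fun n => (-(Boson.a ^ 2)) ^ n

/-- The commutator `[x, y]`. -/
def commutator (x y : BosonH) : BosonH := x * y - y * x

/-- `ad J₀ (t) = [J₀, t] e^{-σ}`. -/
def adJ0 (t : BosonH) : BosonH := commutator J0 t * expNegSigma

/-- `ad J₊ (t) = e^{-σ} [J₊ e^σ, t]`. -/
def adJp (t : BosonH) : BosonH := expNegSigma * commutator (Jp * expSigma) t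

/-- `ad J₋ (t) =
[J₋ + h J₀ + ½ h J₀², t] e^{-σ} - h [J₀, t] e^{-2σ} - ½ h [J₀, [J₀, t]] e^{-2σ}`. -/
def adJm (t : BosonH) : BosonH :=
  commutator (Jm + hh * J0 + (2 : ℂ)⁻¹ • (hh * J0 ^ 2)) t * expNegSigma
    - hh * commutator J0 t * expNegSigma ^ 2
    - (2 : ℂ)⁻¹ • (hh * commutator J0 (commutator J0 t) * expNegSigma ^ 2)

/-- `P n i = P̃_j^m` (`n = 2 j`, `i = j + m`) is an h-symplecton: for every spin, the operators
`P̃_j^m` are nonzero and form an irreducible tensor operator of `U_h(sl(2))`: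
`ad X (P̃_j^m) = ∑_k D(X)_{k m} P̃_j^k` for `X = J₊, J₋, J₀`. -/
def IsHSymplecton (P : (n : ℕ) → Fin (n + 1) → BosonH) : Prop :=
  ∀ (n : ℕ) (i : Fin (n + 1)), P n i ≠ 0 ∧
    adJp (P n i) = ∑ k, scalar ((spin ℂ⟦X⟧ n).Jp k i) * P n k ∧
    adJm (P n i) = ∑ k, scalar ((spin ℂ⟦X⟧ n).Jm k i) * P n k ∧
    adJ0 (P n i) = ∑ k, scalar ((spin ℂ⟦X⟧ n).J0 k i) * P n k

/-- `T` is the triangle function of the product law of the h-symplecton `P`: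
`P̃_j^m P̃_{j'}^{m'} = ∑_{k=|j-j'|}^{j+j'} ∑_{n,n'} ⟨k|j|j'⟩ (F⁻¹)_{n,n' m,m'}^{j,j'}
  C_{n',m,n'+m}^{j',j,k} P̃_k^{n'+m}` with `⟨k|j|j'⟩ = 2^{k-j-j'} (2k+1)^{-1/2} T(k j j')`.
The index `r` stands for `n' + m`; the coefficient `cg` vanishes for all other `r`. -/
def HasProductLaw (P : (n : ℕ) → Fin (n + 1) → BosonH) (T : ℕ → ℕ → ℕ → ℂ⟦X⟧) : Prop :=
  ∀ (j j' : ℕ) (m : Fin (j + 1)) (m' : Fin (j' + 1)),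
    P j m * P j' m' =
      ∑ k ∈ (Finset.range (j + j' + 1)).filter (fun k => Triad k j j'),
        ∑ n : Fin (j + 1), ∑ n' : Fin (j' + 1), ∑ r : Fin (k + 1),
          scalar (algebraMap ℝ ℂ⟦X⟧
              ((2 : ℝ)⁻¹ ^ ((j + j' - k) / 2) * (Real.sqrt ((k : ℝ) + 1))⁻¹) * T k j j' *
            twistInv (PowerSeries.X : ℂ⟦X⟧) (spin ℂ⟦X⟧ j) (spin ℂ⟦X⟧ j') (n, n') (m, m') *
            algebraMap ℝ ℂ⟦X⟧ (cg j' j k n' m r)) * P k r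

end

end Jordanian

/-! The relation is associativity of multiplication, read in two coupled bases. Contract a triple
product `P_a P_b P_c` of symplecton components with a vector coupling `a` and `b` first: the product
law, applied twice, gives a product of two values of `T` times `P_e`. Coupling `b` and `c` first
gives another such product. The Racah coefficients expand one coupling in the other, and nonzero
scalars in `ℂ⟦h⟧` can be cancelled from `P_e ≠ 0`. The powers of `-1/2` and the square roots then
collapse to the factor `2f+1`. This is `HasProductLaw.reducedCoeff_mul` and
`HasProductLaw.triangle_relation`; nothing else about the symplecton is used, so its normalization
plays no role.

The Racah coefficients do not depend on `h`. The element `σ` is primitive for the twisted coproduct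
(`sigma_tensor`), since `e^{-σ} = 1 - 2hJ₊` is group-like. Hence `(Δ̃ ⊗ id)(𝓕) 𝓕₁₂ = (id ⊗ Δ̃)(𝓕)
𝓕₂₃` (`twist_cocycle`), and both coupled bases are the undeformed ones multiplied by one and the
same invertible matrix. What remains is classical: the Clebsch-Gordan coefficients intertwine,
because they are coefficients of transvectants, and they are orthonormal and complete, by Schur's
lemma, one norm computation at highest weight and a dimension count. The recoupling coefficients are
then overlaps of the two couplings.

That `∇` occurs at all is shown by an explicit symplecton. For `h = 0` take normalized Weyl-ordered
monomials in `a, ā`. Their product is the Moyal product, whose term of order `s` is an `s`-th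
transvectant, hence a Clebsch-Gordan coefficient up to normalization, and `∇` is exactly the factor
that fits the normalizations together (`symp_mul_symp`). For general `h`, multiply the component of
weight `m` on the right by `e^{mσ}`. This is a tensor operator for the deformed action. Moving
`e^{mσ}` past the second factor of a product creates the matrix of `𝓕⁻¹` (`conjBy_sigmaPow`), and
the undeformed product law does the rest (`hasProductLaw_hSymp`). -/

namespace Jordanian
open scoped Kronecker PowerSeries
noncomputable section

/-! ### Exponentials and logarithms of nilpotent elements -/

section ExpLog
open Polynomial

/-- The truncation `∑_{j < n} X^{j+1} / (j+1)` of `-ln (1 - X)`. -/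
def logPoly (n : ℕ) : ℚ[X] := ∑ j ∈ Finset.range n, C ((j + 1 : ℚ)⁻¹) * X ^ (j + 1)

theorem X_dvd_logPoly (n : ℕ) : (X : ℚ[X]) ∣ logPoly n :=
  Finset.dvd_sum fun j _ => Dvd.dvd.mul_left (dvd_pow_self _ (Nat.succ_ne_zero j)) _

theorem one_sub_X_mul_derivative_logPoly (n : ℕ) :
    (1 - X) * derivative (logPoly n) = 1 - X ^ n := by
  have : derivative (logPoly n) = ∑ j ∈ Finset.range n, X ^ j := by
    simp only [logPoly, derivative_sum, derivative_mul, derivative_C, zero_mul, zero_add,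
      derivative_X_pow]
    refine Finset.sum_congr rfl fun j _ => ?_
    rw [← mul_assoc, ← C_mul]
    have : ((j : ℚ) + 1)⁻¹ * ((j + 1 : ℕ) : ℚ) = 1 := by
      push_cast; exact inv_mul_cancel₀ (by positivity)
    rw [this]; simp
  rw [this, mul_comm, geom_sum_mul_neg]

/-- The truncated exponential series evaluated at `-logPoly n`. -/
def expNegLogPoly (n : ℕ) : ℚ[X] :=
  ∑ k ∈ Finset.range n, C ((k.factorial : ℚ)⁻¹) * (-logPoly n) ^ k

/-- Both polynomials solve `(1 - X) p' + p = 0` modulo `X^N` with value 1 at 0, and this equation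
determines the coefficients up to degree `N` recursively. -/
theorem X_pow_dvd_expNegLogPoly_sub (N : ℕ) :
    (X : ℚ[X]) ^ (N + 1) ∣ expNegLogPoly (N + 1) - (1 - X) := by
  set L := logPoly (N + 1) with hL
  set p := expNegLogPoly (N + 1) with hp
  -- Differentiating a truncated exponential loses its top term, which is therefore subtracted; it
  -- is harmless because `L` is divisible by `X`.
  have hd : derivative p = -derivative L * (p - C ((N.factorial : ℚ)⁻¹) * (-L) ^ N) := by
    have h1 : p - C ((N.factorial : ℚ)⁻¹) * (-L) ^ N =
        ∑ k ∈ Finset.range N, C ((k.factorial : ℚ)⁻¹) * (-L) ^ k := by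
      rw [hp, expNegLogPoly, Finset.sum_range_succ, ← hL]; ring
    rw [h1, hp, expNegLogPoly, ← hL, Finset.sum_range_succ', derivative_add, derivative_sum,
      Finset.mul_sum]
    simp only [pow_zero, mul_one, derivative_C, add_zero, derivative_mul, zero_mul, zero_add]
    refine Finset.sum_congr rfl fun k _ => ?_
    rw [derivative_pow, derivative_neg, Nat.add_sub_cancel]
    have : C (((k + 1).factorial : ℚ)⁻¹) * C ((k + 1 : ℕ) : ℚ) = C ((k.factorial : ℚ)⁻¹) := by
      rw [← C_mul, Nat.factorial_succ]
      congr 1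
      have := Nat.factorial_ne_zero k
      push_cast
      field_simp
    rw [← this]; ring
  obtain ⟨q, hq⟩ : (X : ℚ[X]) ^ N ∣ (1 - X) * derivative p + p := by
    have h1 : (1 - X) * derivative p + p =
        X ^ N * (X * p) + (1 - X ^ (N + 1)) * C ((N.factorial : ℚ)⁻¹) * (-L) ^ N := by
      rw [hd]
      linear_combination (C ((N.factorial : ℚ)⁻¹) * (-L) ^ N - p) *
        one_sub_X_mul_derivative_logPoly (N + 1)
    rw [h1]
    refine dvd_add (dvd_mul_right _ _) (Dvd.dvd.mul_left (pow_dvd_pow_of_dvd ?_ N) _)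
    exact (dvd_neg).2 (X_dvd_logPoly _)
  have h0 : p.coeff 0 = 1 := by
    obtain ⟨g, hg⟩ := X_dvd_logPoly (N + 1)
    rw [hp, expNegLogPoly, Finset.sum_range_succ']
    rw [coeff_zero_eq_eval_zero]
    simp [eval_finsetSum, hg]
  -- The factor `m - 1` vanishes at `m = 1`, so all coefficients from degree 2 on are zero.
  have hrec : ∀ m < N, ((m : ℚ) + 1) * p.coeff (m + 1) = (m - 1) * p.coeff m := by
    intro m hm
    have h1 : ((1 - X) * derivative p + p).coeff m = 0 := by
      rw [hq, coeff_X_pow_mul', if_neg (by omega)]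
    rw [sub_mul, one_mul, coeff_add, coeff_sub, coeff_derivative] at h1
    rcases m with _ | m
    · simp only [coeff_X_mul_zero] at h1
      push_cast at h1 ⊢
      linear_combination h1
    · rw [coeff_X_mul, coeff_derivative] at h1
      push_cast at h1 ⊢
      linear_combination h1
  have hc : ∀ m ≤ N, (p - (1 - X)).coeff m = 0 := by
    have key : ∀ m, m + 2 ≤ N → p.coeff (m + 2) = 0 := by
      intro m
      induction m with
      | zero =>
        intro h
        have := hrec 1 (by omega)
        push_cast at this
        norm_num at this
        exact this
      | succ m ih =>
        intro h
        have := hrec (m + 2) (by omega)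
        rw [ih (by omega), mul_zero] at this
        exact (mul_eq_zero.1 this).resolve_left (by positivity)
    intro m hm
    match m, hm with
    | 0, _ => simp [h0]
    | 1, hm =>
      have := hrec 0 (by omega)
      rw [h0] at this
      norm_num at this
      simp [this, coeff_one]
    | m + 2, hm =>
      rw [coeff_sub, key m hm, coeff_sub, coeff_X_of_ne_one (by omega), coeff_one]
      simp
  exact X_pow_dvd_iff.2 fun m hm => hc m (by omega)

variable {A : Type*} [Ring A] [Algebra ℚ A]

theorem aeval_logPoly_pow_eq_zero {N : A} {n : ℕ} (hN : N ^ n = 0) (m : ℕ) :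
    aeval N (logPoly m) ^ n = 0 := by
  obtain ⟨g, hg⟩ := pow_dvd_pow_of_dvd (X_dvd_logPoly m) n
  rw [← map_pow, hg, map_mul, map_pow, aeval_X, hN, zero_mul]

theorem isNilpotent_aeval_logPoly {N : A} (hN : IsNilpotent N) (m : ℕ) :
    IsNilpotent (aeval N (logPoly m)) := by
  obtain ⟨n, hn⟩ := hN
  exact ⟨n, aeval_logPoly_pow_eq_zero hn m⟩

theorem exp_neg_aeval_logPoly {N : A} {n : ℕ} (hN : N ^ (n + 1) = 0) :
    IsNilpotent.exp (-aeval N (logPoly (n + 1))) = 1 - N := by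
  have h0 := aeval_logPoly_pow_eq_zero hN (n + 1)
  rw [IsNilpotent.exp_eq_sum (k := n + 1) (by rw [neg_pow, h0, mul_zero])]
  obtain ⟨g, hg⟩ := X_pow_dvd_expNegLogPoly_sub n
  have h1 := congrArg (aeval N) hg
  rw [map_sub, map_mul, map_pow, aeval_X, hN, zero_mul, sub_eq_zero, map_sub, map_one, aeval_X]
    at h1
  rw [← h1, expNegLogPoly, map_sum]
  refine Finset.sum_congr rfl fun k _ => ?_
  rw [map_mul, aeval_C, map_pow, map_neg, Algebra.smul_def]

/-- Since `exp z - 1 = z (1 + z w)` with `w` a polynomial in `z`, the second factor is unipotent,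
hence a unit. -/
theorem exp_eq_one_iff {z : A} (hz : IsNilpotent z) (h : IsNilpotent.exp z = 1) : z = 0 := by
  obtain ⟨n, hn⟩ := hz
  have hn2 : z ^ (n + 2) = 0 := by rw [pow_add, hn, zero_mul]
  rw [IsNilpotent.exp_eq_sum hn2, Finset.sum_range_succ', Finset.sum_range_succ'] at h
  simp only [pow_zero, Nat.factorial_zero, Nat.cast_one, inv_one, one_smul, zero_add,
    Nat.factorial_one, pow_one, add_eq_right] at h
  set w := ∑ k ∈ Finset.range n, (((k + 1 + 1).factorial : ℚ)⁻¹) • z ^ k with hw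
  have h2 : z * (1 + z * w) = 0 := by
    rw [mul_add, mul_one, ← mul_assoc, hw, Finset.mul_sum, add_comm, ← h]
    congr 1
    refine Finset.sum_congr rfl fun k _ => ?_
    rw [mul_smul_comm, ← pow_two, ← pow_add, add_comm 2 k]
  have hc : Commute z w := by
    refine Commute.sum_right _ _ _ fun k _ => ?_
    exact ((Commute.refl z).pow_right k).smul_right _
  have hu : IsUnit (1 + z * w) := by
    have : IsNilpotent (z * w) := hc.isNilpotent_mul_right ⟨n, hn⟩
    exact this.isUnit_one_add
  exact (hu.mul_left_eq_zero).1 h2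

theorem exp_injective_of_commute {x y : A} (hc : Commute x y) (hx : IsNilpotent x)
    (hy : IsNilpotent y) (h : IsNilpotent.exp x = IsNilpotent.exp y) : x = y := by
  have h1 : IsNilpotent.exp (x - y) = 1 := by
    rw [sub_eq_add_neg, IsNilpotent.exp_add_of_commute hc.neg_right hx hy.neg, h,
      IsNilpotent.exp_mul_exp_neg_self hy]
  exact sub_eq_zero.1 (exp_eq_one_iff (hc.isNilpotent_sub hx hy) h1)

end ExpLog

/-! ### Powers and Kronecker products of matrices -/

section Kronecker

variable {R : Type*} [CommRing R] {ι κ : Type*} [Fintype ι] [DecidableEq ι] [Fintype κ]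
  [DecidableEq κ]

theorem pow_mul_of_intertwine {M : Matrix ι ι R} {N : Matrix κ κ R} {U : Matrix ι κ R}
    (hU : M * U = U * N) (n : ℕ) : M ^ n * U = U * N ^ n := by
  induction n with
  | zero => simp
  | succ n ih => rw [pow_succ, Matrix.mul_assoc, hU, ← Matrix.mul_assoc, ih, Matrix.mul_assoc,
      ← pow_succ]

theorem kronecker_pow' (A : Matrix ι ι R) (B : Matrix κ κ R) (n : ℕ) :
    (A ⊗ₖ B) ^ n = (A ^ n) ⊗ₖ (B ^ n) := by
  induction n with
  | zero => simp
  | succ n ih => rw [pow_succ, ih, ← Matrix.mul_kronecker_mul, ← pow_succ, ← pow_succ]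

theorem isNilpotent_kronecker_right (A : Matrix ι ι R) {B : Matrix κ κ R} (hB : IsNilpotent B) :
    IsNilpotent (A ⊗ₖ B) := by
  obtain ⟨n, hn⟩ := hB
  exact ⟨n, by rw [kronecker_pow', hn, Matrix.kronecker_zero]⟩

theorem isNilpotent_kronecker_left {A : Matrix ι ι R} (hA : IsNilpotent A) (B : Matrix κ κ R) :
    IsNilpotent (A ⊗ₖ B) := by
  obtain ⟨n, hn⟩ := hA
  exact ⟨n, by rw [kronecker_pow', hn, Matrix.zero_kronecker]⟩

end Kronecker

/-! ### The logarithm `σ` and the twist for nilpotent matrices -/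

section Twist

variable {R : Type*} [CommRing R] [Algebra ℚ R]
variable {ι κ : Type*} [Fintype ι] [DecidableEq ι] [Fintype κ] [DecidableEq κ]

/-- Terms beyond the nilpotency class vanish, so the class can be traded for any larger bound. This
allows a common truncation for two matrices. -/
theorem sigma_eq_aeval (h : R) {J : Matrix ι ι R} {n : ℕ} (hn : ((2 * h) • J) ^ n = 0) :
    sigma h J = Polynomial.aeval ((2 * h) • J) (logPoly n) := by
  set N := (2 * h) • J
  have h1 : Polynomial.aeval N (logPoly n) =
      ∑ k ∈ Finset.range n, ((k + 1 : ℚ)⁻¹) • N ^ (k + 1) := by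
    simp [logPoly, map_sum, Algebra.smul_def]
  rw [h1, sigma]
  have hle : nilpotencyClass N ≤ n := csInf_le' hn
  refine Finset.sum_subset (Finset.range_mono hle) fun k _ hk => ?_
  replace hk : nilpotencyClass N ≤ k := by simpa using hk
  rw [pow_eq_zero_of_le (by omega) (pow_nilpotencyClass ⟨n, hn⟩), smul_zero]

theorem isNilpotent_sigma (h : R) {J : Matrix ι ι R} (hJ : IsNilpotent ((2 * h) • J)) :
    IsNilpotent (sigma h J) := by
  obtain ⟨n, hn⟩ := hJ
  rw [sigma_eq_aeval h hn]
  exact isNilpotent_aeval_logPoly ⟨n, hn⟩ n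

theorem exp_neg_sigma (h : R) {J : Matrix ι ι R} (hJ : IsNilpotent ((2 * h) • J)) :
    IsNilpotent.exp (-sigma h J) = 1 - (2 * h) • J := by
  obtain ⟨n, hn⟩ := hJ
  have hn1 : ((2 * h) • J) ^ (n + 1) = 0 := by rw [pow_succ, hn, zero_mul]
  rw [sigma_eq_aeval h hn1, exp_neg_aeval_logPoly hn1]

/-- Every power passes through `U`, hence so does the series once both sides have a common length.
`U` may be rectangular: in this way twists are moved past Clebsch-Gordan maps. -/
theorem exp_mul_of_intertwine {M : Matrix ι ι R} {N : Matrix κ κ R} {U : Matrix ι κ R}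
    (hM : IsNilpotent M) (hN : IsNilpotent N) (hU : M * U = U * N) :
    IsNilpotent.exp M * U = U * IsNilpotent.exp N := by
  obtain ⟨m, hm⟩ := hM
  obtain ⟨n, hn⟩ := hN
  rw [IsNilpotent.exp_eq_sum (pow_eq_zero_of_le (le_max_left m n) hm),
    IsNilpotent.exp_eq_sum (pow_eq_zero_of_le (le_max_right m n) hn), Matrix.sum_mul,
    Matrix.mul_sum]
  refine Finset.sum_congr rfl fun k _ => ?_
  rw [Matrix.smul_mul, pow_mul_of_intertwine hU, Matrix.mul_smul]

theorem sigma_mul_of_intertwine (h : R) {M : Matrix ι ι R} {N : Matrix κ κ R} {U : Matrix ι κ R}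
    (hM : IsNilpotent ((2 * h) • M)) (hN : IsNilpotent ((2 * h) • N)) (hU : M * U = U * N) :
    sigma h M * U = U * sigma h N := by
  obtain ⟨m, hm⟩ := hM
  obtain ⟨n, hn⟩ := hN
  have hU' : ((2 * h) • M) * U = U * ((2 * h) • N) := by
    rw [Matrix.smul_mul, hU, Matrix.mul_smul]
  rw [sigma_eq_aeval h (pow_eq_zero_of_le (le_max_left m n) hm),
    sigma_eq_aeval h (pow_eq_zero_of_le (le_max_right m n) hn)]
  simp only [logPoly, map_sum, map_mul, map_pow, Polynomial.aeval_C, Polynomial.aeval_X,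
    ← Algebra.smul_def, Matrix.sum_mul, Matrix.mul_sum]
  refine Finset.sum_congr rfl fun k _ => ?_
  rw [Matrix.smul_mul, pow_mul_of_intertwine hU', Matrix.mul_smul]

theorem exp_one_kronecker {B : Matrix κ κ R} (hB : IsNilpotent B) :
    IsNilpotent.exp ((1 : Matrix ι ι R) ⊗ₖ B) = 1 ⊗ₖ IsNilpotent.exp B := by
  obtain ⟨n, hn⟩ := hB
  have h1 : ((1 : Matrix ι ι R) ⊗ₖ B) ^ n = 0 := by
    rw [kronecker_pow', hn, Matrix.kronecker_zero]
  rw [IsNilpotent.exp_eq_sum hn, IsNilpotent.exp_eq_sum h1]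
  ext ⟨i, k⟩ ⟨i', k'⟩
  simp only [kronecker_pow', one_pow, Matrix.kroneckerMap_apply, Matrix.sum_apply,
    Matrix.smul_apply, Finset.mul_sum, mul_smul_comm]

theorem exp_kronecker_one {B : Matrix κ κ R} (hB : IsNilpotent B) :
    IsNilpotent.exp (B ⊗ₖ (1 : Matrix ι ι R)) = IsNilpotent.exp B ⊗ₖ 1 := by
  obtain ⟨n, hn⟩ := hB
  have h1 : (B ⊗ₖ (1 : Matrix ι ι R)) ^ n = 0 := by
    rw [kronecker_pow', hn, Matrix.zero_kronecker]
  rw [IsNilpotent.exp_eq_sum hn, IsNilpotent.exp_eq_sum h1]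
  ext ⟨i, k⟩ ⟨i', k'⟩
  simp only [kronecker_pow', one_pow, Matrix.kroneckerMap_apply, Matrix.sum_apply,
    Matrix.smul_apply, Finset.sum_mul, smul_mul_assoc]

/-- For the twist this means block structure: `𝓕⁻¹` preserves the first magnetic number `m` and acts
on the second factor by `e^{mσ}`. -/
theorem exp_diagonal_kronecker_apply (w : ι → R) {B : Matrix κ κ R} (hB : IsNilpotent B)
    (i i' : ι) (k k' : κ) :
    IsNilpotent.exp (Matrix.diagonal w ⊗ₖ B) (i, k) (i', k') =
      if i = i' then IsNilpotent.exp (w i • B) k k' else 0 := by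
  obtain ⟨n, hn⟩ := hB
  have h1 : (Matrix.diagonal w ⊗ₖ B) ^ n = 0 := by
    rw [kronecker_pow', hn, Matrix.kronecker_zero]
  have h2 : (w i • B) ^ n = 0 := by rw [smul_pow, hn, smul_zero]
  rw [IsNilpotent.exp_eq_sum h1, IsNilpotent.exp_eq_sum h2]
  simp only [kronecker_pow', Matrix.diagonal_pow, Matrix.sum_apply, Matrix.smul_apply,
    Matrix.kroneckerMap_apply, Matrix.diagonal_apply, smul_pow]
  split_ifs with h
  · simp
  · simp

theorem twist_mul_twistInv (h : R) (M : Generators ι R) (N : Generators κ R)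
    (hN : IsNilpotent ((2 * h) • N.Jp)) : twist h M N * twistInv h M N = 1 :=
  IsNilpotent.exp_neg_mul_exp_self
    ((isNilpotent_kronecker_right M.J0 (isNilpotent_sigma h hN)).smul _)

theorem twistInv_mul_twist (h : R) (M : Generators ι R) (N : Generators κ R)
    (hN : IsNilpotent ((2 * h) • N.Jp)) : twistInv h M N * twist h M N = 1 :=
  IsNilpotent.exp_mul_exp_neg_self
    ((isNilpotent_kronecker_right M.J0 (isNilpotent_sigma h hN)).smul _)

end Twist
end
end Jordanian

namespace Jordanian
open scoped Kronecker PowerSeries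
noncomputable section

/-! ### Transvectant coefficients and the Clebsch-Gordan coefficients -/

theorem invFact_natCast (n : ℕ) : invFact n = ((n.factorial : ℝ))⁻¹ := by
  simp [invFact]

theorem invFact_of_neg {z : ℤ} (hz : z < 0) : invFact z = 0 := by simp [invFact, hz]

/-- The convention at negative integers is made for this recurrence: it persists for `z ≤ 0`, so the
transvectant identities need no boundary cases. -/
theorem mul_invFact (z : ℤ) : (z : ℝ) * invFact z = invFact (z - 1) := by
  rcases lt_trichotomy z 0 with hz | rfl | hz
  · rw [invFact_of_neg hz, invFact_of_neg (by omega), mul_zero]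
  · rw [invFact_of_neg (z := (0 : ℤ) - 1) (by omega)]; simp
  · obtain ⟨n, rfl⟩ : ∃ n : ℕ, z = n + 1 := ⟨(z - 1).toNat, by omega⟩
    have h := invFact_natCast (n + 1)
    push_cast at h
    rw [h, add_sub_cancel_right, invFact_natCast, Nat.factorial_succ]
    have := Nat.factorial_ne_zero n
    push_cast
    field_simp

/-- The coefficients of the `s`-th transvectant: with `x^[l] = x^l / l!`,
`(∂_y ⊗ ∂_x - ∂_x ⊗ ∂_y)^s (x^[l] y^[b] ⊗ x^[i] y^[d])` multiplies out to
`transvect s l b i d • x^{l+i-s} y^{b+d-s}`. -/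
def transvect : ℕ → ℤ → ℤ → ℤ → ℤ → ℝ
  | 0, l, b, i, d => invFact l * invFact b * invFact i * invFact d
  | s + 1, l, b, i, d => transvect s l (b - 1) (i - 1) d - transvect s (l - 1) b i (d - 1)

theorem transvect_succ (s : ℕ) (l b i d : ℤ) : transvect (s + 1) l b i d =
    transvect s l (b - 1) (i - 1) d - transvect s (l - 1) b i (d - 1) := rfl

/-- The operator `Ω = ∂_y ⊗ ∂_x - ∂_x ⊗ ∂_y` is `sl(2)`-invariant. Here it is compared with the
derivation `y ∂_x` acting on both factors and on their product; `transvect_lower` does the same for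
`x ∂_y`. -/
theorem transvect_raise (s : ℕ) (l b i d : ℤ) :
    ((d : ℝ) + 1) * transvect s l b (i - 1) (d + 1) +
      ((b : ℝ) + 1) * transvect s (l - 1) (b + 1) i d =
      ((i : ℝ) + l - s) * transvect s l b i d := by
  induction s generalizing l b i d with
  | zero =>
    have h1 := mul_invFact (d + 1)
    have h2 := mul_invFact (b + 1)
    have h3 := mul_invFact i
    have h4 := mul_invFact l
    push_cast at h1 h2
    rw [add_sub_cancel_right] at h1 h2
    simp only [transvect, ← h3, ← h4, Nat.cast_zero]
    linear_combination invFact l * invFact b * i * invFact i * h1 +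
      l * invFact l * invFact i * invFact d * h2
  | succ s ih =>
    have h1 := ih l (b - 1) (i - 1) d
    have h2 := ih (l - 1) b i (d - 1)
    simp only [transvect_succ]
    simp only [sub_add_cancel, add_sub_cancel_right] at *
    push_cast at *
    linear_combination h1 - h2

theorem transvect_lower (s : ℕ) (l b i d : ℤ) :
    ((i : ℝ) + 1) * transvect s l b (i + 1) (d - 1) +
      ((l : ℝ) + 1) * transvect s (l + 1) (b - 1) i d =
      ((b : ℝ) + d - s) * transvect s l b i d := by
  induction s generalizing l b i d with
  | zero =>
    have h1 := mul_invFact (i + 1)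
    have h2 := mul_invFact (l + 1)
    have h3 := mul_invFact d
    have h4 := mul_invFact b
    push_cast at h1 h2
    rw [add_sub_cancel_right] at h1 h2
    simp only [transvect, ← h3, ← h4, Nat.cast_zero]
    linear_combination invFact l * invFact b * d * invFact d * h1 +
      b * invFact b * invFact i * invFact d * h2
  | succ s ih =>
    have h1 := ih l (b - 1) (i - 1) d
    have h2 := ih (l - 1) b i (d - 1)
    simp only [transvect_succ]
    simp only [sub_add_cancel, add_sub_cancel_right] at *
    push_cast at *
    linear_combination h1 - h2

theorem transvect_swap (s : ℕ) (l b i d : ℤ) :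
    transvect s i d l b = (-1) ^ s * transvect s l b i d := by
  induction s generalizing l b i d with
  | zero => simp only [transvect]; ring
  | succ s ih => rw [transvect_succ, ih l (b - 1), ih (l - 1) b, transvect_succ]; ring

/-- This is the commutator `[Ω, x ⊗ 1] = -1 ⊗ ∂_y`, applied to `Ω^{s+1}`; note `x · x^[l] = (l+1)
x^[l+1]`. -/
theorem transvect_succ_left (s : ℕ) (l b i d : ℤ) :
    ((l : ℝ) + 1) * transvect (s + 1) (l + 1) b i d =
      transvect (s + 1) l b i d - (s + 1) * transvect s l b i (d - 1) := by
  induction s generalizing l b i d with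
  | zero =>
    have h1 := mul_invFact (l + 1)
    have h2 := mul_invFact l
    simp only [transvect, add_sub_cancel_right] at *
    rw [← h2, ← h1]
    push_cast
    ring
  | succ s ih =>
    have e1 := ih l (b - 1) (i - 1) d
    have e2 := ih (l - 1) b i (d - 1)
    rw [transvect_succ (s + 1), transvect_succ (s + 1) l, add_sub_cancel_right]
    rw [sub_add_cancel] at e2
    push_cast at *
    linear_combination e1 - e2 + (s + 1) * transvect_succ s l b i (d - 1)

theorem transvect_zero_succ_left (l b i d : ℤ) :
    ((l : ℝ) + 1) * transvect 0 (l + 1) b i d = transvect 0 l b i d := by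
  have := mul_invFact (l + 1)
  rw [add_sub_cancel_right] at this
  push_cast at this
  simp only [transvect]
  linear_combination invFact b * invFact i * invFact d * this

/-- The Leibniz rule for the second variable. -/
theorem transvect_leibniz (s : ℕ) (l b i d : ℤ) :
    ((b : ℝ) + d - s) * transvect s l b i d =
      transvect s l (b - 1) i d + transvect s l b i (d - 1) := by
  induction s generalizing l b i d with
  | zero =>
    simp only [transvect, ← mul_invFact d, ← mul_invFact b, Nat.cast_zero]
    ring
  | succ s ih =>
    have h1 := ih l (b - 1) (i - 1) d
    have h2 := ih (l - 1) b i (d - 1)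
    simp only [transvect_succ]
    push_cast at *
    linear_combination h1 - h2

/-- The two summands of `Ω` commute, so the binomial theorem expands its power. -/
theorem transvect_eq_sum (s : ℕ) (l b i d : ℤ) :
    transvect s l b i d = ∑ k ∈ Finset.range (s + 1), (s.choose k : ℝ) * ((-1 : ℝ) ^ k *
      (invFact (l - k) * invFact (b - s + k) * invFact (i - s + k) * invFact (d - k))) := by
  induction s generalizing l b i d with
  | zero => simp [transvect]
  | succ s ih =>
    rw [transvect_succ, ih, ih]
    have := Finset.sum_choose_succ_mul (fun k _ => (-1 : ℝ) ^ k * (invFact (l - k) *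
      invFact (b - (s + 1 : ℕ) + k) * invFact (i - (s + 1 : ℕ) + k) * invFact (d - k))) s
    rw [this, sub_eq_add_neg, ← Finset.sum_neg_distrib]
    push_cast
    congr 1
    · refine Finset.sum_congr rfl fun k _ => ?_
      rw [show b - 1 - (s : ℤ) + k = b - (s + 1) + k by ring,
        show i - 1 - (s : ℤ) + k = i - (s + 1) + k by ring]
    · refine Finset.sum_congr rfl fun k _ => ?_
      rw [show l - 1 - (k : ℤ) = l - (k + 1) by ring, show d - 1 - (k : ℤ) = d - (k + 1) by ring,
        show b - (s : ℤ) + k = b - (s + 1) + (k + 1) by ring,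
        show i - (s : ℤ) + k = i - (s + 1) + (k + 1) by ring]
      ring

/-- In each of these ranges every term of the binomial expansion contains the reciprocal factorial
of a negative integer. -/
theorem transvect_eq_zero {s : ℕ} {l b i d : ℤ}
    (h : l < 0 ∨ b < 0 ∨ i < 0 ∨ d < 0 ∨ l + i < s ∨ b + d < s ∨ l + b < s ∨ i + d < s) :
    transvect s l b i d = 0 := by
  rw [transvect_eq_sum]
  refine Finset.sum_eq_zero fun k hk => ?_
  rw [Finset.mem_range] at hk
  have : l - k < 0 ∨ b - s + k < 0 ∨ i - s + k < 0 ∨ d - k < 0 := by omega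
  rcases this with h | h | h | h <;> rw [invFact_of_neg h] <;> ring

/-- Here no `y` is left in the product, so every `y` must be differentiated away and a single term
of the expansion survives. This is the highest-weight case. -/
theorem transvect_of_add_eq (l i : ℤ) (b d : ℕ) :
    transvect (b + d) l b i d =
      (-1) ^ d * (b + d).choose d * invFact (l - d) * invFact (i - b) := by
  rw [transvect_eq_sum, Finset.sum_eq_single d]
  · rw [show (b : ℤ) - (b + d : ℕ) + d = (0 : ℕ) by push_cast; ring,
      show i - (b + d : ℕ) + (d : ℤ) = i - b by push_cast; ring,
      show (d : ℤ) - d = (0 : ℕ) by push_cast; ring, invFact_natCast]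
    simp
    ring
  · intro k _ hk
    rcases lt_or_gt_of_ne hk with h | h
    · rw [invFact_of_neg (z := (b : ℤ) - (b + d : ℕ) + k) (by push_cast; omega)]; ring
    · rw [invFact_of_neg (z := (d : ℤ) - k) (by omega)]; ring
  · intro h; simp at h

theorem invFact_mul_invFact {s k : ℕ} (hk : k ≤ s) :
    invFact k * invFact ((s : ℤ) - k) = s.choose k * ((s.factorial : ℝ))⁻¹ := by
  rw [show (s : ℤ) - k = ((s - k : ℕ) : ℤ) by omega, invFact_natCast, invFact_natCast,
    Nat.cast_choose ℝ hk]
  have := Nat.factorial_ne_zero s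
  field_simp

/-- `√(i! (n-i)!)`. -/
def wt (n i : ℕ) : ℝ := Real.sqrt (i.factorial * (n - i).factorial)

theorem wt_pos (n i : ℕ) : 0 < wt n i := Real.sqrt_pos.2 (by positivity)

theorem wt_sq (n i : ℕ) : wt n i ^ 2 = i.factorial * (n - i).factorial :=
  Real.sq_sqrt (by positivity)

/-- The part of the Clebsch-Gordan coefficient which does not depend on the magnetic numbers. -/
def cgNorm (A B K : ℕ) : ℝ :=
  if Triad A B K then
    Real.sqrt (((K + 1 : ℕ) : ℝ) * (((K + A - B) / 2).factorial * ((K + B - A) / 2).factorial *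
        ((A + B - K) / 2).factorial) / ((A + B + K) / 2 + 1).factorial) *
      ((((A + B - K) / 2).factorial : ℝ))⁻¹
  else 0

/-- The part of the Clebsch-Gordan coefficient that is rational in the magnetic numbers, as a
function of integers. -/
def cgPoly (A B s : ℕ) (i l r : ℤ) : ℝ :=
  if r + s = i + l then transvect s l (B - l) i (A - i) else 0

/-- The binomial coefficients of the expansion account for `k! (s-k)!` up to `s!`, which `cgNorm`
absorbs. The second spin sits in the first factor of the transvectant; this order fixes the overall
sign. -/
theorem cg_eq (A B K : ℕ) (i : Fin (A + 1)) (l : Fin (B + 1)) (r : Fin (K + 1)) :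
    cg A B K i l r = cgNorm A B K * (wt A i * wt B l * wt K r *
      cgPoly A B ((A + B - K) / 2) (i : ℕ) (l : ℕ) (r : ℕ)) := by
  rw [cg, cgNorm, cgPoly]
  by_cases h1 : Triad A B K
  swap
  · rw [if_neg (fun h => h1 h.1), if_neg h1, zero_mul]
  set s := (A + B - K) / 2 with hs
  by_cases h2 : (r : ℕ) + s = i + l
  swap
  · rw [if_neg (fun h => h2 h.2), if_neg (c := ((r : ℕ) : ℤ) + s = (i : ℕ) + (l : ℕ)) (by omega)]
    simp
  rw [if_pos ⟨h1, h2⟩, if_pos h1,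
    if_pos (c := ((r : ℕ) : ℤ) + s = (i : ℕ) + (l : ℕ)) (by omega), transvect_eq_sum]
  have hw : Real.sqrt ((r : ℕ).factorial * (K - r : ℕ).factorial * (A - i : ℕ).factorial *
        (i : ℕ).factorial * (B - l : ℕ).factorial * (l : ℕ).factorial) =
        wt A i * wt B l * wt K r := by
    rw [wt, wt, wt, ← Real.sqrt_mul (by positivity), ← Real.sqrt_mul (by positivity)]
    congr 1
    ring
  rw [hw, Finset.mul_sum, Finset.mul_sum, Finset.mul_sum]
  refine Finset.sum_congr rfl fun k hk => ?_
  rw [Finset.mem_range] at hk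
  rw [invFact_mul_invFact (by omega),
    show (B : ℤ) - s - (l : ℕ) + k = B - (l : ℕ) - s + k by ring]
  ring

/-- Exchanging the tensor factors changes the sign of `Ω`, hence multiplies its `s`-th power by
`(-1)^s`. -/
theorem cg_swap (A B K : ℕ) (i : Fin (A + 1)) (l : Fin (B + 1)) (r : Fin (K + 1)) :
    cg B A K l i r = (-1) ^ ((A + B - K) / 2) * cg A B K i l r := by
  have h1 : cgNorm B A K = cgNorm A B K := by
    simp only [cgNorm]
    have h : Triad B A K ↔ Triad A B K := by
      rw [Triad, Triad, add_comm B A]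
      tauto
    by_cases hT : Triad A B K
    · rw [if_pos hT, if_pos (h.2 hT), add_comm B A]
      congr 4
      ring
    · rw [if_neg hT, if_neg (h.not.2 hT)]
  rw [cg_eq, cg_eq, h1, show B + A - K = A + B - K by omega]
  have h2 : cgPoly B A ((A + B - K) / 2) (l : ℕ) (i : ℕ) (r : ℕ) =
      (-1) ^ ((A + B - K) / 2) * cgPoly A B ((A + B - K) / 2) (i : ℕ) (l : ℕ) (r : ℕ) := by
    simp only [cgPoly, add_comm ((l : ℕ) : ℤ)]
    split_ifs
    · rw [transvect_swap]
    · simp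
  rw [h2]; ring

end
end Jordanian

namespace Jordanian
open scoped Kronecker PowerSeries Matrix
noncomputable section

set_option linter.unusedSectionVars false

/-! ### Intertwiners of `sl(2)` -/

section Intertwiners

variable {R : Type*} [CommRing R] {ι κ μ ν : Type*} [Fintype ι] [DecidableEq ι] [Fintype κ]
  [DecidableEq κ] [Fintype μ] [DecidableEq μ] [Fintype ν] [DecidableEq ν]

/-- The undeformed tensor product of representations. -/
def tensorZero (M : Generators ι R) (N : Generators κ R) : Generators (ι × κ) R where
  Jp := M.Jp ⊗ₖ 1 + 1 ⊗ₖ N.Jp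
  Jm := M.Jm ⊗ₖ 1 + 1 ⊗ₖ N.Jm
  J0 := M.J0 ⊗ₖ 1 + 1 ⊗ₖ N.J0

/-- The matrix `U` intertwines the representation `N` with the representation `M`. -/
structure Intertwines (M : Generators ι R) (N : Generators κ R) (U : Matrix ι κ R) : Prop where
  jp : M.Jp * U = U * N.Jp
  jm : M.Jm * U = U * N.Jm
  j0 : M.J0 * U = U * N.J0

theorem mul_intertwine_comp {M : Matrix ι ι R} {N : Matrix κ κ R} {P : Matrix μ μ R}
    {U : Matrix ι κ R} {V : Matrix κ μ R} (hU : M * U = U * N) (hV : N * V = V * P) :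
    M * (U * V) = U * V * P := by
  rw [← Matrix.mul_assoc, hU, Matrix.mul_assoc, hV, Matrix.mul_assoc]

theorem Intertwines.mul {M : Generators ι R} {N : Generators κ R} {P : Generators μ R}
    {U : Matrix ι κ R} {V : Matrix κ μ R} (hU : Intertwines M N U) (hV : Intertwines N P V) :
    Intertwines M P (U * V) :=
  ⟨mul_intertwine_comp hU.jp hV.jp, mul_intertwine_comp hU.jm hV.jm,
    mul_intertwine_comp hU.j0 hV.j0⟩

theorem kronecker_one_intertwine {M : Matrix ι ι R} {N : Matrix κ κ R} {U : Matrix ι κ R}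
    (P : Matrix μ μ R) (hU : M * U = U * N) :
    (M ⊗ₖ 1 + 1 ⊗ₖ P : Matrix (ι × μ) (ι × μ) R) * (U ⊗ₖ (1 : Matrix μ μ R)) = (U ⊗ₖ (1 : Matrix μ μ R)) * (N ⊗ₖ 1 + 1 ⊗ₖ P) := by
  simp only [Matrix.add_mul, Matrix.mul_add, ← Matrix.mul_kronecker_mul, hU, Matrix.one_mul,
    Matrix.mul_one]

theorem one_kronecker_intertwine {M : Matrix ι ι R} {N : Matrix κ κ R} {U : Matrix ι κ R}
    (P : Matrix μ μ R) (hU : M * U = U * N) :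
    (P ⊗ₖ 1 + 1 ⊗ₖ M : Matrix (μ × ι) (μ × ι) R) * ((1 : Matrix μ μ R) ⊗ₖ U) = ((1 : Matrix μ μ R) ⊗ₖ U) * (P ⊗ₖ 1 + 1 ⊗ₖ N) := by
  simp only [Matrix.add_mul, Matrix.mul_add, ← Matrix.mul_kronecker_mul, hU, Matrix.one_mul,
    Matrix.mul_one]

theorem Intertwines.kronecker_one {M : Generators ι R} {N : Generators κ R} {U : Matrix ι κ R}
    (hU : Intertwines M N U) (P : Generators μ R) :
    Intertwines (tensorZero M P) (tensorZero N P) (U ⊗ₖ (1 : Matrix μ μ R)) :=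
  ⟨kronecker_one_intertwine _ hU.jp, kronecker_one_intertwine _ hU.jm,
    kronecker_one_intertwine _ hU.j0⟩

theorem Intertwines.one_kronecker {M : Generators ι R} {N : Generators κ R} {U : Matrix ι κ R}
    (hU : Intertwines M N U) (P : Generators μ R) :
    Intertwines (tensorZero P M) (tensorZero P N) ((1 : Matrix μ μ R) ⊗ₖ U) :=
  ⟨one_kronecker_intertwine _ hU.jp, one_kronecker_intertwine _ hU.jm,
    one_kronecker_intertwine _ hU.j0⟩

/-- Reassociation of the rows of a matrix. -/
def assocRows (U : Matrix (ι × (κ × μ)) ν R) : Matrix ((ι × κ) × μ) ν R :=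
  U.submatrix (Equiv.prodAssoc ι κ μ) id

theorem Intertwines.assocRows {M : Generators ι R} {N : Generators κ R} {P : Generators μ R}
    {Q : Generators ν R} {U : Matrix (ι × (κ × μ)) ν R}
    (hU : Intertwines (tensorZero M (tensorZero N P)) Q U) :
    Intertwines (tensorZero (tensorZero M N) P) Q (assocRows U) := by
  have key : ∀ (X : Matrix ι ι R) (Y : Matrix κ κ R) (Z : Matrix μ μ R) (W : Matrix ν ν R),
      (X ⊗ₖ 1 + 1 ⊗ₖ (Y ⊗ₖ 1 + 1 ⊗ₖ Z)) * U = U * W →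
      ((X ⊗ₖ 1 + 1 ⊗ₖ Y) ⊗ₖ 1 + 1 ⊗ₖ Z) * Jordanian.assocRows U =
        Jordanian.assocRows U * W := by
    intro X Y Z W h
    have h1 : ((X ⊗ₖ 1 + 1 ⊗ₖ Y) ⊗ₖ 1 + 1 ⊗ₖ Z : Matrix ((ι × κ) × μ) ((ι × κ) × μ) R) =
        (X ⊗ₖ 1 + 1 ⊗ₖ (Y ⊗ₖ 1 + 1 ⊗ₖ Z) :
          Matrix (ι × (κ × μ)) (ι × (κ × μ)) R).submatrix (Equiv.prodAssoc ι κ μ)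
          (Equiv.prodAssoc ι κ μ) := by
      rw [← Matrix.one_kronecker_one (m := κ) (n := μ), ← Matrix.one_kronecker_one (m := ι) (n := κ)]
      ext ⟨⟨i, k⟩, l⟩ ⟨⟨i', k'⟩, l'⟩
      simp only [Matrix.add_apply, Matrix.kroneckerMap_apply, Matrix.submatrix_apply,
        Equiv.prodAssoc_apply]
      ring
    rw [h1, Jordanian.assocRows, Matrix.submatrix_mul_equiv, h]
    rfl
  exact ⟨key _ _ _ _ hU.jp, key _ _ _ _ hU.jm, key _ _ _ _ hU.j0⟩

theorem kronecker_one_mul_apply (X : Matrix ι ι R) (U : Matrix (ι × κ) μ R) (i : ι) (k : κ)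
    (r : μ) : ((X ⊗ₖ (1 : Matrix κ κ R)) * U) (i, k) r = ∑ i', X i i' * U (i', k) r := by
  rw [Matrix.mul_apply, Fintype.sum_prod_type]
  refine Finset.sum_congr rfl fun i' _ => ?_
  simp [Matrix.one_apply]

theorem one_kronecker_mul_apply (X : Matrix κ κ R) (U : Matrix (ι × κ) μ R) (i : ι) (k : κ)
    (r : μ) : (((1 : Matrix ι ι R) ⊗ₖ X) * U) (i, k) r = ∑ k', X k k' * U (i, k') r := by
  rw [Matrix.mul_apply, Fintype.sum_prod_type, Finset.sum_eq_single i]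
  · simp
  · intro i' _ h
    simp [h.symm]
  · simp

end Intertwiners

theorem spin_Jp_transpose (n : ℕ) : (spin ℝ n).Jpᵀ = (spin ℝ n).Jm := by
  ext k i
  simp only [spin, Matrix.transpose_apply, Matrix.of_apply]
  split_ifs with h
  · rw [h]; push_cast; congr 2; ring
  · rfl

theorem spin_Jm_transpose (n : ℕ) : (spin ℝ n).Jmᵀ = (spin ℝ n).Jp := by
  rw [← spin_Jp_transpose, Matrix.transpose_transpose]

theorem spin_J0_transpose (n : ℕ) : (spin ℝ n).J0ᵀ = (spin ℝ n).J0 := by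
  simp [spin, Matrix.diagonal_transpose]

theorem Intertwines.transpose_spin {m n : ℕ} {U : Matrix (Fin (m + 1)) (Fin (n + 1)) ℝ}
    (hU : Intertwines (spin ℝ m) (spin ℝ n) U) : Intertwines (spin ℝ n) (spin ℝ m) Uᵀ := by
  refine ⟨?_, ?_, ?_⟩
  · have := congrArg Matrix.transpose hU.jm
    simpa [Matrix.transpose_mul, spin_Jm_transpose] using this.symm
  · have := congrArg Matrix.transpose hU.jp
    simpa [Matrix.transpose_mul, spin_Jp_transpose] using this.symm
  · have := congrArg Matrix.transpose hU.j0
    simpa [Matrix.transpose_mul, spin_J0_transpose] using this.symm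

/-- Rescaling the basis by `wt` removes the square roots from the ladder operators, leaving integer
matrix elements. -/
theorem wt_raise {n k : ℕ} (hk : k < n) :
    Real.sqrt (((n : ℝ) - k) * (k + 1)) * wt n k = wt n (k + 1) * (n - k) := by
  obtain ⟨m, rfl⟩ : ∃ m, n = k + 1 + m := ⟨n - k - 1, by omega⟩
  have h1 : (0 : ℝ) ≤ ((k + 1 + m : ℕ) : ℝ) - k := by push_cast; linarith [m.cast_nonneg (α := ℝ)]
  have h2 : (((k + 1 + m : ℕ) : ℝ) - k) = Real.sqrt ((((k + 1 + m : ℕ) : ℝ) - k) ^ 2) :=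
    (Real.sqrt_sq h1).symm
  rw [wt, wt, ← Real.sqrt_mul (by positivity)]
  conv_rhs => rw [h2]
  rw [← Real.sqrt_mul (by positivity), show k + 1 + m - k = m + 1 by omega,
    show k + 1 + m - (k + 1) = m by omega, Nat.factorial_succ, Nat.factorial_succ]
  congr 1
  push_cast
  ring

theorem wt_lower {n k : ℕ} (hk : k < n) :
    Real.sqrt (((n : ℝ) - k) * (k + 1)) * wt n (k + 1) = wt n k * (k + 1) := by
  have h1 := wt_raise hk
  have h2 : (0 : ℝ) < n - k := by
    have : (k : ℝ) < n := by exact_mod_cast hk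
    linarith
  have h3 := Real.sq_sqrt (show 0 ≤ ((n : ℝ) - k) * (k + 1) by positivity)
  have h4 : (n - k : ℝ) * (Real.sqrt (((n : ℝ) - k) * (k + 1)) * wt n (k + 1)) =
      (n - k) * (wt n k * (k + 1)) := by
    linear_combination wt n k * h3 - Real.sqrt (((n : ℝ) - k) * (k + 1)) * h1
  exact mul_left_cancel₀ h2.ne' h4

/-- The value of `g` at `-1` stands in for the missing neighbour at the end of the ladder, so that
one formula covers every index. -/
theorem sum_spin_Jp (n : ℕ) (g : ℤ → ℝ) (hg : g (-1) = 0) (k : Fin (n + 1)) :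
    ∑ i : Fin (n + 1), (spin ℝ n).Jp k i * (wt n i * g (i : ℕ)) =
      wt n k * ((n - (k : ℕ) + 1) * g ((k : ℕ) - 1)) := by
  obtain ⟨k, hk⟩ := k
  rcases k with _ | k
  · simp only [spin, Matrix.of_apply]
    simp [hg]
  · rw [Finset.sum_eq_single ⟨k, by omega⟩]
    · have := wt_raise (n := n) (k := k) (by omega)
      simp only [spin, Matrix.of_apply, if_true, Algebra.algebraMap_self_apply]
      rw [← mul_assoc, this]
      push_cast
      ring_nf
    · intro i _ hi
      simp only [spin, Matrix.of_apply]
      rw [if_neg (fun h => hi (Fin.ext (by simpa using (Nat.succ_injective h).symm))), zero_mul]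
    · simp

theorem sum_spin_Jm (n : ℕ) (g : ℤ → ℝ) (hg : g (n + 1) = 0) (k : Fin (n + 1)) :
    ∑ i : Fin (n + 1), (spin ℝ n).Jm k i * (wt n i * g (i : ℕ)) =
      wt n k * (((k : ℕ) + 1) * g ((k : ℕ) + 1)) := by
  obtain ⟨k, hk⟩ := k
  by_cases hkn : k < n
  · rw [Finset.sum_eq_single ⟨k + 1, by omega⟩]
    · have := wt_lower hkn
      simp only [spin, Matrix.of_apply, if_true, Algebra.algebraMap_self_apply]
      push_cast
      rw [show ((k : ℝ) + 1) * (n - (k + 1) + 1) = (n - k) * (k + 1) by ring, ← mul_assoc, this]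
      ring
    · intro i _ hi
      simp only [spin, Matrix.of_apply]
      rw [if_neg (fun h => hi (Fin.ext (by simpa using h))), zero_mul]
    · simp
  · obtain rfl : k = n := by omega
    rw [hg, mul_zero, mul_zero]
    refine Finset.sum_eq_zero fun i _ => ?_
    simp only [spin, Matrix.of_apply]
    rw [if_neg (by have := i.2; omega), zero_mul]

/-- The matrix of Clebsch-Gordan coefficients. -/
def cgMatrix (A B K : ℕ) : Matrix (Fin (A + 1) × Fin (B + 1)) (Fin (K + 1)) ℝ :=
  Matrix.of fun p r => cg A B K p.1 p.2 r

theorem cgMatrix_of_not_triad {A B K : ℕ} (h : ¬ Triad A B K) : cgMatrix A B K = 0 := by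
  ext p r
  rw [cgMatrix, Matrix.of_apply, cg, if_neg (fun h' => h h'.1)]
  rfl

theorem Triad.exists_eq {A B K : ℕ} (h : Triad A B K) :
    ∃ p q s, A = p + s ∧ B = q + s ∧ K = p + q := by
  obtain ⟨⟨t, ht⟩, h1, h2, h3⟩ := h
  exact ⟨t - B, t - A, t - K, by omega, by omega, by omega⟩

theorem cgMatrix_apply (p q s : ℕ) (i : Fin (p + s + 1)) (l : Fin (q + s + 1))
    (r : Fin (p + q + 1)) : cgMatrix (p + s) (q + s) (p + q) (i, l) r =
      cgNorm (p + s) (q + s) (p + q) * (wt (p + s) i * wt (q + s) l * wt (p + q) r *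
      cgPoly (p + s) (q + s) s (i : ℕ) (l : ℕ) (r : ℕ)) := by
  rw [cgMatrix, Matrix.of_apply, cg_eq, show (p + s + (q + s) - (p + q)) / 2 = s by omega]

/-- Once `wt` has absorbed the square roots, the relations for `J₊` and `J₋` are `transvect_raise`
and `transvect_lower`, and the one for `J₀` is the weight condition `r + s = i + l`. -/
theorem cgMatrix_intertwines (A B K : ℕ) :
    Intertwines (tensorZero (spin ℝ A) (spin ℝ B)) (spin ℝ K) (cgMatrix A B K) := by
  by_cases hT : Triad A B K
  swap
  · rw [cgMatrix_of_not_triad hT]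
    constructor <;> simp
  obtain ⟨p, q, s, rfl, rfl, rfl⟩ := hT.exists_eq
  set N := cgNorm (p + s) (q + s) (p + q)
  refine ⟨?_, ?_, ?_⟩
  · ext ⟨i, l⟩ r
    simp only [tensorZero]
    rw [Matrix.add_mul, Matrix.add_apply, kronecker_one_mul_apply, one_kronecker_mul_apply,
      Matrix.mul_apply]
    simp only [cgMatrix_apply]
    have e1 := sum_spin_Jp (p + s) (fun z => N * wt (q + s) l * wt (p + q) r *
      cgPoly (p + s) (q + s) s z (l : ℕ) (r : ℕ)) (by
        rw [cgPoly, transvect_eq_zero (by omega)]; simp) i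
    have e2 := sum_spin_Jp (q + s) (fun z => N * wt (p + s) i * wt (p + q) r *
      cgPoly (p + s) (q + s) s (i : ℕ) z (r : ℕ)) (by
        rw [cgPoly, transvect_eq_zero (by omega)]; simp) l
    -- On the right side `J₊` acts on the column index, that is, through its transpose `J₋`.
    have e3 := sum_spin_Jm (p + q) (fun z => N * wt (p + s) i * wt (q + s) l *
      cgPoly (p + s) (q + s) s (i : ℕ) (l : ℕ) z) (by
        rw [cgPoly]
        split_ifs with h
        · rw [transvect_eq_zero (by push_cast at *; omega)]; simp
        · simp) r
    rw [← spin_Jp_transpose] at e3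
    simp only [Matrix.transpose_apply] at e3
    have e4 : ((p + s : ℕ) - (i : ℕ) + 1 : ℝ) *
          cgPoly (p + s) (q + s) s ((i : ℕ) - 1) (l : ℕ) (r : ℕ) +
        ((q + s : ℕ) - (l : ℕ) + 1 : ℝ) *
          cgPoly (p + s) (q + s) s (i : ℕ) ((l : ℕ) - 1) (r : ℕ) =
        ((r : ℕ) + 1) * cgPoly (p + s) (q + s) s (i : ℕ) (l : ℕ) ((r : ℕ) + 1) := by
      by_cases h : ((r : ℕ) : ℤ) + 1 + s = (i : ℕ) + (l : ℕ)
      · simp only [cgPoly]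
        rw [if_pos (by omega), if_pos (by omega), if_pos (by omega)]
        have := transvect_raise s (l : ℕ) ((q + s : ℕ) - (l : ℕ)) (i : ℕ) ((p + s : ℕ) - (i : ℕ))
        have hr : ((r : ℕ) : ℝ) + 1 = (i : ℕ) + (l : ℕ) - s := by
          have : ((r : ℕ) : ℝ) + 1 + s = (i : ℕ) + (l : ℕ) := by exact_mod_cast h
          linarith
        rw [hr, show ((p + s : ℕ) : ℤ) - ((i : ℕ) - 1) = (p + s : ℕ) - (i : ℕ) + 1 by ring,
          show ((q + s : ℕ) : ℤ) - ((l : ℕ) - 1) = (q + s : ℕ) - (l : ℕ) + 1 by ring]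
        push_cast at this ⊢
        exact this
      · simp only [cgPoly]
        rw [if_neg (by omega), if_neg (by omega), if_neg (by omega)]
        simp
    calc _ = (∑ i' : Fin (p + s + 1), (spin ℝ (p + s)).Jp i i' * (wt (p + s) i' *
            (N * wt (q + s) l * wt (p + q) r *
              cgPoly (p + s) (q + s) s (i' : ℕ) (l : ℕ) (r : ℕ)))) +
          ∑ l' : Fin (q + s + 1), (spin ℝ (q + s)).Jp l l' * (wt (q + s) l' *
            (N * wt (p + s) i * wt (p + q) r *
              cgPoly (p + s) (q + s) s (i : ℕ) (l' : ℕ) (r : ℕ))) := by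
          congr 1 <;> refine Finset.sum_congr rfl fun _ _ => ?_ <;> ring
      _ = ∑ r' : Fin (p + q + 1), (spin ℝ (p + q)).Jp r' r * (wt (p + q) r' *
            (N * wt (p + s) i * wt (q + s) l *
              cgPoly (p + s) (q + s) s (i : ℕ) (l : ℕ) (r' : ℕ))) := by
          rw [e1, e2, e3]
          linear_combination wt (p + s) i * wt (q + s) l * wt (p + q) r * N * e4
      _ = _ := by refine Finset.sum_congr rfl fun _ _ => ?_; ring
  · ext ⟨i, l⟩ r
    simp only [tensorZero]
    rw [Matrix.add_mul, Matrix.add_apply, kronecker_one_mul_apply, one_kronecker_mul_apply,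
      Matrix.mul_apply]
    simp only [cgMatrix_apply]
    have e1 := sum_spin_Jm (p + s) (fun z => N * wt (q + s) l * wt (p + q) r *
      cgPoly (p + s) (q + s) s z (l : ℕ) (r : ℕ)) (by
        rw [cgPoly, transvect_eq_zero (by push_cast; omega)]; simp) i
    have e2 := sum_spin_Jm (q + s) (fun z => N * wt (p + s) i * wt (p + q) r *
      cgPoly (p + s) (q + s) s (i : ℕ) z (r : ℕ)) (by
        rw [cgPoly, transvect_eq_zero (by push_cast; omega)]; simp) l
    have e3 := sum_spin_Jp (p + q) (fun z => N * wt (p + s) i * wt (q + s) l *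
      cgPoly (p + s) (q + s) s (i : ℕ) (l : ℕ) z) (by
        rw [cgPoly]
        split_ifs with h
        · rw [transvect_eq_zero (by push_cast at *; omega)]; simp
        · simp) r
    rw [← spin_Jm_transpose] at e3
    simp only [Matrix.transpose_apply] at e3
    have e4 : ((i : ℕ) + 1 : ℝ) *
          cgPoly (p + s) (q + s) s ((i : ℕ) + 1) (l : ℕ) (r : ℕ) +
        ((l : ℕ) + 1 : ℝ) *
          cgPoly (p + s) (q + s) s (i : ℕ) ((l : ℕ) + 1) (r : ℕ) =
        ((p + q : ℕ) - (r : ℕ) + 1) *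
          cgPoly (p + s) (q + s) s (i : ℕ) (l : ℕ) ((r : ℕ) - 1) := by
      by_cases h : ((r : ℕ) : ℤ) - 1 + s = (i : ℕ) + (l : ℕ)
      · simp only [cgPoly]
        rw [if_pos (by omega), if_pos (by omega), if_pos (by omega)]
        have := transvect_lower s (l : ℕ) ((q + s : ℕ) - (l : ℕ)) (i : ℕ) ((p + s : ℕ) - (i : ℕ))
        have hr : ((r : ℕ) : ℝ) - 1 + s = (i : ℕ) + (l : ℕ) := by exact_mod_cast h
        have hr' : ((p + q : ℕ) : ℝ) - (r : ℕ) + 1 =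
            ((q + s : ℕ) : ℝ) - (l : ℕ) + ((p + s : ℕ) - (i : ℕ)) - s := by
          push_cast
          linarith
        rw [hr', show ((p + s : ℕ) : ℤ) - ((i : ℕ) + 1) = (p + s : ℕ) - (i : ℕ) - 1 by ring,
          show ((q + s : ℕ) : ℤ) - ((l : ℕ) + 1) = (q + s : ℕ) - (l : ℕ) - 1 by ring]
        push_cast at this ⊢
        exact this
      · simp only [cgPoly]
        rw [if_neg (by omega), if_neg (by omega), if_neg (by omega)]
        simp
    calc _ = (∑ i' : Fin (p + s + 1), (spin ℝ (p + s)).Jm i i' * (wt (p + s) i' *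
            (N * wt (q + s) l * wt (p + q) r *
              cgPoly (p + s) (q + s) s (i' : ℕ) (l : ℕ) (r : ℕ)))) +
          ∑ l' : Fin (q + s + 1), (spin ℝ (q + s)).Jm l l' * (wt (q + s) l' *
            (N * wt (p + s) i * wt (p + q) r *
              cgPoly (p + s) (q + s) s (i : ℕ) (l' : ℕ) (r : ℕ))) := by
          congr 1 <;> refine Finset.sum_congr rfl fun _ _ => ?_ <;> ring
      _ = ∑ r' : Fin (p + q + 1), (spin ℝ (p + q)).Jm r' r * (wt (p + q) r' *
            (N * wt (p + s) i * wt (q + s) l *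
              cgPoly (p + s) (q + s) s (i : ℕ) (l : ℕ) (r' : ℕ))) := by
          rw [e1, e2, e3]
          linear_combination wt (p + s) i * wt (q + s) l * wt (p + q) r * N * e4
      _ = _ := by refine Finset.sum_congr rfl fun _ _ => ?_; ring
  · ext ⟨i, l⟩ r
    simp only [tensorZero]
    rw [Matrix.add_mul, Matrix.add_apply, kronecker_one_mul_apply, one_kronecker_mul_apply]
    simp only [spin, Matrix.mul_diagonal, Matrix.diagonal_apply, ite_mul, zero_mul,
      Finset.sum_ite_eq, Finset.mem_univ, if_true, cgMatrix_apply, cgPoly]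
    split_ifs with h
    · have h' : ((r : ℕ) : ℝ) + s = (i : ℕ) + (l : ℕ) := by exact_mod_cast h
      push_cast
      rw [show ((r : ℕ) : ℝ) = (i : ℕ) + (l : ℕ) - s by linarith]
      ring
    · simp

end
end Jordanian

namespace Jordanian
open scoped Kronecker PowerSeries Matrix
noncomputable section

set_option linter.unusedSectionVars false

/-! ### Schur's lemma and orthogonality of the Clebsch-Gordan coefficients -/

theorem spin_Jp_apply_succ {n k : ℕ} (hk : k < n) :
    (spin ℝ n).Jp ⟨k + 1, by omega⟩ ⟨k, by omega⟩ = Real.sqrt (((n : ℝ) - k) * (k + 1)) := by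
  simp [spin]

theorem sqrt_ladder_pos {n k : ℕ} (hk : k < n) : 0 < Real.sqrt (((n : ℝ) - k) * (k + 1)) := by
  have : (k : ℝ) < n := by exact_mod_cast hk
  exact Real.sqrt_pos.2 (mul_pos (by linarith) (by positivity))

theorem mul_spin_Jp_apply {m n k : ℕ} (M : Matrix (Fin m) (Fin (n + 1)) ℝ) (hk : k < n)
    (i : Fin m) : (M * (spin ℝ n).Jp) i ⟨k, by omega⟩ =
      M i ⟨k + 1, by omega⟩ * Real.sqrt (((n : ℝ) - k) * (k + 1)) := by
  rw [Matrix.mul_apply, Finset.sum_eq_single ⟨k + 1, by omega⟩, spin_Jp_apply_succ hk]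
  · intro j _ hj
    simp only [spin, Matrix.of_apply]
    rw [if_neg (fun h => hj (Fin.ext h)), mul_zero]
  · simp

theorem Intertwines.weight_eq {m n : ℕ} {M : Matrix (Fin (m + 1)) (Fin (n + 1)) ℝ}
    (hM : Intertwines (spin ℝ m) (spin ℝ n) M) {i : Fin (m + 1)} {k : Fin (n + 1)}
    (h : M i k ≠ 0) : 2 * (i : ℕ) + n = 2 * (k : ℕ) + m := by
  have h1 := congrFun (congrFun hM.j0 i) k
  simp only [spin, Matrix.mul_diagonal, Matrix.diagonal_mul] at h1
  have h2 : (2 * ((i : ℕ) : ℝ) + n) = 2 * (k : ℕ) + m := by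
    have := mul_left_cancel₀ h ((mul_comm _ _).trans h1)
    linarith
  exact_mod_cast h2

/-- The lowest weight of the larger spin does not occur in the smaller one, so the first column
vanishes; `J₊` carries the zeros from each column to the next. -/
theorem Intertwines.eq_zero_of_lt {m n : ℕ} (hmn : m < n)
    {M : Matrix (Fin (m + 1)) (Fin (n + 1)) ℝ} (hM : Intertwines (spin ℝ m) (spin ℝ n) M) :
    M = 0 := by
  have key : ∀ (k : ℕ) (hk : k < n + 1) (i : Fin (m + 1)), M i ⟨k, hk⟩ = 0 := by
    intro k
    induction k with
    | zero =>
      intro hk i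
      by_contra h
      have := hM.weight_eq h
      have := i.2
      simp at *
      omega
    | succ k ih =>
      intro hk i
      have h1 := congrFun (congrFun hM.jp i) ⟨k, by omega⟩
      rw [mul_spin_Jp_apply M (by omega), Matrix.mul_apply,
        Finset.sum_eq_zero (fun j _ => by rw [ih, mul_zero])] at h1
      exact (mul_eq_zero.1 h1.symm).resolve_right (sqrt_ladder_pos (by omega)).ne'
  ext i ⟨k, hk⟩
  exact key k hk i

theorem Intertwines.eq_zero_of_ne {m n : ℕ} (hmn : m ≠ n)
    {M : Matrix (Fin (m + 1)) (Fin (n + 1)) ℝ} (hM : Intertwines (spin ℝ m) (spin ℝ n) M) :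
    M = 0 := by
  rcases lt_or_gt_of_ne hmn with h | h
  · exact hM.eq_zero_of_lt h
  · rw [← Matrix.transpose_transpose M, hM.transpose_spin.eq_zero_of_lt h, Matrix.transpose_zero]

/-- Weights are simple, so the matrix is diagonal, and commuting with `J₊` makes neighbouring
diagonal entries equal. -/
theorem Intertwines.eq_smul_one {n : ℕ} {M : Matrix (Fin (n + 1)) (Fin (n + 1)) ℝ}
    (hM : Intertwines (spin ℝ n) (spin ℝ n) M) (j : Fin (n + 1)) : M = M j j • 1 := by
  have hd : ∀ i k, i ≠ k → M i k = 0 := by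
    intro i k hik
    by_contra h
    exact hik (Fin.ext (by have := hM.weight_eq h; omega))
  have key : ∀ (k : ℕ) (hk : k < n + 1), M ⟨k, hk⟩ ⟨k, hk⟩ = M 0 0 := by
    intro k
    induction k with
    | zero => intro _; rfl
    | succ k ih =>
      intro hk
      have h1 := congrFun (congrFun hM.jp ⟨k + 1, hk⟩) ⟨k, by omega⟩
      rw [mul_spin_Jp_apply M (by omega), Matrix.mul_apply, Finset.sum_eq_single ⟨k, by omega⟩,
        spin_Jp_apply_succ (by omega), ih, mul_comm] at h1
      · exact (mul_right_cancel₀ (sqrt_ladder_pos (by omega)).ne' h1).symm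
      · intro j _ hj
        rw [hd _ _ hj, mul_zero]
      · simp
  ext i k
  rw [Matrix.smul_apply, Matrix.one_apply]
  split_ifs with h
  · subst h
    rw [key i i.2, key j j.2, smul_eq_mul, mul_one]
  · rw [hd i k h, smul_zero]

/-- Compare coefficients in `(1-X)^{-(p+1)} (1-X)^{-(q+1)} = (1-X)^{-(p+q+2)}`. -/
theorem sum_antidiagonal_choose_mul_choose (p q s : ℕ) :
    ∑ x ∈ Finset.HasAntidiagonal.antidiagonal s, (p + x.1).choose p * (q + x.2).choose q =
      (p + q + 1 + s).choose (p + q + 1) := by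
  have h := congrArg (fun u : (ℚ⟦X⟧)ˣ => PowerSeries.coeff s (u : ℚ⟦X⟧))
    (PowerSeries.invOneSubPow_add (S := ℚ) (p + 1) (q + 1))
  simp only [Units.val_mul] at h
  rw [show p + 1 + (q + 1) = p + q + 1 + 1 by ring, PowerSeries.coeff_mul] at h
  simp only [PowerSeries.invOneSubPow_val_succ_eq_mk_add_choose, PowerSeries.coeff_mk] at h
  exact_mod_cast h.symm

theorem tensorZero_spin_transpose (A B : ℕ) :
    (tensorZero (spin ℝ A) (spin ℝ B)).Jpᵀ = (tensorZero (spin ℝ A) (spin ℝ B)).Jm ∧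
    (tensorZero (spin ℝ A) (spin ℝ B)).J0ᵀ = (tensorZero (spin ℝ A) (spin ℝ B)).J0 := by
  constructor <;>
  simp only [tensorZero, Matrix.transpose_add, ← Matrix.kroneckerMap_transpose,
    Matrix.transpose_one, spin_Jp_transpose, spin_J0_transpose]

theorem Intertwines.transpose {ι : Type*} [Fintype ι] [DecidableEq ι] {M : Generators ι ℝ} {n : ℕ}
    (hp : M.Jpᵀ = M.Jm) (h0 : M.J0ᵀ = M.J0) {U : Matrix ι (Fin (n + 1)) ℝ}
    (hU : Intertwines M (spin ℝ n) U) : Intertwines (spin ℝ n) M Uᵀ := by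
  have hm : M.Jmᵀ = M.Jp := by rw [← hp, Matrix.transpose_transpose]
  refine ⟨?_, ?_, ?_⟩
  · have := congrArg Matrix.transpose hU.jm
    simpa [Matrix.transpose_mul, spin_Jm_transpose, hm] using this.symm
  · have := congrArg Matrix.transpose hU.jp
    simpa [Matrix.transpose_mul, spin_Jp_transpose, hp] using this.symm
  · have := congrArg Matrix.transpose hU.j0
    simpa [Matrix.transpose_mul, spin_J0_transpose, h0] using this.symm

theorem cgMatrix_gram_intertwines (A B K K' : ℕ) :
    Intertwines (spin ℝ K) (spin ℝ K') ((cgMatrix A B K)ᵀ * cgMatrix A B K') :=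
  ((cgMatrix_intertwines A B K).transpose (tensorZero_spin_transpose A B).1
    (tensorZero_spin_transpose A B).2).mul (cgMatrix_intertwines A B K')

theorem cgNorm_sq (p q s : ℕ) : cgNorm (p + s) (q + s) (p + q) ^ 2 =
    (p + q + 1) * (p.factorial * q.factorial) / ((p + q + s + 1).factorial * s.factorial) := by
  have hT : Triad (p + s) (q + s) (p + q) := ⟨⟨p + q + s, by ring⟩, by omega, by omega, by omega⟩
  rw [cgNorm, if_pos hT, show (p + s + (q + s) - (p + q)) / 2 = s by omega,
    show (p + q + (p + s) - (q + s)) / 2 = p by omega,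
    show (p + q + (q + s) - (p + s)) / 2 = q by omega,
    show (p + s + (q + s) + (p + q)) / 2 = p + q + s by omega, mul_pow,
    Real.sq_sqrt (by positivity)]
  have := Nat.factorial_ne_zero s
  have := Nat.factorial_ne_zero (p + q + s + 1)
  push_cast
  field_simp

theorem highest_term (p q s : ℕ) (x : ℕ × ℕ) (hx : x ∈ Finset.HasAntidiagonal.antidiagonal s) :
    (wt (p + s) (p + x.1) * wt (q + s) (q + x.2) * wt (p + q) (p + q) *
      transvect s (q + x.2 : ℕ) x.1 (p + x.1 : ℕ) x.2) ^ 2 =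
    (p + q).factorial * s.factorial ^ 2 / (p.factorial * q.factorial) *
      ((p + x.1).choose p * (q + x.2).choose q : ℕ) := by
  rw [Finset.HasAntidiagonal.mem_antidiagonal] at hx
  obtain ⟨b, d⟩ := x
  simp only at *
  subst hx
  rw [transvect_of_add_eq, show (((q + d : ℕ) : ℤ) - d) = (q : ℕ) by push_cast; ring,
    show (((p + b : ℕ) : ℤ) - b) = (p : ℕ) by push_cast; ring, invFact_natCast, invFact_natCast]
  simp only [mul_pow, wt_sq]
  rw [show p + (b + d) - (p + b) = d by omega, show q + (b + d) - (q + d) = b by omega,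
    Nat.sub_self, Nat.cast_mul, Nat.cast_add_choose, Nat.cast_add_choose,
    show (b + d).choose d = (b + d).choose b from Nat.choose_symm_add.symm,
    Nat.cast_add_choose]
  have := Nat.factorial_ne_zero b
  have := Nat.factorial_ne_zero d
  have := Nat.factorial_ne_zero p
  have := Nat.factorial_ne_zero q
  rw [← pow_mul, mul_comm d 2, pow_mul]
  norm_num
  field_simp

/-- At highest weight each transvectant is a single product, and the sum of squares becomes a
convolution of binomial coefficients. By Schur's lemma this one entry determines the whole Gram
matrix. -/
theorem cgMatrix_highest_norm (p q s : ℕ) :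
    ((cgMatrix (p + s) (q + s) (p + q))ᵀ * cgMatrix (p + s) (q + s) (p + q))
      (Fin.last (p + q)) (Fin.last (p + q)) = 1 := by
  have h1 : ((cgMatrix (p + s) (q + s) (p + q))ᵀ * cgMatrix (p + s) (q + s) (p + q))
      (Fin.last (p + q)) (Fin.last (p + q)) = ∑ x ∈ Finset.HasAntidiagonal.antidiagonal s,
        cgNorm (p + s) (q + s) (p + q) ^ 2 * (wt (p + s) (p + x.1) * wt (q + s) (q + x.2) *
          wt (p + q) (p + q) * transvect s (q + x.2 : ℕ) x.1 (p + x.1 : ℕ) x.2) ^ 2 := by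
    rw [Matrix.mul_apply]
    simp only [Matrix.transpose_apply, ← pow_two]
    symm
    -- Only the index pairs `i = p + b`, `l = q + d` with `b + d = s` contribute; for every other
    -- pair the weight condition fails or the transvectant vanishes.
    refine Finset.sum_of_injOn
      (fun x => (Fin.ofNat (p + s + 1) (p + x.1), Fin.ofNat (q + s + 1) (q + x.2))) ?_ ?_ ?_ ?_
    · rintro ⟨b, d⟩ hx ⟨b', d'⟩ hx' h
      simp only [Finset.mem_coe,
        Finset.HasAntidiagonal.mem_antidiagonal] at hx hx'
      simp only [Prod.mk.injEq, Fin.ext_iff, Fin.val_ofNat] at h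
      rw [Nat.mod_eq_of_lt (by omega), Nat.mod_eq_of_lt (by omega)] at h
      ext <;> simp <;> omega
    · intro _ _; simp
    · rintro ⟨i, l⟩ _ hx
      rw [cgMatrix_apply, cgPoly]
      split_ifs with h
      · by_cases hi : p ≤ (i : ℕ) ∧ q ≤ (l : ℕ)
        · exfalso
          refine hx ⟨((i : ℕ) - p, (l : ℕ) - q), ?_, ?_⟩
          · simp [Fin.val_last] at h ⊢; omega
          · have := i.2
            have := l.2
            simp only [Prod.mk.injEq, Fin.ext_iff, Fin.val_ofNat]
            constructor
            · rw [Nat.mod_eq_of_lt (by omega)]; omega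
            · rw [Nat.mod_eq_of_lt (by omega)]; omega
        · have := i.2
          have := l.2
          simp only [Fin.val_last] at h
          rw [transvect_eq_zero (by push_cast at *; omega)]
          simp
      · simp
    · rintro ⟨b, d⟩ hx
      simp only [Finset.HasAntidiagonal.mem_antidiagonal] at hx
      have e1 : (Fin.ofNat (p + s + 1) (p + b) : ℕ) = p + b := by
        rw [Fin.val_ofNat, Nat.mod_eq_of_lt (by omega)]
      have e2 : (Fin.ofNat (q + s + 1) (q + d) : ℕ) = q + d := by
        rw [Fin.val_ofNat, Nat.mod_eq_of_lt (by omega)]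
      rw [cgMatrix_apply, e1, e2, cgPoly, if_pos (by simp; omega), Fin.val_last,
        show ((q + s : ℕ) : ℤ) - (q + d : ℕ) = b by push_cast; omega,
        show ((p + s : ℕ) : ℤ) - (p + b : ℕ) = d by push_cast; omega, ← mul_pow]
  rw [h1, Finset.sum_congr rfl (fun x hx => by rw [highest_term p q s x hx]), ← Finset.mul_sum,
    ← Finset.mul_sum, ← Nat.cast_sum, sum_antidiagonal_choose_mul_choose, cgNorm_sq,
    Nat.cast_add_choose, show p + q + 1 + s = p + q + s + 1 by ring, Nat.factorial_succ (p + q)]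
  have := Nat.factorial_ne_zero s
  have := Nat.factorial_ne_zero p
  have := Nat.factorial_ne_zero q
  have := Nat.factorial_ne_zero (p + q)
  have := Nat.factorial_ne_zero (p + q + s + 1)
  push_cast
  field_simp

theorem cgMatrix_orthonormal {A B K : ℕ} (hT : Triad A B K) :
    (cgMatrix A B K)ᵀ * cgMatrix A B K = 1 := by
  rw [(cgMatrix_gram_intertwines A B K K).eq_smul_one (Fin.last K)]
  obtain ⟨p, q, s, rfl, rfl, rfl⟩ := hT.exists_eq
  rw [cgMatrix_highest_norm, one_smul]

theorem cgMatrix_orthogonal {A B K K' : ℕ} (h : K ≠ K') :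
    (cgMatrix A B K)ᵀ * cgMatrix A B K' = 0 :=
  (cgMatrix_gram_intertwines A B K K').eq_zero_of_ne h

/-- The spins (doubled) occurring in the tensor product of spins `A` and `B`. -/
def triads (A B : ℕ) : Finset ℕ := (Finset.range (A + B + 1)).filter (fun K => Triad A B K)

theorem mem_triads {A B K : ℕ} : K ∈ triads A B ↔ Triad A B K := by
  rw [triads, Finset.mem_filter, Finset.mem_range]
  exact ⟨fun h => h.2, fun h => ⟨by have := h.2.2.2; omega, h⟩⟩

theorem sum_triads_succ (A B : ℕ) : ∑ K ∈ triads A B, (K + 1) = (A + 1) * (B + 1) := by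
  wlog hAB : A ≤ B generalizing A B
  · rw [mul_comm, ← this B A (by omega)]
    refine Finset.sum_congr ?_ fun _ _ => rfl
    ext K
    rw [mem_triads, mem_triads, Triad, Triad, add_comm A B]
    tauto
  have h1 : triads A B = (Finset.range (A + 1)).image (fun t => B - A + 2 * t) := by
    ext K
    simp only [mem_triads, Finset.mem_image, Finset.mem_range]
    constructor
    · rintro ⟨⟨t, ht⟩, h1, h2, h3⟩
      exact ⟨t - B, by omega, by omega⟩
    · rintro ⟨t, ht, rfl⟩
      exact ⟨⟨B + t, by omega⟩, by omega, by omega, by omega⟩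
  rw [h1, Finset.sum_image (fun x _ y _ h => by omega)]
  obtain ⟨D, rfl⟩ := Nat.exists_eq_add_of_le hAB
  rw [Nat.add_sub_cancel_left]
  have h2 : ∀ N : ℕ, ∑ t ∈ Finset.range (N + 1), (D + 2 * t + 1) = (N + 1) * (N + D + 1) := by
    intro N
    induction N with
    | zero => simp
    | succ N ih => rw [Finset.sum_range_succ, ih]; ring
  exact h2 A

/-- Placed side by side, the coupled bases form a matrix with orthonormal columns. By
`sum_triads_succ` it has as many columns as rows, so its transpose is also a right inverse. -/
theorem cgMatrix_complete (A B : ℕ) :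
    ∑ K ∈ triads A B, cgMatrix A B K * (cgMatrix A B K)ᵀ = 1 := by
  let U : Matrix (Fin (A + 1) × Fin (B + 1)) (Σ K : triads A B, Fin (K.1 + 1)) ℝ :=
    Matrix.of fun p r => cgMatrix A B r.1 p r.2
  have h1 : Uᵀ * U = 1 := by
    ext ⟨⟨K, hK⟩, r⟩ ⟨⟨K', hK'⟩, r'⟩
    have h2 : (Uᵀ * U) ⟨⟨K, hK⟩, r⟩ ⟨⟨K', hK'⟩, r'⟩ =
        ((cgMatrix A B K)ᵀ * cgMatrix A B K') r r' := rfl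
    rw [h2]
    by_cases h : K = K'
    · subst h
      rw [cgMatrix_orthonormal (mem_triads.1 hK), Matrix.one_apply, Matrix.one_apply]
      simp
    · rw [cgMatrix_orthogonal h, Matrix.one_apply, if_neg (by simp [h])]
      rfl
  have hcard : Fintype.card (Σ K : triads A B, Fin (K.1 + 1)) =
      Fintype.card (Fin (A + 1) × Fin (B + 1)) := by
    rw [Fintype.card_sigma, Fintype.card_prod, Fintype.card_fin, Fintype.card_fin,
      ← sum_triads_succ, ← Finset.sum_coe_sort (triads A B)]
    exact Finset.sum_congr rfl fun K _ => Fintype.card_fin _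
  have h3 : U * Uᵀ = 1 := (Matrix.mul_eq_one_comm_of_equiv (Fintype.equivOfCardEq hcard)).1 h1
  rw [← h3]
  ext p p'
  rw [Matrix.sum_apply, Matrix.mul_apply, Fintype.sum_sigma, ← Finset.sum_coe_sort]
  rfl

end
end Jordanian

namespace Jordanian
open scoped Kronecker PowerSeries Matrix
noncomputable section

set_option linter.unusedSectionVars false

/-! ### The Racah coefficients of `sl(2)` -/

/-- The coupling `(Vᵃ ⊗ Vᵇ) ⊗ Vᶜ → Vᵉ` through `V^d ⊆ Vᵃ ⊗ Vᵇ`. -/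
def leftMatrix (a b c d e : ℕ) :
    Matrix ((Fin (a + 1) × Fin (b + 1)) × Fin (c + 1)) (Fin (e + 1)) ℝ :=
  (cgMatrix a b d ⊗ₖ (1 : Matrix (Fin (c + 1)) (Fin (c + 1)) ℝ)) * cgMatrix d c e

/-- The coupling `Vᵃ ⊗ (Vᵇ ⊗ Vᶜ) → Vᵉ` through `V^f ⊆ Vᵇ ⊗ Vᶜ`. -/
def rightMatrix (a b c f e : ℕ) :
    Matrix ((Fin (a + 1) × Fin (b + 1)) × Fin (c + 1)) (Fin (e + 1)) ℝ :=
  assocRows (((1 : Matrix (Fin (a + 1)) (Fin (a + 1)) ℝ) ⊗ₖ cgMatrix b c f) * cgMatrix a f e)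

theorem leftMatrix_apply (a b c d e : ℕ) (i : Fin (a + 1)) (k : Fin (b + 1)) (l : Fin (c + 1))
    (ε : Fin (e + 1)) : leftMatrix a b c d e ((i, k), l) ε =
      ∑ φ : Fin (d + 1), cg a b d i k φ * cg d c e φ l ε := by
  rw [leftMatrix, Matrix.mul_apply, Fintype.sum_prod_type]
  refine Finset.sum_congr rfl fun φ _ => ?_
  simp [cgMatrix, Matrix.one_apply]

theorem rightMatrix_apply (a b c f e : ℕ) (i : Fin (a + 1)) (k : Fin (b + 1)) (l : Fin (c + 1))
    (ε : Fin (e + 1)) : rightMatrix a b c f e ((i, k), l) ε =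
      ∑ φ : Fin (f + 1), cg b c f k l φ * cg a f e i φ ε := by
  rw [rightMatrix, assocRows, Matrix.submatrix_apply, Matrix.mul_apply, Fintype.sum_prod_type,
    Finset.sum_eq_single i]
  · simp [cgMatrix]
  · intro j _ hj
    simp [hj.symm]
  · simp

theorem leftMatrix_intertwines (a b c d e : ℕ) :
    Intertwines (tensorZero (tensorZero (spin ℝ a) (spin ℝ b)) (spin ℝ c)) (spin ℝ e)
      (leftMatrix a b c d e) :=
  ((cgMatrix_intertwines a b d).kronecker_one (spin ℝ c)).mul (cgMatrix_intertwines d c e)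

theorem rightMatrix_intertwines (a b c f e : ℕ) :
    Intertwines (tensorZero (tensorZero (spin ℝ a) (spin ℝ b)) (spin ℝ c)) (spin ℝ e)
      (rightMatrix a b c f e) :=
  (((cgMatrix_intertwines b c f).one_kronecker (spin ℝ a)).mul
    (cgMatrix_intertwines a f e)).assocRows

theorem rightMatrix_gram (a b c f f' e e' : ℕ) :
    (rightMatrix a b c f e)ᵀ * rightMatrix a b c f' e' = (cgMatrix a f e)ᵀ *
      ((1 : Matrix (Fin (a + 1)) (Fin (a + 1)) ℝ) ⊗ₖ ((cgMatrix b c f)ᵀ * cgMatrix b c f')) *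
      cgMatrix a f' e' := by
  rw [rightMatrix, rightMatrix, assocRows, assocRows, Matrix.transpose_submatrix,
    Matrix.submatrix_mul_equiv, Matrix.submatrix_id_id, Matrix.transpose_mul,
    ← Matrix.kroneckerMap_transpose, Matrix.transpose_one, Matrix.mul_assoc,
    ← Matrix.mul_assoc (1 ⊗ₖ _), ← Matrix.mul_kronecker_mul, Matrix.one_mul, Matrix.mul_assoc]

theorem rightMatrix_orthonormal {a b c f e : ℕ} (h1 : Triad b c f) (h2 : Triad a f e) :
    (rightMatrix a b c f e)ᵀ * rightMatrix a b c f e = 1 := by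
  rw [rightMatrix_gram, cgMatrix_orthonormal h1, Matrix.one_kronecker_one, Matrix.mul_one,
    cgMatrix_orthonormal h2]

theorem rightMatrix_orthogonal {a b c f f' e e' : ℕ} (h : f ≠ f') :
    (rightMatrix a b c f e)ᵀ * rightMatrix a b c f' e' = 0 := by
  rw [rightMatrix_gram, cgMatrix_orthogonal h, Matrix.kronecker_zero, Matrix.mul_zero,
    Matrix.zero_mul]

theorem rightMatrix_complete (a b c : ℕ) : ∑ f ∈ triads b c, ∑ e ∈ triads a f,
    rightMatrix a b c f e * (rightMatrix a b c f e)ᵀ = 1 := by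
  have h1 : ∀ f e, rightMatrix a b c f e * (rightMatrix a b c f e)ᵀ =
      (((1 : Matrix (Fin (a + 1)) (Fin (a + 1)) ℝ) ⊗ₖ cgMatrix b c f) *
        (cgMatrix a f e * (cgMatrix a f e)ᵀ) *
        ((1 : Matrix (Fin (a + 1)) (Fin (a + 1)) ℝ) ⊗ₖ (cgMatrix b c f)ᵀ)).submatrix
        (Equiv.prodAssoc _ _ _) (Equiv.prodAssoc _ _ _) := by
    intro f e
    rw [rightMatrix, assocRows, Matrix.transpose_submatrix,
      ← Matrix.submatrix_mul _ _ _ id _ Function.bijective_id, Matrix.transpose_mul,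
      ← Matrix.kroneckerMap_transpose, Matrix.transpose_one, Matrix.mul_assoc, Matrix.mul_assoc,
      Matrix.mul_assoc]
  have h2 : ∀ f, ∑ e ∈ triads a f, rightMatrix a b c f e * (rightMatrix a b c f e)ᵀ =
      ((1 : Matrix (Fin (a + 1)) (Fin (a + 1)) ℝ) ⊗ₖ (cgMatrix b c f * (cgMatrix b c f)ᵀ)).submatrix
        (Equiv.prodAssoc _ _ _) (Equiv.prodAssoc _ _ _) := by
    intro f
    simp only [h1]
    have : ∀ X : ℕ → Matrix (Fin (a + 1) × (Fin (b + 1) × Fin (c + 1)))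
        (Fin (a + 1) × (Fin (b + 1) × Fin (c + 1))) ℝ,
        ∑ e ∈ triads a f, (X e).submatrix (Equiv.prodAssoc _ _ _) (Equiv.prodAssoc _ _ _) =
        (∑ e ∈ triads a f, X e).submatrix (Equiv.prodAssoc _ _ _) (Equiv.prodAssoc _ _ _) := by
      intro X
      ext p q
      simp only [Matrix.sum_apply, Matrix.submatrix_apply]
    rw [this, ← Matrix.sum_mul, ← Matrix.mul_sum, cgMatrix_complete, Matrix.mul_one,
      ← Matrix.mul_kronecker_mul, Matrix.one_mul]
  simp only [h2]
  have h3 : ∑ f ∈ triads b c,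
      ((1 : Matrix (Fin (a + 1)) (Fin (a + 1)) ℝ) ⊗ₖ (cgMatrix b c f * (cgMatrix b c f)ᵀ)).submatrix
        (Equiv.prodAssoc _ _ _) (Equiv.prodAssoc _ _ _) =
      ((1 : Matrix (Fin (a + 1)) (Fin (a + 1)) ℝ) ⊗ₖ
        (∑ f ∈ triads b c, cgMatrix b c f * (cgMatrix b c f)ᵀ)).submatrix
        (Equiv.prodAssoc _ _ _) (Equiv.prodAssoc _ _ _) := by
    ext p q
    simp only [Matrix.sum_apply, Matrix.submatrix_apply, Matrix.kroneckerMap_apply,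
      Finset.mul_sum]
  rw [h3, cgMatrix_complete, Matrix.one_kronecker_one, Matrix.submatrix_one_equiv]

theorem tensorZero_transpose {ι κ : Type*} [Fintype ι] [DecidableEq ι] [Fintype κ]
    [DecidableEq κ] {M : Generators ι ℝ} {N : Generators κ ℝ} (h1 : M.Jpᵀ = M.Jm ∧ M.J0ᵀ = M.J0)
    (h2 : N.Jpᵀ = N.Jm ∧ N.J0ᵀ = N.J0) :
    (tensorZero M N).Jpᵀ = (tensorZero M N).Jm ∧ (tensorZero M N).J0ᵀ = (tensorZero M N).J0 := by
  constructor <;>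
  simp only [tensorZero, Matrix.transpose_add, ← Matrix.kroneckerMap_transpose,
    Matrix.transpose_one, h1, h2]

/-- The recoupling coefficient of `sl(2)`: the overlap of the two couplings of three spins. -/
def recoupling (a b c d f e : ℕ) : ℝ := ((rightMatrix a b c f e)ᵀ * leftMatrix a b c d e) 0 0

theorem overlap_intertwines (a b c d f e e' : ℕ) : Intertwines (spin ℝ e') (spin ℝ e)
    ((rightMatrix a b c f e')ᵀ * leftMatrix a b c d e) := by
  have h1 := tensorZero_transpose (tensorZero_spin_transpose a b)
    ⟨spin_Jp_transpose c, spin_J0_transpose c⟩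
  exact ((rightMatrix_intertwines a b c f e').transpose h1.1 h1.2).mul
    (leftMatrix_intertwines a b c d e)

theorem overlap_eq (a b c d f e : ℕ) :
    (rightMatrix a b c f e)ᵀ * leftMatrix a b c d e = recoupling a b c d f e • 1 :=
  (overlap_intertwines a b c d f e e).eq_smul_one 0

/-- Insert the completeness of the right couplings. By Schur's lemma the overlap with total spin `e'
≠ e` is zero, and for `e' = e` it is a scalar. -/
theorem leftMatrix_eq_sum (a b c d e : ℕ) : leftMatrix a b c d e =
    ∑ f ∈ (Finset.range (b + c + 1)).filter (fun f => Triad b c f ∧ Triad a f e),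
      recoupling a b c d f e • rightMatrix a b c f e := by
  have h1 : leftMatrix a b c d e = ∑ f ∈ triads b c, ∑ e' ∈ triads a f,
      rightMatrix a b c f e' * ((rightMatrix a b c f e')ᵀ * leftMatrix a b c d e) := by
    simp only [← Matrix.mul_assoc, ← Matrix.sum_mul]
    rw [rightMatrix_complete, Matrix.one_mul]
  rw [h1, ← Finset.filter_filter, Finset.sum_filter, triads]
  refine Finset.sum_congr rfl fun f _ => ?_
  split_ifs with h
  · rw [Finset.sum_eq_single e, overlap_eq, Matrix.mul_smul, Matrix.mul_one]
    · intro e' _ he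
      rw [(overlap_intertwines a b c d f e e').eq_zero_of_ne he, Matrix.mul_zero]
    · intro h'
      exact absurd (mem_triads.2 h) h'
  · refine Finset.sum_eq_zero fun e' he => ?_
    have he' : e' ≠ e := by
      rintro rfl
      exact h (mem_triads.1 he)
    rw [(overlap_intertwines a b c d f e e').eq_zero_of_ne he', Matrix.mul_zero]

theorem leftMatrix_reverse (a b c f e : ℕ) (i : Fin (a + 1)) (k : Fin (b + 1)) (l : Fin (c + 1))
    (ε : Fin (e + 1)) : leftMatrix c b a f e ((l, k), i) ε =
      (-1) ^ ((b + c - f) / 2 + (a + f - e) / 2) * rightMatrix a b c f e ((i, k), l) ε := by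
  rw [leftMatrix_apply, rightMatrix_apply, Finset.mul_sum]
  refine Finset.sum_congr rfl fun φ _ => ?_
  rw [cg_swap b c f, cg_swap a f e, pow_add]
  ring

theorem rightMatrix_reverse (a b c d e : ℕ) (i : Fin (a + 1)) (k : Fin (b + 1)) (l : Fin (c + 1))
    (ε : Fin (e + 1)) : rightMatrix c b a d e ((l, k), i) ε =
      (-1) ^ ((a + b - d) / 2 + (d + c - e) / 2) * leftMatrix a b c d e ((i, k), l) ε := by
  rw [leftMatrix_apply, rightMatrix_apply, Finset.mul_sum]
  refine Finset.sum_congr rfl fun φ _ => ?_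
  rw [cg_swap a b d, cg_swap d c e, pow_add]
  ring

/-- Reversing the order of the three factors exchanges left and right couplings up to signs, and the
overlap is symmetric in the two. -/
theorem recoupling_reverse {a b c d f e : ℕ} (h1 : Triad a b d) (h2 : Triad d c e)
    (h3 : Triad b c f) (h4 : Triad a f e) : recoupling c b a f d e = recoupling a b c d f e := by
  let σ : ((Fin (c + 1) × Fin (b + 1)) × Fin (a + 1)) ≃
      ((Fin (a + 1) × Fin (b + 1)) × Fin (c + 1)) :=
    { toFun := fun p => ((p.2, p.1.2), p.1.1)
      invFun := fun p => ((p.2, p.1.2), p.1.1)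
      left_inv := fun _ => rfl
      right_inv := fun _ => rfl }
  rw [recoupling, recoupling, Matrix.mul_apply, Matrix.mul_apply]
  refine Fintype.sum_equiv σ _ _ fun p => ?_
  obtain ⟨⟨l, k⟩, i⟩ := p
  simp only [Matrix.transpose_apply]
  rw [rightMatrix_reverse a b c d e, leftMatrix_reverse a b c f e]
  simp only [σ, Equiv.coe_fn_mk]
  have hs : (-1 : ℝ) ^ ((a + b - d) / 2 + (d + c - e) / 2) *
      (-1) ^ ((b + c - f) / 2 + (a + f - e) / 2) = 1 := by
    rw [← pow_add]
    refine Even.neg_one_pow ?_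
    obtain ⟨⟨_, _⟩, _⟩ := h1
    obtain ⟨⟨_, _⟩, _⟩ := h2
    obtain ⟨⟨_, _⟩, _⟩ := h3
    obtain ⟨⟨_, _⟩, _⟩ := h4
    -- The four exponents add up to `a + b + c - e` in doubled spins, which is even.
    exact ⟨(a + b + c - e) / 2, by omega⟩
  linear_combination leftMatrix a b c d e ((i, k), l) 0 * rightMatrix a b c f e ((i, k), l) 0 * hs

/-- The Racah coefficients `W(abcd;ef)` of `sl(2)`. -/
def racahCoeff (a b c d e f : ℕ) : ℝ :=
  if Triad a b e ∧ Triad c d e ∧ Triad a c f ∧ Triad b d f then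
    recoupling a b d e f c / Real.sqrt (((e : ℝ) + 1) * (f + 1))
  else 0

theorem Triad.rotate {a b c : ℕ} (h : Triad a b c) : Triad b c a := by
  rw [Triad] at *
  rw [show b + c + a = a + b + c by ring]
  obtain ⟨h0, h⟩ := h
  exact ⟨h0, by omega⟩

theorem Triad.swap {a b c : ℕ} (h : Triad a b c) : Triad b a c := by
  rw [Triad] at *
  rw [show b + a + c = a + b + c by ring]
  obtain ⟨h0, h⟩ := h
  exact ⟨h0, by omega⟩

/-- Associativity will produce the coefficient with its spins in reversed order; this symmetry
brings it to the order of the theorem. -/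
theorem racahCoeff_reverse (a b c d e f : ℕ) : racahCoeff d b c a f e = racahCoeff a b c d e f := by
  rw [racahCoeff, racahCoeff]
  by_cases h : Triad a b e ∧ Triad c d e ∧ Triad a c f ∧ Triad b d f
  · obtain ⟨h1, h2, h3, h4⟩ := h
    rw [if_pos ⟨h4.swap, h3.swap, h2.swap, h1.swap⟩, if_pos ⟨h1, h2, h3, h4⟩,
      recoupling_reverse h1 h2.rotate.swap h4 h3.rotate.rotate.swap, mul_comm ((f : ℝ) + 1)]
  · rw [if_neg (fun h' => h ⟨h'.2.2.2.swap, h'.2.2.1.swap, h'.2.1.swap, h'.1.swap⟩), if_neg h]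

theorem sqrt_mul_racahCoeff {a b c d e f : ℕ} (h1 : Triad a b e) (h2 : Triad c d e)
    (h3 : Triad a c f) (h4 : Triad b d f) :
    Real.sqrt (((e : ℝ) + 1) * (f + 1)) * racahCoeff a b c d e f = recoupling a b d e f c := by
  rw [racahCoeff, if_pos ⟨h1, h2, h3, h4⟩]
  have : Real.sqrt (((e : ℝ) + 1) * (f + 1)) ≠ 0 := (Real.sqrt_pos.2 (by positivity)).ne'
  field_simp

end
end Jordanian

namespace Jordanian
open scoped Kronecker PowerSeries Matrix
noncomputable section

set_option linter.unusedSectionVars false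

/-! ### The twist cocycle -/

section Deformed

variable {R : Type*} [CommRing R] [Algebra ℝ R] [Algebra ℚ R]
variable {ι κ μ : Type*} [Fintype ι] [DecidableEq ι] [Fintype κ] [DecidableEq κ]
  [Fintype μ] [DecidableEq μ]

theorem spin_Jp_pow_apply (n m : ℕ) (i k : Fin (n + 1)) (h : (i : ℕ) ≠ k + m) :
    ((spin R n).Jp ^ m) i k = 0 := by
  induction m generalizing i with
  | zero =>
    rw [pow_zero, Matrix.one_apply, if_neg]
    rintro rfl
    simp at h
  | succ m ih =>
    rw [pow_succ', Matrix.mul_apply]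
    refine Finset.sum_eq_zero fun j _ => ?_
    by_cases hj : (j : ℕ) = k + m
    · simp only [spin, Matrix.of_apply]
      rw [if_neg (by omega), zero_mul]
    · rw [ih j hj, mul_zero]

theorem isNilpotent_spin_Jp (h : R) (n : ℕ) : IsNilpotent ((2 * h) • (spin R n).Jp) := by
  refine ⟨n + 1, ?_⟩
  rw [smul_pow]
  have : (spin R n).Jp ^ (n + 1) = 0 := by
    ext i k
    exact spin_Jp_pow_apply n (n + 1) i k (by omega)
  rw [this, smul_zero]

theorem spin_J0_mul_Jp (n : ℕ) :
    (spin R n).J0 * (spin R n).Jp = (spin R n).Jp * ((spin R n).J0 + 2) := by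
  have h2 : (2 : Matrix (Fin (n + 1)) (Fin (n + 1)) R) = Matrix.diagonal fun _ => 2 := by
    ext i k
    simp [Matrix.diagonal_apply, Matrix.ofNat_apply]
  rw [h2]
  ext i k
  simp only [spin, Matrix.diagonal_add, Matrix.diagonal_mul, Matrix.mul_diagonal, Matrix.of_apply]
  split_ifs with hik
  · rw [hik]; push_cast; ring
  · simp

theorem isNilpotent_of_intertwine {M : Matrix ι ι R} {N F F' : Matrix ι ι R} (hF : F * F' = 1)
    (hMF : M * F = F * N) (hN : IsNilpotent N) : IsNilpotent M := by
  obtain ⟨n, hn⟩ := hN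
  refine ⟨n, ?_⟩
  rw [← Matrix.mul_one (M ^ n), ← hF, ← Matrix.mul_assoc, pow_mul_of_intertwine hMF, hn,
    Matrix.mul_zero, Matrix.zero_mul]

/-- The twisted generator is conjugate to the undeformed one, a sum of two commuting nilpotents. -/
theorem isNilpotent_tensor_Jp (h : R) (M : Generators ι R) (N : Generators κ R)
    (hM : IsNilpotent ((2 * h) • M.Jp)) (hN : IsNilpotent ((2 * h) • N.Jp)) :
    IsNilpotent ((2 * h) • (tensor h M N).Jp) := by
  have h1 : IsNilpotent ((2 * h) • (tensorZero M N).Jp) := by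
    have h2 : (2 * h) • (tensorZero M N).Jp =
        ((2 * h) • M.Jp) ⊗ₖ 1 + 1 ⊗ₖ ((2 * h) • N.Jp) := by
      simp only [tensorZero, smul_add, Matrix.smul_kronecker, Matrix.kronecker_smul]
    rw [h2]
    refine Commute.isNilpotent_add ?_ (isNilpotent_kronecker_left hM _)
      (isNilpotent_kronecker_right _ hN)
    rw [Commute, SemiconjBy, ← Matrix.mul_kronecker_mul, ← Matrix.mul_kronecker_mul]
    simp
  refine isNilpotent_of_intertwine (twist_mul_twistInv h M N hN) ?_ h1
  simp only [tensor, tensorZero]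
  rw [Matrix.smul_mul, Matrix.mul_assoc, twistInv_mul_twist h M N hN, Matrix.mul_one,
    Matrix.mul_smul]

theorem tensor_J0_mul_twist (h : R) (M : Generators ι R) (N : Generators κ R)
    (hN : IsNilpotent ((2 * h) • N.Jp)) :
    (tensor h M N).J0 * twist h M N = twist h M N * (tensorZero M N).J0 := by
  simp only [tensor, tensorZero]
  rw [Matrix.mul_assoc, twistInv_mul_twist h M N hN, Matrix.mul_one]

theorem tensor_Jp_mul_twist (h : R) (M : Generators ι R) (N : Generators κ R)
    (hN : IsNilpotent ((2 * h) • N.Jp)) :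
    (tensor h M N).Jp * twist h M N = twist h M N * (tensorZero M N).Jp := by
  simp only [tensor, tensorZero]
  rw [Matrix.mul_assoc, twistInv_mul_twist h M N hN, Matrix.mul_one]

theorem commute_sigma (h : R) {J : Matrix ι ι R} (hJ : IsNilpotent ((2 * h) • J)) :
    Commute (sigma h J) J :=
  sigma_mul_of_intertwine h hJ hJ rfl

theorem isNilpotent_twist_exponent (h : R) (X : Matrix ι ι R) {J : Matrix κ κ R}
    (hJ : IsNilpotent ((2 * h) • J)) : IsNilpotent (-((2 : ℚ)⁻¹ • (X ⊗ₖ sigma h J))) :=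
  ((isNilpotent_kronecker_right X (isNilpotent_sigma h hJ)).smul _).neg

/-- `𝓕 (J₊ ⊗ 1) = (J₊ ⊗ e^{-σ}) 𝓕`. -/
theorem twist_mul_Jp_kronecker_one (h : R) (M : Generators ι R) (N : Generators κ R)
    (hM : M.J0 * M.Jp = M.Jp * (M.J0 + 2)) (hN : IsNilpotent ((2 * h) • N.Jp)) :
    twist h M N * (M.Jp ⊗ₖ (1 : Matrix κ κ R)) = (M.Jp ⊗ₖ (1 - (2 * h) • N.Jp)) * twist h M N := by
  have hσ := isNilpotent_sigma h hN
  -- Passing `J₊` shifts `J₀` by 2, so the exponent picks up `-1 ⊗ σ`, which exponentiates to `1 ⊗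
  -- (1 - 2hJ₊)`.
  have h1 : -((2 : ℚ)⁻¹ • (M.J0 ⊗ₖ sigma h N.Jp)) * (M.Jp ⊗ₖ 1) =
      (M.Jp ⊗ₖ 1) * (1 ⊗ₖ (-sigma h N.Jp) + -((2 : ℚ)⁻¹ • (M.J0 ⊗ₖ sigma h N.Jp))) := by
    rw [Matrix.mul_add, Matrix.neg_mul, Matrix.mul_neg, Matrix.smul_mul, Matrix.mul_smul,
      ← Matrix.mul_kronecker_mul, ← Matrix.mul_kronecker_mul, ← Matrix.mul_kronecker_mul, hM,
      Matrix.mul_add, Matrix.add_kronecker, smul_add, Matrix.mul_one, Matrix.one_mul,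
      Matrix.mul_one, Matrix.one_mul]
    have h2 : (M.Jp * 2) ⊗ₖ sigma h N.Jp = (2 : ℚ) • (M.Jp ⊗ₖ sigma h N.Jp) := by
      rw [mul_two, Matrix.add_kronecker, two_smul]
    have h3 : M.Jp ⊗ₖ (-sigma h N.Jp) = -(M.Jp ⊗ₖ sigma h N.Jp) := by
      rw [← neg_one_smul R, Matrix.kronecker_smul, neg_one_smul]
    rw [h2, h3, smul_smul]
    norm_num
  have hc : Commute ((1 : Matrix ι ι R) ⊗ₖ (-sigma h N.Jp))
      (-((2 : ℚ)⁻¹ • (M.J0 ⊗ₖ sigma h N.Jp))) := by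
    refine Commute.neg_right (Commute.smul_right ?_ _)
    rw [Commute, SemiconjBy, ← Matrix.mul_kronecker_mul, ← Matrix.mul_kronecker_mul]
    simp
  have hn1 := isNilpotent_twist_exponent h M.J0 hN
  have hn2 : IsNilpotent ((1 : Matrix ι ι R) ⊗ₖ (-sigma h N.Jp)) :=
    isNilpotent_kronecker_right _ hσ.neg
  rw [twist, exp_mul_of_intertwine hn1 (hc.isNilpotent_add hn2 hn1) h1,
    IsNilpotent.exp_add_of_commute hc hn2 hn1, exp_one_kronecker hσ.neg, exp_neg_sigma h hN,
    ← Matrix.mul_assoc, ← Matrix.mul_kronecker_mul, Matrix.mul_one, Matrix.one_mul]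

/-- The coproduct of `σ` is primitive: `Δ̃ σ = σ ⊗ 1 + 1 ⊗ σ`. -/
theorem sigma_tensor (h : R) (M : Generators ι R) (N : Generators κ R)
    (hJ : M.J0 * M.Jp = M.Jp * (M.J0 + 2)) (hM : IsNilpotent ((2 * h) • M.Jp))
    (hN : IsNilpotent ((2 * h) • N.Jp)) :
    sigma h (tensor h M N).Jp = sigma h M.Jp ⊗ₖ 1 + 1 ⊗ₖ sigma h N.Jp := by
  have hT := isNilpotent_tensor_Jp h M N hM hN
  have hσM := isNilpotent_sigma h hM
  have hσN := isNilpotent_sigma h hN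
  have cM := commute_sigma h hM
  have cN := commute_sigma h hN
  have hJp : (tensor h M N).Jp = M.Jp ⊗ₖ (1 - (2 * h) • N.Jp) + 1 ⊗ₖ N.Jp := by
    simp only [tensor]
    have h1 : twist h M N * (1 ⊗ₖ N.Jp) = (1 ⊗ₖ N.Jp) * twist h M N := by
      refine exp_mul_of_intertwine (isNilpotent_twist_exponent h M.J0 hN)
        (isNilpotent_twist_exponent h M.J0 hN) ?_
      rw [Matrix.neg_mul, Matrix.mul_neg, Matrix.smul_mul, Matrix.mul_smul,
        ← Matrix.mul_kronecker_mul, ← Matrix.mul_kronecker_mul, cN.eq, Matrix.one_mul,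
        Matrix.mul_one]
    rw [Matrix.mul_add, twist_mul_Jp_kronecker_one h M N hJ hN, h1, ← Matrix.add_mul,
      Matrix.mul_assoc, twist_mul_twistInv h M N hN, Matrix.mul_one]
  have hc : Commute (sigma h M.Jp ⊗ₖ (1 : Matrix κ κ R)) (1 ⊗ₖ sigma h N.Jp) := by
    rw [Commute, SemiconjBy, ← Matrix.mul_kronecker_mul, ← Matrix.mul_kronecker_mul]
    simp
  have hnM : IsNilpotent (sigma h M.Jp ⊗ₖ (1 : Matrix κ κ R)) := isNilpotent_kronecker_left hσM _
  have hnN : IsNilpotent ((1 : Matrix ι ι R) ⊗ₖ sigma h N.Jp) := isNilpotent_kronecker_right _ hσN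
  -- It suffices to compare exponentials. With the formula for the coproduct of `J₊` just found, `1
  -- - 2hJ₊` has coproduct `(1 - 2hJ₊) ⊗ (1 - 2hJ₊)`.
  refine exp_injective_of_commute ?_ (isNilpotent_sigma h hT) (hc.isNilpotent_add hnM hnN) ?_
  · refine sigma_mul_of_intertwine h hT hT ?_
    have cN' : Commute (1 - (2 * h) • N.Jp) (sigma h N.Jp) :=
      ((Commute.one_left _).sub_left (cN.symm.smul_left _))
    rw [hJp]
    simp only [Matrix.add_mul, Matrix.mul_add, ← Matrix.mul_kronecker_mul, Matrix.one_mul,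
      Matrix.mul_one, cM.eq, cN'.eq, cN.eq]
    abel
  · have h1 := exp_neg_sigma h hT
    have h2 : IsNilpotent.exp (-(sigma h M.Jp ⊗ₖ (1 : Matrix κ κ R) + 1 ⊗ₖ sigma h N.Jp)) =
        IsNilpotent.exp (-sigma h (tensor h M N).Jp) := by
      have e1 : -(sigma h M.Jp ⊗ₖ (1 : Matrix κ κ R)) = (-sigma h M.Jp) ⊗ₖ 1 := by
        rw [← neg_one_smul R, ← neg_one_smul R (sigma h M.Jp), Matrix.smul_kronecker]
      have e2 : -((1 : Matrix ι ι R) ⊗ₖ sigma h N.Jp) = 1 ⊗ₖ (-sigma h N.Jp) := by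
        rw [← neg_one_smul R, ← neg_one_smul R (sigma h N.Jp), Matrix.kronecker_smul]
      rw [neg_add, IsNilpotent.exp_add_of_commute hc.neg_left.neg_right hnM.neg hnN.neg, e1, e2,
        exp_kronecker_one hσM.neg, exp_one_kronecker hσN.neg, h1, exp_neg_sigma h hM,
        exp_neg_sigma h hN, hJp, ← Matrix.mul_kronecker_mul, Matrix.mul_one, Matrix.one_mul]
      rw [sub_eq_add_neg (1 : Matrix ι ι R), Matrix.add_kronecker, smul_add,
        ← neg_smul, Matrix.smul_kronecker, neg_smul]
      have e3 : (1 : Matrix ι ι R) ⊗ₖ (1 - (2 * h) • N.Jp) =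
          1 - (2 * h) • ((1 : Matrix ι ι R) ⊗ₖ N.Jp) := by
        ext ⟨i, k⟩ ⟨i', k'⟩
        simp only [Matrix.kroneckerMap_apply, Matrix.sub_apply, Matrix.smul_apply,
          ← Matrix.one_kronecker_one (m := ι) (n := κ), smul_eq_mul]
        ring
      rw [e3]
      abel
    have h3 := IsNilpotent.exp_mul_exp_neg_self (isNilpotent_sigma h hT)
    have h4 := IsNilpotent.exp_neg_mul_exp_self (hc.isNilpotent_add hnM hnN)
    rw [h2] at h4
    exact left_inv_eq_right_inv h3 h4

/-- The first leg of the twist contains only `J₀`, the second only `J₊`. Hence compatibility with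
`J₀` suffices here, and compatibility with `J₊` in `twist_mul_one_kronecker`. -/
theorem twist_mul_kronecker_one (h : R) {M : Generators ι R} {N : Generators κ R}
    (P : Generators μ R) {U : Matrix ι κ R} (hP : IsNilpotent ((2 * h) • P.Jp))
    (hU : M.J0 * U = U * N.J0) :
    twist h M P * (U ⊗ₖ (1 : Matrix μ μ R)) = (U ⊗ₖ (1 : Matrix μ μ R)) * twist h N P := by
  refine exp_mul_of_intertwine (isNilpotent_twist_exponent h M.J0 hP)
    (isNilpotent_twist_exponent h N.J0 hP) ?_
  rw [Matrix.neg_mul, Matrix.mul_neg, Matrix.smul_mul, Matrix.mul_smul,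
    ← Matrix.mul_kronecker_mul, ← Matrix.mul_kronecker_mul, hU, Matrix.one_mul, Matrix.mul_one]

theorem twist_mul_one_kronecker (h : R) {M : Generators ι R} {N : Generators κ R}
    (P : Generators μ R) {U : Matrix ι κ R} (hM : IsNilpotent ((2 * h) • M.Jp))
    (hN : IsNilpotent ((2 * h) • N.Jp)) (hU : M.Jp * U = U * N.Jp) :
    twist h P M * ((1 : Matrix μ μ R) ⊗ₖ U) = ((1 : Matrix μ μ R) ⊗ₖ U) * twist h P N := by
  refine exp_mul_of_intertwine (isNilpotent_twist_exponent h P.J0 hM)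
    (isNilpotent_twist_exponent h P.J0 hN) ?_
  rw [Matrix.neg_mul, Matrix.mul_neg, Matrix.smul_mul, Matrix.mul_smul,
    ← Matrix.mul_kronecker_mul, ← Matrix.mul_kronecker_mul, sigma_mul_of_intertwine h hM hN hU,
    Matrix.one_mul, Matrix.mul_one]

/-- The total twist `(Δ̃ ⊗ id)(𝓕) 𝓕₁₂` on a threefold tensor product. -/
def tripleTwist (h : R) (M : Generators ι R) (N : Generators κ R) (P : Generators μ R) :
    Matrix ((ι × κ) × μ) ((ι × κ) × μ) R :=
  twist h (tensor h M N) P * (twist h M N ⊗ₖ 1)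

theorem isUnit_twist (h : R) (M : Generators ι R) (N : Generators κ R)
    (hN : IsNilpotent ((2 * h) • N.Jp)) : IsUnit (twist h M N) :=
  IsNilpotent.isUnit_exp (isNilpotent_twist_exponent h M.J0 hN)

theorem isUnit_tripleTwist (h : R) (M : Generators ι R) (N : Generators κ R)
    (P : Generators μ R) (hN : IsNilpotent ((2 * h) • N.Jp)) (hP : IsNilpotent ((2 * h) • P.Jp)) :
    IsUnit (tripleTwist h M N P) := by
  refine (isUnit_twist h _ P hP).mul ?_
  refine IsUnit.of_mul_eq_one (twistInv h M N ⊗ₖ 1) ?_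
  rw [← Matrix.mul_kronecker_mul, twist_mul_twistInv h M N hN, Matrix.one_mul,
    Matrix.one_kronecker_one]

theorem exp_submatrix (e : ι ≃ κ) {X : Matrix κ κ R} (hX : IsNilpotent X) :
    (IsNilpotent.exp X).submatrix e e = IsNilpotent.exp (X.submatrix e e) :=
  IsNilpotent.map_exp hX (Matrix.reindexAlgEquiv ℚ R e.symm)

/-- The cocycle condition `(Δ̃ ⊗ id)(𝓕) 𝓕₁₂ = (id ⊗ Δ̃)(𝓕) 𝓕₂₃`. -/
theorem twist_cocycle (h : R) (M : Generators ι R) (N : Generators κ R) (P : Generators μ R)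
    (hJ : N.J0 * N.Jp = N.Jp * (N.J0 + 2)) (hN : IsNilpotent ((2 * h) • N.Jp))
    (hP : IsNilpotent ((2 * h) • P.Jp)) :
    (twist h M (tensor h N P) * (1 ⊗ₖ twist h N P)).submatrix (Equiv.prodAssoc ι κ μ)
      (Equiv.prodAssoc ι κ μ) = tripleTwist h M N P := by
  have hσN := isNilpotent_sigma h hN
  have hσP := isNilpotent_sigma h hP
  -- With `X, Y, Z` equal to `-½` times `J₀ ⊗ σ ⊗ 1`, `J₀ ⊗ 1 ⊗ σ`, `1 ⊗ J₀ ⊗ σ`, one side is `e^X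
  -- e^{Y+Z}` and the other `e^{X+Y} e^Z`. `Y` commutes with `X` and with `Z`; commutation of `X`
  -- with `Z` is neither available in general nor needed.
  set X : Matrix ((ι × κ) × μ) ((ι × κ) × μ) R :=
    (-((2 : ℚ)⁻¹ • (M.J0 ⊗ₖ sigma h N.Jp))) ⊗ₖ 1 with hX
  set Y : Matrix ((ι × κ) × μ) ((ι × κ) × μ) R :=
    -((2 : ℚ)⁻¹ • ((M.J0 ⊗ₖ (1 : Matrix κ κ R)) ⊗ₖ sigma h P.Jp)) with hY
  set Z : Matrix ((ι × κ) × μ) ((ι × κ) × μ) R :=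
    -((2 : ℚ)⁻¹ • (((1 : Matrix ι ι R) ⊗ₖ N.J0) ⊗ₖ sigma h P.Jp)) with hZ
  have nX : IsNilpotent X :=
    isNilpotent_kronecker_left (isNilpotent_twist_exponent h M.J0 hN) _
  have nY : IsNilpotent Y := isNilpotent_twist_exponent h _ hP
  have nZ : IsNilpotent Z := isNilpotent_twist_exponent h _ hP
  have cXY : Commute X Y := by
    refine Commute.neg_right (Commute.smul_right ?_ _)
    rw [hX, Commute, SemiconjBy, ← Matrix.mul_kronecker_mul, ← Matrix.mul_kronecker_mul,
      Matrix.neg_mul, Matrix.mul_neg, Matrix.smul_mul, Matrix.mul_smul, ← Matrix.mul_kronecker_mul,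
      ← Matrix.mul_kronecker_mul]
    simp
  have cYZ : Commute Y Z := by
    refine Commute.neg_right (Commute.smul_right (Commute.neg_left (Commute.smul_left ?_ _)) _)
    rw [Commute, SemiconjBy, ← Matrix.mul_kronecker_mul, ← Matrix.mul_kronecker_mul,
      ← Matrix.mul_kronecker_mul, ← Matrix.mul_kronecker_mul]
    simp
  have hL : tripleTwist h M N P = IsNilpotent.exp X * IsNilpotent.exp Y * IsNilpotent.exp Z := by
    have e : tripleTwist h M N P = (twist h M N ⊗ₖ 1) * twist h (tensorZero M N) P :=
      twist_mul_kronecker_one h P hP (tensor_J0_mul_twist h M N hN)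
    rw [e, mul_assoc,
      ← IsNilpotent.exp_add_of_commute cYZ nY nZ]
    congr 1
    · rw [hX, exp_kronecker_one (isNilpotent_twist_exponent h M.J0 hN)]; rfl
    · rw [twist]
      congr 1
      simp only [tensorZero, hY, hZ, Matrix.add_kronecker, smul_add, neg_add]
  have hR : twist h M (tensor h N P) = IsNilpotent.exp
      (-((2 : ℚ)⁻¹ • (M.J0 ⊗ₖ (sigma h N.Jp ⊗ₖ (1 : Matrix μ μ R)))) +
        -((2 : ℚ)⁻¹ • (M.J0 ⊗ₖ ((1 : Matrix κ κ R) ⊗ₖ sigma h P.Jp)))) := by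
    rw [twist, sigma_tensor h N P hJ hN hP, Matrix.kronecker_add, smul_add, neg_add]
  have hs : (-((2 : ℚ)⁻¹ • (M.J0 ⊗ₖ (sigma h N.Jp ⊗ₖ (1 : Matrix μ μ R)))) +
        -((2 : ℚ)⁻¹ • (M.J0 ⊗ₖ ((1 : Matrix κ κ R) ⊗ₖ sigma h P.Jp)))).submatrix
      (Equiv.prodAssoc ι κ μ) (Equiv.prodAssoc ι κ μ) = X + Y := by
    ext ⟨⟨i, k⟩, l⟩ ⟨⟨i', k'⟩, l'⟩
    simp only [hX, hY, Matrix.add_apply, Matrix.neg_apply, Matrix.smul_apply,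
      Matrix.submatrix_apply, Equiv.prodAssoc_apply, Matrix.kroneckerMap_apply]
    simp only [Algebra.smul_def]
    ring
  have hs' : ((1 : Matrix ι ι R) ⊗ₖ (-((2 : ℚ)⁻¹ • (N.J0 ⊗ₖ sigma h P.Jp)))).submatrix
      (Equiv.prodAssoc ι κ μ) (Equiv.prodAssoc ι κ μ) = Z := by
    ext ⟨⟨i, k⟩, l⟩ ⟨⟨i', k'⟩, l'⟩
    simp only [hZ, Matrix.neg_apply, Matrix.smul_apply,
      Matrix.submatrix_apply, Equiv.prodAssoc_apply, Matrix.kroneckerMap_apply]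
    simp only [Algebra.smul_def]
    ring
  have nXY : IsNilpotent (-((2 : ℚ)⁻¹ • (M.J0 ⊗ₖ (sigma h N.Jp ⊗ₖ (1 : Matrix μ μ R)))) +
        -((2 : ℚ)⁻¹ • (M.J0 ⊗ₖ ((1 : Matrix κ κ R) ⊗ₖ sigma h P.Jp)))) := by
    have := isNilpotent_twist_exponent h M.J0 (isNilpotent_tensor_Jp h N P hN hP)
    rwa [sigma_tensor h N P hJ hN hP, Matrix.kronecker_add, smul_add, neg_add] at this
  rw [hL, ← IsNilpotent.exp_add_of_commute cXY nX nY, ← Matrix.submatrix_mul_equiv _ _ _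
    (Equiv.prodAssoc ι κ μ) _, hR, exp_submatrix _ nXY, hs, ← hs', ← exp_submatrix _
    (isNilpotent_kronecker_right _ (isNilpotent_twist_exponent h N.J0 hP)),
    exp_one_kronecker (isNilpotent_twist_exponent h N.J0 hP)]
  rfl

/-! ### The Racah coefficients of `U_h(sl(2))` -/

variable (R) in
/-- The Clebsch-Gordan coefficients with values in an `ℝ`-algebra. -/
def cgMatrixOver (A B K : ℕ) : Matrix (Fin (A + 1) × Fin (B + 1)) (Fin (K + 1)) R :=
  (cgMatrix A B K).map (algebraMap ℝ R)

theorem couple_apply (h : R) (M : Generators ι R) (N : Generators κ R) {A B : ℕ}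
    (u : Fin (A + 1) → ι → R) (v : Fin (B + 1) → κ → R) (K : ℕ) (r : Fin (K + 1)) (p : ι × κ) :
    couple h M N u v K r p = (twist h M N * (((Matrix.of u)ᵀ ⊗ₖ (Matrix.of v)ᵀ) *
      cgMatrixOver R A B K)) p r := by
  rw [couple, Matrix.mul_apply, Matrix.mulVec, dotProduct]
  refine Finset.sum_congr rfl fun q _ => ?_
  congr 1
  rw [Finset.sum_apply, Matrix.mul_apply, Fintype.sum_prod_type]
  refine Finset.sum_congr rfl fun α _ => ?_
  rw [Finset.sum_apply]
  refine Finset.sum_congr rfl fun β _ => ?_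
  simp only [Pi.smul_apply, smul_eq_mul, Matrix.kroneckerMap_apply, Matrix.transpose_apply,
    Matrix.of_apply, cgMatrixOver, Matrix.map_apply, cgMatrix]
  ring

theorem of_stdBasis (n : ℕ) : (Matrix.of (stdBasis R n))ᵀ = 1 := by
  ext i k
  simp [stdBasis, Matrix.one_apply, Pi.single_apply]

theorem of_couple (h : R) (M : Generators ι R) (N : Generators κ R) {A B : ℕ}
    (u : Fin (A + 1) → ι → R) (v : Fin (B + 1) → κ → R) (K : ℕ) :
    (Matrix.of (couple h M N u v K))ᵀ = twist h M N * (((Matrix.of u)ᵀ ⊗ₖ (Matrix.of v)ᵀ) *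
      cgMatrixOver R A B K) := by
  ext p r
  rw [Matrix.transpose_apply, Matrix.of_apply, couple_apply]

theorem of_couple_stdBasis (h : R) (A B K : ℕ) :
    (Matrix.of (couple h (spin R A) (spin R B) (stdBasis R A) (stdBasis R B) K))ᵀ =
      twist h (spin R A) (spin R B) * cgMatrixOver R A B K := by
  rw [of_couple, of_stdBasis, of_stdBasis, Matrix.one_kronecker_one, Matrix.one_mul]

theorem coupleLeft_apply (h : R) (a b c d e : ℕ) (ε : Fin (e + 1))
    (p : (Fin (a + 1) × Fin (b + 1)) × Fin (c + 1)) : coupleLeft h a b c d e ε p =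
      (tripleTwist h (spin R a) (spin R b) (spin R c) *
        (leftMatrix a b c d e).map (algebraMap ℝ R)) p ε := by
  rw [coupleLeft, couple_apply, of_couple_stdBasis, of_stdBasis, tripleTwist, leftMatrix,
    Matrix.map_mul]
  have e1 : ((cgMatrix a b d) ⊗ₖ (1 : Matrix (Fin (c + 1)) (Fin (c + 1)) ℝ)).map (algebraMap ℝ R) =
      cgMatrixOver R a b d ⊗ₖ (1 : Matrix (Fin (c + 1)) (Fin (c + 1)) R) := by
    ext ⟨i, k⟩ ⟨i', k'⟩
    simp [cgMatrixOver, Matrix.one_apply, apply_ite (algebraMap ℝ R)]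
  have e2 : (twist h (spin R a) (spin R b) * cgMatrixOver R a b d) ⊗ₖ
      (1 : Matrix (Fin (c + 1)) (Fin (c + 1)) R) =
      (twist h (spin R a) (spin R b) ⊗ₖ (1 : Matrix (Fin (c + 1)) (Fin (c + 1)) R)) *
        (cgMatrixOver R a b d ⊗ₖ (1 : Matrix (Fin (c + 1)) (Fin (c + 1)) R)) := by
    rw [← Matrix.mul_kronecker_mul, Matrix.one_mul]
  rw [e1, e2, Matrix.mul_assoc, Matrix.mul_assoc]
  rfl

/-- The cocycle identity enters here: the right coupling carries `(id ⊗ Δ̃)(𝓕) 𝓕₂₃`, which is the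
matrix already found in the left coupling. -/
theorem coupleRight_apply (h : R) (a b c f e : ℕ) (ε : Fin (e + 1)) (i : Fin (a + 1))
    (k : Fin (b + 1)) (l : Fin (c + 1)) : coupleRight h a b c f e ε (i, (k, l)) =
      (tripleTwist h (spin R a) (spin R b) (spin R c) *
        (rightMatrix a b c f e).map (algebraMap ℝ R)) ((i, k), l) ε := by
  have h1 : (rightMatrix a b c f e).map (algebraMap ℝ R) =
      (((1 : Matrix (Fin (a + 1)) (Fin (a + 1)) R) ⊗ₖ cgMatrixOver R b c f) *
        cgMatrixOver R a f e).submatrix (Equiv.prodAssoc _ _ _) id := by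
    rw [rightMatrix, assocRows, ← Matrix.submatrix_map, Matrix.map_mul]
    congr 2
    ext ⟨i, k⟩ ⟨i', k'⟩
    simp [cgMatrixOver, Matrix.one_apply, apply_ite (algebraMap ℝ R)]
  rw [coupleRight, couple_apply, of_couple_stdBasis, of_stdBasis, h1,
    ← twist_cocycle h _ _ _ (spin_J0_mul_Jp b) (isNilpotent_spin_Jp h b) (isNilpotent_spin_Jp h c),
    Matrix.submatrix_mul_equiv, Matrix.submatrix_apply, Equiv.prodAssoc_apply, id_eq]
  rw [Matrix.mul_assoc, ← Matrix.mul_assoc (1 ⊗ₖ _) (1 ⊗ₖ _), ← Matrix.mul_kronecker_mul,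
    Matrix.one_mul]

/-- Both deformed bases are the undeformed ones multiplied by the same matrix, so the undeformed
expansion carries over for every `h`. -/
theorem isRacah_racahCoeff (h : R) :
    IsRacah h (fun a b c d e f => algebraMap ℝ R (racahCoeff a b c d e f)) := by
  refine ⟨fun a b c d e f hn => ?_, ?_⟩
  · show algebraMap ℝ R (racahCoeff a b c d e f) = 0
    rw [racahCoeff, if_neg hn, map_zero]
  intro a b c d e h1 h2 ε i k l
  rw [coupleLeft_apply, leftMatrix_eq_sum]
  simp only [coupleRight_apply, Matrix.mul_apply]
  simp only [Matrix.map_apply, Matrix.sum_apply, map_sum, Finset.mul_sum]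
  rw [Finset.sum_comm]
  refine Finset.sum_congr rfl fun f hf => Finset.sum_congr rfl fun p _ => ?_
  obtain ⟨-, h3, h4⟩ := Finset.mem_filter.1 hf
  rw [← map_mul, sqrt_mul_racahCoeff h1 h2.rotate.swap h4.rotate.rotate.swap h3,
    Matrix.smul_apply, smul_eq_mul, map_mul]
  ring

theorem isRacah_unique (h : R) {W : ℕ → ℕ → ℕ → ℕ → ℕ → ℕ → R} (hW : IsRacah h W) :
    W = fun a b c d e f => algebraMap ℝ R (racahCoeff a b c d e f) := by
  funext a b e c d f
  by_cases hT : Triad a b d ∧ Triad e c d ∧ Triad a e f ∧ Triad b c f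
  swap
  · rw [hW.1 _ _ _ _ _ _ hT, racahCoeff, if_neg hT, map_zero]
  obtain ⟨h1, h2, h3, h4⟩ := hT
  have h2' : Triad d c e := h2.rotate.swap
  have h3' : Triad a f e := h3.rotate.rotate.swap
  set G := tripleTwist h (spin R a) (spin R b) (spin R c) with hG
  obtain ⟨G', hG'⟩ := (isUnit_tripleTwist h (spin R a) (spin R b) (spin R c)
    (isNilpotent_spin_Jp h b) (isNilpotent_spin_Jp h c)).exists_left_inv
  rw [← hG] at hG'
  set S := (Finset.range (b + c + 1)).filter (fun f => Triad b c f ∧ Triad a f e)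
  have key : G * (leftMatrix a b c d e).map (algebraMap ℝ R) =
      G * ∑ f ∈ S, (algebraMap ℝ R (Real.sqrt (((d : ℝ) + 1) * (f + 1))) * W a b e c d f) •
        (rightMatrix a b c f e).map (algebraMap ℝ R) := by
    ext ⟨⟨i, k⟩, l⟩ ε
    rw [← coupleLeft_apply, hW.2 a b c d e h1 h2' ε i k l, Matrix.mul_sum, Matrix.sum_apply]
    refine Finset.sum_congr rfl fun f _ => ?_
    rw [coupleRight_apply, Matrix.mul_smul, Matrix.smul_apply, smul_eq_mul]
  -- Cancel the common twist, then pair with the right coupling through `f`; orthogonality isolates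
  -- the coefficient wanted.
  replace key := congrArg (fun X => ((rightMatrix a b c f e).map (algebraMap ℝ R))ᵀ * (G' * X)) key
  simp only [← Matrix.mul_assoc G' G, hG', Matrix.one_mul] at key
  have hmem : f ∈ S := Finset.mem_filter.2 ⟨by rw [Finset.mem_range]; have := h4.2.2.2; omega, h4, h3'⟩
  have hm : ∀ X : Matrix ((Fin (a + 1) × Fin (b + 1)) × Fin (c + 1)) (Fin (e + 1)) ℝ,
      ((rightMatrix a b c f e).map (algebraMap ℝ R))ᵀ * X.map (algebraMap ℝ R) =
      ((rightMatrix a b c f e)ᵀ * X).map (algebraMap ℝ R) := by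
    intro X
    rw [Matrix.map_mul, Matrix.transpose_map]
  rw [Matrix.mul_sum, Finset.sum_eq_single f, Matrix.mul_smul, hm, hm, overlap_eq,
    rightMatrix_orthonormal h4 h3'] at key
  · have k0 := congrFun (congrFun key 0) 0
    simp only [Matrix.map_apply, Matrix.smul_apply, Matrix.one_apply_eq, smul_eq_mul, mul_one,
      map_one] at k0
    rw [← sqrt_mul_racahCoeff h1 h2 h3 h4, map_mul] at k0
    have hu : IsUnit (algebraMap ℝ R (Real.sqrt (((d : ℝ) + 1) * (f + 1)))) :=
      (IsUnit.mk0 _ (Real.sqrt_pos.2 (by positivity)).ne').map _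
    exact (hu.mul_left_cancel k0).symm
  · intro f' _ hf'
    rw [Matrix.mul_smul, hm, rightMatrix_orthogonal hf'.symm]
    ext i j
    simp
  · intro h'
    exact absurd hmem h'

end Deformed

end
end Jordanian

namespace Jordanian
open scoped Kronecker PowerSeries Matrix
noncomputable section

set_option linter.unusedSectionVars false

/-! ### Products of coupled tensor operators -/

section Over

variable {R : Type*} [CommRing R] [Algebra ℝ R] [Algebra ℚ R]

theorem spin_J0_map (n : ℕ) : (spin ℝ n).J0.map (algebraMap ℝ R) = (spin R n).J0 := by
  ext i k
  simp only [spin, Matrix.map_apply, Matrix.diagonal_apply]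
  split_ifs <;> simp [map_ofNat]

theorem spin_Jp_map (n : ℕ) : (spin ℝ n).Jp.map (algebraMap ℝ R) = (spin R n).Jp := by
  ext i k
  simp only [spin, Matrix.map_apply, Matrix.of_apply]
  split_ifs <;> simp

theorem kronecker_add_map {ι κ : Type*} [DecidableEq ι] [DecidableEq κ] (X : Matrix ι ι ℝ)
    (Y : Matrix κ κ ℝ) : (X ⊗ₖ (1 : Matrix κ κ ℝ) + (1 : Matrix ι ι ℝ) ⊗ₖ Y).map (algebraMap ℝ R) =
      X.map (algebraMap ℝ R) ⊗ₖ 1 + 1 ⊗ₖ Y.map (algebraMap ℝ R) := by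
  ext ⟨i, k⟩ ⟨i', k'⟩
  simp [Matrix.one_apply, apply_ite (algebraMap ℝ R)]

theorem cgMatrixOver_J0 (A B K : ℕ) : (tensorZero (spin R A) (spin R B)).J0 * cgMatrixOver R A B K =
    cgMatrixOver R A B K * (spin R K).J0 := by
  have h := congrArg (fun X => X.map (algebraMap ℝ R)) (cgMatrix_intertwines A B K).j0
  simp only [tensorZero, Matrix.map_mul, kronecker_add_map, spin_J0_map] at h
  exact h

theorem cgMatrixOver_Jp (A B K : ℕ) : (tensorZero (spin R A) (spin R B)).Jp * cgMatrixOver R A B K =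
    cgMatrixOver R A B K * (spin R K).Jp := by
  have h := congrArg (fun X => X.map (algebraMap ℝ R)) (cgMatrix_intertwines A B K).jp
  simp only [tensorZero, Matrix.map_mul, kronecker_add_map, spin_Jp_map] at h
  exact h

theorem cgMatrixOver_gram (A B K K' : ℕ) :
    (cgMatrixOver R A B K)ᵀ * cgMatrixOver R A B K' =
      ((cgMatrix A B K)ᵀ * cgMatrix A B K').map (algebraMap ℝ R) := by
  rw [Matrix.map_mul, Matrix.transpose_map]
  rfl

/-- The basis of spin `K` in the deformed tensor product of two irreducible representations. -/
def coupledBasis (h : R) (A B K : ℕ) : Matrix (Fin (A + 1) × Fin (B + 1)) (Fin (K + 1)) R :=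
  twist h (spin R A) (spin R B) * cgMatrixOver R A B K

theorem coupledBasis_J0 (h : R) (A B K : ℕ) :
    (tensor h (spin R A) (spin R B)).J0 * coupledBasis h A B K =
      coupledBasis h A B K * (spin R K).J0 :=
  mul_intertwine_comp (tensor_J0_mul_twist h _ _ (isNilpotent_spin_Jp h B)) (cgMatrixOver_J0 A B K)

theorem coupledBasis_Jp (h : R) (A B K : ℕ) :
    (tensor h (spin R A) (spin R B)).Jp * coupledBasis h A B K =
      coupledBasis h A B K * (spin R K).Jp :=
  mul_intertwine_comp (tensor_Jp_mul_twist h _ _ (isNilpotent_spin_Jp h B)) (cgMatrixOver_Jp A B K)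

/-- Moved through the inner coupling, the twist on `(Vᵃ ⊗ Vᵇ) ⊗ Vᶜ` becomes the twist on `V^d ⊗ Vᶜ`.
The product law can thus be applied in two separate stages. -/
theorem coupleLeft_eq_sum (h : R) (a b c d e : ℕ) (ε : Fin (e + 1)) (i : Fin (a + 1))
    (k : Fin (b + 1)) (l : Fin (c + 1)) : coupleLeft h a b c d e ε ((i, k), l) =
      ∑ δ : Fin (d + 1), coupledBasis h a b d (i, k) δ * coupledBasis h d c e (δ, l) ε := by
  rw [coupleLeft, couple_apply, of_couple_stdBasis, of_stdBasis, ← coupledBasis, ← Matrix.mul_assoc,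
    twist_mul_kronecker_one h (spin R c) (isNilpotent_spin_Jp h c) (coupledBasis_J0 h a b d),
    Matrix.mul_assoc, ← coupledBasis, Matrix.mul_apply, Fintype.sum_prod_type]
  refine Finset.sum_congr rfl fun δ _ => ?_
  simp [Matrix.one_apply]

theorem coupleRight_eq_sum (h : R) (a b c f e : ℕ) (ε : Fin (e + 1)) (i : Fin (a + 1))
    (k : Fin (b + 1)) (l : Fin (c + 1)) : coupleRight h a b c f e ε (i, (k, l)) =
      ∑ φ : Fin (f + 1), coupledBasis h b c f (k, l) φ * coupledBasis h a f e (i, φ) ε := by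
  rw [coupleRight, couple_apply, of_couple_stdBasis, of_stdBasis, ← coupledBasis,
    ← Matrix.mul_assoc, twist_mul_one_kronecker h (spin R a)
      (isNilpotent_tensor_Jp h _ _ (isNilpotent_spin_Jp h b) (isNilpotent_spin_Jp h c))
      (isNilpotent_spin_Jp h f) (coupledBasis_Jp h b c f),
    Matrix.mul_assoc, ← coupledBasis, Matrix.mul_apply, Fintype.sum_prod_type,
    Finset.sum_eq_single i]
  · simp
  · intro j _ hj
    simp [hj.symm]
  · simp

theorem twistInv_spin_apply (h : R) (A B : ℕ) (i i' : Fin (A + 1)) (k k' : Fin (B + 1)) :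
    twistInv h (spin R A) (spin R B) (i, k) (i', k') = if i = i' then
      IsNilpotent.exp ((2 * ((i : ℕ) : R) - A) • ((2 : ℚ)⁻¹ • sigma h (spin R B).Jp)) k k'
    else 0 := by
  have h1 : (2 : ℚ)⁻¹ • ((spin R A).J0 ⊗ₖ sigma h (spin R B).Jp) =
      Matrix.diagonal (fun i : Fin (A + 1) => 2 * ((i : ℕ) : R) - A) ⊗ₖ
        ((2 : ℚ)⁻¹ • sigma h (spin R B).Jp) := by
    rw [Matrix.kronecker_smul]
    rfl
  rw [twistInv, h1, exp_diagonal_kronecker_apply _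
    ((isNilpotent_sigma h (isNilpotent_spin_Jp h B)).smul _)]

end Over

/-! ### Central scalars `ℂ⟦h⟧` in the boson power series -/

theorem scalar_commute (c : ℂ⟦X⟧) (x : BosonH) : scalar c * x = x * scalar c := by
  ext n
  rw [PowerSeries.coeff_mul, PowerSeries.coeff_mul, ← Finset.Nat.sum_antidiagonal_swap]
  refine Finset.sum_congr rfl fun p _ => ?_
  simp only [scalar, PowerSeries.coeff_map, Prod.fst_swap, Prod.snd_swap]
  exact Algebra.commutes _ _

/-- A nonzero element of `ℂ⟦h⟧` is a unit times `h^n`, and multiplication by `h^n` only shifts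
coefficients. -/
theorem scalar_mul_cancel {c c' : ℂ⟦X⟧} {x : BosonH} (hx : x ≠ 0)
    (h : scalar c * x = scalar c' * x) : c = c' := by
  by_contra hc
  have h0 : c - c' ≠ 0 := sub_ne_zero.2 hc
  have h1 : scalar (c - c') * x = 0 := by rw [map_sub, sub_mul, h, sub_self]
  obtain ⟨n, u, hu⟩ : ∃ (n : ℕ) (u : ℂ⟦X⟧ˣ), c - c' = (PowerSeries.X : ℂ⟦X⟧) ^ n * (u : ℂ⟦X⟧) := by
    obtain ⟨n, u, hu⟩ := IsDiscreteValuationRing.associated_pow_irreducible h0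
      (PowerSeries.X_prime (R := ℂ)).irreducible
    exact ⟨n, u⁻¹, by rw [← hu, mul_assoc, Units.mul_inv, mul_one]⟩
  apply hx
  have h2 : scalar (PowerSeries.X ^ n) * x = 0 := by
    have h3 : scalar (PowerSeries.X ^ n) = scalar (↑u⁻¹ : ℂ⟦X⟧) * scalar (c - c') := by
      rw [← map_mul, hu, mul_comm, mul_assoc, Units.mul_inv, mul_one]
    rw [h3, mul_assoc, h1, mul_zero]
  have h4 : scalar (PowerSeries.X ^ n) = (PowerSeries.X : BosonH) ^ n := by
    rw [map_pow, scalar, PowerSeries.map_X]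
  rw [h4] at h2
  ext m
  have h5 := congrArg (PowerSeries.coeff (m + n)) h2
  rwa [PowerSeries.coeff_X_pow_mul] at h5

theorem scalar_mul_scalar_mul (c c' : ℂ⟦X⟧) (x : BosonH) :
    scalar c * (scalar c' * x) = scalar (c * c') * x := by rw [map_mul, mul_assoc]

/-! ### Associativity of the product law -/

section ProductLaw

variable {P : (n : ℕ) → Fin (n + 1) → BosonH} {T : ℕ → ℕ → ℕ → ℂ⟦X⟧}

/-- The reduced coefficient of the product law: the product of the operators of spins `j` and `j'`,
coupled to spin `k`, is `reducedCoeff T k j j'` times the operator of spin `k`. -/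
def reducedCoeff (T : ℕ → ℕ → ℕ → ℂ⟦X⟧) (k j j' : ℕ) : ℂ⟦X⟧ :=
  algebraMap ℝ ℂ⟦X⟧ ((-(2 : ℝ)⁻¹) ^ ((j + j' - k) / 2) * (Real.sqrt ((k : ℝ) + 1))⁻¹) * T k j j'

theorem HasProductLaw.mul_eq (hP : HasProductLaw P T) (j j' : ℕ) (p : Fin (j + 1) × Fin (j' + 1)) :
    P j p.1 * P j' p.2 =
      ∑ k ∈ (Finset.range (j + j' + 1)).filter (fun k => Triad k j j'), ∑ r : Fin (k + 1),
        scalar (reducedCoeff T k j j' * ((cgMatrixOver ℂ⟦X⟧ j j' k)ᵀ *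
          twistInv (PowerSeries.X : ℂ⟦X⟧) (spin ℂ⟦X⟧ j) (spin ℂ⟦X⟧ j')) r p) * P k r := by
  obtain ⟨m, m'⟩ := p
  rw [hP j j' m m']
  refine Finset.sum_congr rfl fun k _ => ?_
  simp only [Matrix.mul_apply, Fintype.sum_prod_type, Finset.mul_sum, map_sum, Finset.sum_mul]
  symm
  rw [Finset.sum_comm]
  refine Finset.sum_congr rfl fun n _ => ?_
  rw [Finset.sum_comm]
  refine Finset.sum_congr rfl fun n' _ => Finset.sum_congr rfl fun r _ => ?_
  congr 2
  -- `𝓕⁻¹` is diagonal in its first index, so `m` in the Clebsch-Gordan coefficient may be read as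
  -- `n`. Swapping the spins there turns the powers of `1/2` into powers of `-1/2`.
  by_cases hn : n = m
  · subst hn
    rw [cg_swap j j' k, reducedCoeff, Matrix.transpose_apply, cgMatrixOver, Matrix.map_apply,
      cgMatrix, Matrix.of_apply, neg_pow, map_mul, map_mul, map_mul, map_mul]
    ring
  · rw [twistInv_spin_apply, if_neg hn]
    ring

/-- With `C` the Clebsch-Gordan matrix, the product law contains `Cᵀ 𝓕⁻¹` and the coupled basis is
`𝓕 C`: the twists cancel and orthogonality leaves the component of spin `k`. -/
theorem HasProductLaw.sum_coupledBasis (hP : HasProductLaw P T) {j j' k : ℕ} (hT : Triad k j j')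
    (r : Fin (k + 1)) :
    ∑ p : Fin (j + 1) × Fin (j' + 1),
      scalar (coupledBasis (PowerSeries.X : ℂ⟦X⟧) j j' k p r) * (P j p.1 * P j' p.2) =
      scalar (reducedCoeff T k j j') * P k r := by
  set S := (Finset.range (j + j' + 1)).filter (fun k => Triad k j j')
  have h1 : ∀ k' ∈ S, ∀ r' : Fin (k' + 1),
      ∑ p : Fin (j + 1) × Fin (j' + 1), scalar (coupledBasis (PowerSeries.X : ℂ⟦X⟧) j j' k p r) *
        (scalar (reducedCoeff T k' j j' * ((cgMatrixOver ℂ⟦X⟧ j j' k')ᵀ *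
          twistInv (PowerSeries.X : ℂ⟦X⟧) (spin ℂ⟦X⟧ j) (spin ℂ⟦X⟧ j')) r' p) * P k' r') =
      scalar (reducedCoeff T k' j j' *
        (((cgMatrix j j' k')ᵀ * cgMatrix j j' k).map (algebraMap ℝ ℂ⟦X⟧)) r' r) * P k' r' := by
    intro k' _ r'
    have h2 : ((cgMatrix j j' k')ᵀ * cgMatrix j j' k).map (algebraMap ℝ ℂ⟦X⟧) =
        ((cgMatrixOver ℂ⟦X⟧ j j' k')ᵀ * twistInv (PowerSeries.X : ℂ⟦X⟧) (spin ℂ⟦X⟧ j) (spin ℂ⟦X⟧ j')) *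
          coupledBasis (PowerSeries.X : ℂ⟦X⟧) j j' k := by
      rw [coupledBasis, Matrix.mul_assoc, ← Matrix.mul_assoc (twistInv _ _ _),
        twistInv_mul_twist _ _ _ (isNilpotent_spin_Jp _ j'), Matrix.one_mul, cgMatrixOver_gram]
    rw [h2, Matrix.mul_apply, Finset.mul_sum, map_sum, Finset.sum_mul]
    refine Finset.sum_congr rfl fun p _ => ?_
    rw [scalar_mul_scalar_mul]
    congr 2
    ring
  simp only [hP.mul_eq, Finset.mul_sum]
  rw [Finset.sum_comm, Finset.sum_congr rfl (fun k' hk' => by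
    rw [Finset.sum_comm, Finset.sum_congr rfl (fun r' _ => h1 k' hk' r')])]
  rw [Finset.sum_eq_single k]
  · rw [cgMatrix_orthonormal hT.rotate, Finset.sum_eq_single r]
    · simp
    · intro r' _ hr'
      simp [hr']
    · simp
  · intro k' _ hk'
    rw [cgMatrix_orthogonal hk']
    simp
  · intro h
    have hk : k < j + j' + 1 := by have := hT.2.1; omega
    exact absurd (Finset.mem_filter.2 ⟨Finset.mem_range.2 hk, hT⟩) h

theorem HasProductLaw.sum_coupleLeft (hP : HasProductLaw P T) {a b c d e : ℕ} (h1 : Triad d a b)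
    (h2 : Triad e d c) (ε : Fin (e + 1)) :
    ∑ l : Fin (c + 1), ∑ q : Fin (a + 1) × Fin (b + 1),
      scalar (coupleLeft PowerSeries.X a b c d e ε (q, l)) * (P a q.1 * P b q.2 * P c l) =
      scalar (reducedCoeff T d a b * reducedCoeff T e d c) * P e ε := by
  have h3 : ∀ l : Fin (c + 1), ∑ q : Fin (a + 1) × Fin (b + 1),
      scalar (coupleLeft PowerSeries.X a b c d e ε (q, l)) * (P a q.1 * P b q.2 * P c l) =
      ∑ δ : Fin (d + 1), scalar (reducedCoeff T d a b) *
        (scalar (coupledBasis (PowerSeries.X : ℂ⟦X⟧) d c e (δ, l) ε) * (P d δ * P c l)) := by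
    intro l
    calc _ = ∑ q : Fin (a + 1) × Fin (b + 1), ∑ δ : Fin (d + 1),
          scalar (coupledBasis (PowerSeries.X : ℂ⟦X⟧) d c e (δ, l) ε) *
          (scalar (coupledBasis (PowerSeries.X : ℂ⟦X⟧) a b d q δ) * (P a q.1 * P b q.2) * P c l) := by
          refine Finset.sum_congr rfl fun q _ => ?_
          obtain ⟨i, k⟩ := q
          rw [coupleLeft_eq_sum, map_sum, Finset.sum_mul]
          refine Finset.sum_congr rfl fun δ _ => ?_
          rw [mul_assoc (scalar (coupledBasis _ _ _ _ _ _)), scalar_mul_scalar_mul, mul_comm]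
      _ = _ := by
          rw [Finset.sum_comm]
          refine Finset.sum_congr rfl fun δ _ => ?_
          rw [← Finset.mul_sum, ← Finset.sum_mul, hP.sum_coupledBasis h1, scalar_mul_scalar_mul,
            mul_assoc, scalar_mul_scalar_mul, mul_comm]
  simp only [h3]
  rw [Finset.sum_comm]
  simp only [← Finset.mul_sum]
  rw [← Fintype.sum_prod_type (f := fun p : Fin (d + 1) × Fin (c + 1) =>
    scalar (coupledBasis (PowerSeries.X : ℂ⟦X⟧) d c e p ε) * (P d p.1 * P c p.2)),
    hP.sum_coupledBasis h2, scalar_mul_scalar_mul]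

theorem HasProductLaw.sum_coupleRight (hP : HasProductLaw P T) {a b c f e : ℕ} (h1 : Triad f b c)
    (h2 : Triad e a f) (ε : Fin (e + 1)) :
    ∑ i : Fin (a + 1), ∑ q : Fin (b + 1) × Fin (c + 1),
      scalar (coupleRight PowerSeries.X a b c f e ε (i, q)) * (P a i * (P b q.1 * P c q.2)) =
      scalar (reducedCoeff T f b c * reducedCoeff T e a f) * P e ε := by
  have h3 : ∀ i : Fin (a + 1), ∑ q : Fin (b + 1) × Fin (c + 1),
      scalar (coupleRight PowerSeries.X a b c f e ε (i, q)) * (P a i * (P b q.1 * P c q.2)) =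
      ∑ φ : Fin (f + 1), scalar (reducedCoeff T f b c) *
        (scalar (coupledBasis (PowerSeries.X : ℂ⟦X⟧) a f e (i, φ) ε) * (P a i * P f φ)) := by
    intro i
    calc _ = ∑ q : Fin (b + 1) × Fin (c + 1), ∑ φ : Fin (f + 1),
          scalar (coupledBasis (PowerSeries.X : ℂ⟦X⟧) a f e (i, φ) ε) *
          (P a i * (scalar (coupledBasis (PowerSeries.X : ℂ⟦X⟧) b c f q φ) * (P b q.1 * P c q.2))) := by
          refine Finset.sum_congr rfl fun q _ => ?_
          obtain ⟨k, l⟩ := q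
          rw [coupleRight_eq_sum, map_sum, Finset.sum_mul]
          refine Finset.sum_congr rfl fun φ _ => ?_
          rw [← mul_assoc (P a i) (scalar _), ← scalar_commute, mul_assoc, scalar_mul_scalar_mul,
            mul_comm]
      _ = _ := by
          rw [Finset.sum_comm]
          refine Finset.sum_congr rfl fun φ _ => ?_
          rw [← Finset.mul_sum, ← Finset.mul_sum, hP.sum_coupledBasis h1, ← mul_assoc (P a i) (scalar _),
            ← scalar_commute, mul_assoc, scalar_mul_scalar_mul, scalar_mul_scalar_mul, mul_comm]
  simp only [h3]
  simp only [← Finset.mul_sum]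
  rw [← Fintype.sum_prod_type (f := fun p : Fin (a + 1) × Fin (f + 1) =>
    scalar (coupledBasis (PowerSeries.X : ℂ⟦X⟧) a f e p ε) * (P a p.1 * P f p.2)),
    hP.sum_coupledBasis h2, scalar_mul_scalar_mul]

/-- Both sides are the coefficient of `P_e` in the same contracted triple product, bracketed in the
two possible ways and linked by the Racah expansion. -/
theorem HasProductLaw.reducedCoeff_mul (hP : HasProductLaw P T) {W : ℕ → ℕ → ℕ → ℕ → ℕ → ℕ → ℂ⟦X⟧}
    (hW : IsRacah (PowerSeries.X : ℂ⟦X⟧) W) {a b c d e : ℕ} (h1 : Triad a b d) (h2 : Triad d c e)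
    (hne : P e 0 ≠ 0) : reducedCoeff T d a b * reducedCoeff T e d c =
      ∑ f ∈ (Finset.range (b + c + 1)).filter (fun f => Triad b c f ∧ Triad a f e),
        algebraMap ℝ ℂ⟦X⟧ (Real.sqrt (((d : ℝ) + 1) * (f + 1))) * W a b e c d f *
          (reducedCoeff T f b c * reducedCoeff T e a f) := by
  refine scalar_mul_cancel hne ?_
  rw [← hP.sum_coupleLeft h1.rotate.rotate h2.rotate.rotate, map_sum, Finset.sum_mul]
  have h3 : ∀ f ∈ (Finset.range (b + c + 1)).filter (fun f => Triad b c f ∧ Triad a f e),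
      scalar (algebraMap ℝ ℂ⟦X⟧ (Real.sqrt (((d : ℝ) + 1) * (f + 1))) * W a b e c d f *
        (reducedCoeff T f b c * reducedCoeff T e a f)) * P e 0 =
      ∑ i : Fin (a + 1), ∑ q : Fin (b + 1) × Fin (c + 1),
        scalar (algebraMap ℝ ℂ⟦X⟧ (Real.sqrt (((d : ℝ) + 1) * (f + 1))) * W a b e c d f *
          coupleRight PowerSeries.X a b c f e 0 (i, q)) * (P a i * (P b q.1 * P c q.2)) := by
    intro f hf
    obtain ⟨-, h4, h5⟩ := Finset.mem_filter.1 hf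
    rw [← scalar_mul_scalar_mul, ← hP.sum_coupleRight h4.rotate.rotate h5.rotate.rotate]
    simp only [Finset.mul_sum, scalar_mul_scalar_mul]
  have hL : ∀ G : Fin (c + 1) → Fin (a + 1) × Fin (b + 1) → BosonH,
      ∑ l, ∑ q, G l q = ∑ i, ∑ k, ∑ l, G l (i, k) := by
    intro G
    rw [Finset.sum_comm, Fintype.sum_prod_type]
  have hR : ∀ (S : Finset ℕ) (H : ℕ → Fin (a + 1) → Fin (b + 1) × Fin (c + 1) → BosonH),
      ∑ f ∈ S, ∑ i, ∑ q, H f i q = ∑ i, ∑ k, ∑ l, ∑ f ∈ S, H f i (k, l) := by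
    intro S H
    rw [Finset.sum_comm]
    refine Finset.sum_congr rfl fun i _ => ?_
    rw [Finset.sum_comm, Fintype.sum_prod_type]
  rw [Finset.sum_congr rfl h3, hL, hR]
  refine Finset.sum_congr rfl fun i _ => Finset.sum_congr rfl fun k _ =>
    Finset.sum_congr rfl fun l _ => ?_
  rw [hW.2 a b c d e h1 h2 0 i k l, map_sum, Finset.sum_mul]
  refine Finset.sum_congr rfl fun f _ => ?_
  rw [mul_assoc (P a i)]

/-- The relation between the triangle function and the Racah coefficients. -/
theorem HasProductLaw.triangle_relation (hP : HasProductLaw P T)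
    {W : ℕ → ℕ → ℕ → ℕ → ℕ → ℕ → ℂ⟦X⟧} (hW : IsRacah (PowerSeries.X : ℂ⟦X⟧) W)
    (hne : ∀ n, P n 0 ≠ 0) {a b c d f : ℕ} (h1 : Triad a c f) (h2 : Triad b d f) :
    T c f a * T f d b = ((f : ℂ⟦X⟧) + 1) *
      ∑ e ∈ (Finset.range (a + b + 1)).filter (fun e => Triad a b e ∧ Triad c d e),
        W a b c d e f * T e b a * T c d e := by
  -- The triple product is that of spins `d, b, a`, with `d` and `b` coupled to `f` and total spin
  -- `c`.
  have key := hP.reducedCoeff_mul hW h2.swap h1.rotate.rotate (hne c)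
  have hset : (Finset.range (b + a + 1)).filter (fun e => Triad b a e ∧ Triad d e c) =
      (Finset.range (a + b + 1)).filter (fun e => Triad a b e ∧ Triad c d e) := by
    ext e
    rw [Finset.mem_filter, Finset.mem_filter, Finset.mem_range, Finset.mem_range, add_comm b a]
    exact ⟨fun h => ⟨h.1, h.2.1.swap, h.2.2.rotate.rotate⟩,
      fun h => ⟨h.1, h.2.1.swap, h.2.2.rotate⟩⟩
  rw [hset] at key
  set x : ℝ := (-(2 : ℝ)⁻¹) ^ ((d + b - f) / 2) * (Real.sqrt ((f : ℝ) + 1))⁻¹ *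
    ((-(2 : ℝ)⁻¹) ^ ((f + a - c) / 2) * (Real.sqrt ((c : ℝ) + 1))⁻¹) with hx
  have hf0 : Real.sqrt ((f : ℝ) + 1) ≠ 0 := (Real.sqrt_pos.2 (by positivity)).ne'
  have hc0 : Real.sqrt ((c : ℝ) + 1) ≠ 0 := (Real.sqrt_pos.2 (by positivity)).ne'
  have hx0 : x ≠ 0 := by
    have : (-(2 : ℝ)⁻¹) ≠ 0 := by norm_num
    positivity
  have hu : IsUnit (algebraMap ℝ ℂ⟦X⟧ x) := (IsUnit.mk0 x hx0).map _
  apply hu.mul_left_cancel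
  have hL : reducedCoeff T f d b * reducedCoeff T c f a =
      algebraMap ℝ ℂ⟦X⟧ x * (T c f a * T f d b) := by
    simp only [reducedCoeff, hx, map_mul]
    ring
  rw [← hL, key, Finset.mul_sum, Finset.mul_sum]
  refine Finset.sum_congr rfl fun e he => ?_
  obtain ⟨-, h3, h4⟩ := Finset.mem_filter.1 he
  have hWs : W d b c a f e = W a b c d e f := by
    rw [isRacah_unique _ hW]
    simp only [racahCoeff_reverse]
  -- The root of `e + 1` cancels, and the remaining root of `f + 1` against its inverse inside `x`
  -- yields `f + 1`. The exponents of `-1/2` have the same total on both sides, independent of `e`.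
  have hr : Real.sqrt (((f : ℝ) + 1) * (e + 1)) *
      ((-(2 : ℝ)⁻¹) ^ ((b + a - e) / 2) * (Real.sqrt ((e : ℝ) + 1))⁻¹ *
      ((-(2 : ℝ)⁻¹) ^ ((d + e - c) / 2) * (Real.sqrt ((c : ℝ) + 1))⁻¹)) = x * (f + 1) := by
    have he0 : Real.sqrt ((e : ℝ) + 1) ≠ 0 := (Real.sqrt_pos.2 (by positivity)).ne'
    have hp : (-(2 : ℝ)⁻¹) ^ ((b + a - e) / 2) * (-(2 : ℝ)⁻¹) ^ ((d + e - c) / 2) =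
        (-(2 : ℝ)⁻¹) ^ ((d + b - f) / 2) * (-(2 : ℝ)⁻¹) ^ ((f + a - c) / 2) := by
      rw [← pow_add, ← pow_add]
      congr 1
      obtain ⟨⟨_, _⟩, _⟩ := h1
      obtain ⟨⟨_, _⟩, _⟩ := h2
      obtain ⟨⟨_, _⟩, _⟩ := h3
      obtain ⟨⟨_, _⟩, _⟩ := h4
      omega
    rw [Real.sqrt_mul (by positivity), hx]
    have hs := Real.mul_self_sqrt (show (0 : ℝ) ≤ f + 1 by positivity)
    field_simp
    rw [pow_two, hs]
    linear_combination ((f : ℝ) + 1) * hp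
  have hr' := congrArg (algebraMap ℝ ℂ⟦X⟧) hr
  simp only [map_mul, map_add, map_natCast, map_one] at hr'
  rw [hWs]
  simp only [reducedCoeff, map_mul]
  linear_combination W a b c d e f * T e b a * T c d e * hr'

end ProductLaw

end
end Jordanian

namespace Jordanian
open scoped Kronecker PowerSeries Matrix
noncomputable section

/-! ### Weyl ordering -/

theorem transvect_succ_right (s : ℕ) (l b i d : ℤ) :
    ((b : ℝ) + 1) * transvect (s + 1) l (b + 1) i d =
      transvect (s + 1) l b i d + (s + 1) * transvect s l b (i - 1) d := by
  induction s generalizing l b i d with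
  | zero =>
    have h1 := mul_invFact (b + 1)
    have h2 := mul_invFact b
    simp only [transvect, add_sub_cancel_right] at *
    rw [← h2, ← h1]
    push_cast
    ring
  | succ s ih =>
    have e1 := ih l (b - 1) (i - 1) d
    have e2 := ih (l - 1) b i (d - 1)
    rw [transvect_succ (s + 1), transvect_succ (s + 1) l, add_sub_cancel_right]
    rw [sub_add_cancel] at e1
    push_cast at *
    linear_combination e1 - e2 - (s + 1) * transvect_succ s l b (i - 1) d

theorem transvect_zero_succ_right (l b i d : ℤ) :
    ((b : ℝ) + 1) * transvect 0 l (b + 1) i d = transvect 0 l b i d := by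
  have := mul_invFact (b + 1)
  rw [add_sub_cancel_right] at this
  push_cast at this
  simp only [transvect]
  linear_combination invFact l * invFact i * invFact d * this

/-- The Leibniz rule for the first variable. -/
theorem transvect_leibniz_left (s : ℕ) (l b i d : ℤ) :
    ((l : ℝ) + i - s) * transvect s l b i d =
      transvect s (l - 1) b i d + transvect s l b (i - 1) d := by
  induction s generalizing l b i d with
  | zero =>
    simp only [transvect, ← mul_invFact l, ← mul_invFact i, Nat.cast_zero]
    ring
  | succ s ih =>
    have h1 := ih l (b - 1) (i - 1) d
    have h2 := ih (l - 1) b i (d - 1)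
    simp only [transvect_succ]
    push_cast at *
    linear_combination h1 - h2

section Weyl

variable {B : Type*} [Ring B] [Algebra ℝ B]

/-- The Weyl-ordered (symmetrized) monomial of degree `m` in `x` and `n` in `y`. -/
def weyl (x y : B) : ℕ → ℕ → B
  | 0, n => y ^ n
  | m + 1, n => (2 : ℝ)⁻¹ • (x * weyl x y m n + weyl x y m n * x)

variable {x y : B}

theorem weyl_succ (m n : ℕ) :
    weyl x y (m + 1) n = (2 : ℝ)⁻¹ • (x * weyl x y m n + weyl x y m n * x) := rfl

theorem comm_pow (hxy : y * x = x * y + 1) (n : ℕ) :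
    y ^ n * x = x * y ^ n + (n : ℝ) • y ^ (n - 1) := by
  induction n with
  | zero => simp
  | succ n ih =>
    rw [pow_succ', mul_assoc, ih, mul_add, ← mul_assoc, hxy, mul_smul_comm, Nat.add_sub_cancel]
    rcases n with _ | n
    · simp
    · rw [Nat.add_sub_cancel, ← pow_succ', add_mul, mul_assoc, ← pow_succ', one_mul]
      push_cast
      module

theorem weyl_mul_x (hxy : y * x = x * y + 1) (m n : ℕ) :
    weyl x y m n * x = x * weyl x y m n + (n : ℝ) • weyl x y m (n - 1) := by
  induction m with
  | zero => exact comm_pow hxy n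
  | succ m ih =>
    simp only [weyl_succ]
    rw [smul_mul_assoc, mul_smul_comm, add_mul, mul_add, mul_assoc x, ih]
    simp only [add_mul, mul_add, smul_mul_assoc, mul_smul_comm, mul_assoc, ih]
    module

/-- On Weyl symbols, left multiplication by `x` is `x - ½ ∂_y`; likewise `y_mul_weyl` is `y + ½
∂_x`. -/
theorem x_mul_weyl (hxy : y * x = x * y + 1) (m n : ℕ) :
    x * weyl x y m n = weyl x y (m + 1) n - ((2 : ℝ)⁻¹ * n) • weyl x y m (n - 1) := by
  rw [weyl_succ, weyl_mul_x hxy]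
  module

theorem y_mul_weyl (hxy : y * x = x * y + 1) (m n : ℕ) :
    y * weyl x y m n = weyl x y m (n + 1) + ((2 : ℝ)⁻¹ * m) • weyl x y (m - 1) n := by
  induction m with
  | zero => simp [weyl, pow_succ']
  | succ m ih =>
    rw [weyl_succ, mul_smul_comm, mul_add, ← mul_assoc, hxy, ← mul_assoc, ih, weyl_succ]
    simp only [add_mul, mul_add, one_mul, mul_assoc, ih, smul_mul_assoc, mul_smul_comm,
      Nat.add_sub_cancel]
    rcases m with _ | m
    · push_cast
      module
    · rw [Nat.add_sub_cancel]
      have h2 : weyl x y m n * x = (2 : ℝ) • weyl x y (m + 1) n - x * weyl x y m n := by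
        rw [weyl_succ, smul_smul]; norm_num
      rw [h2]
      push_cast
      module

theorem weyl_mul_y (hxy : y * x = x * y + 1) (m n : ℕ) :
    weyl x y m n * y = weyl x y m (n + 1) - ((2 : ℝ)⁻¹ * m) • weyl x y (m - 1) n := by
  have hyx : x * y = y * x - 1 := by rw [hxy, add_sub_cancel_right]
  induction m with
  | zero => simp [weyl, pow_succ]
  | succ m ih =>
    rw [weyl_succ, smul_mul_assoc, add_mul, mul_assoc x, mul_assoc _ x y, hyx, mul_sub,
      ← mul_assoc _ y x, ih, weyl_succ]
    simp only [sub_mul, mul_sub, mul_one, smul_mul_assoc, mul_smul_comm, Nat.add_sub_cancel]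
    rcases m with _ | m
    · push_cast
      module
    · rw [Nat.add_sub_cancel]
      have h2 : weyl x y m n * x = (2 : ℝ) • weyl x y (m + 1) n - x * weyl x y m n := by
        rw [weyl_succ, smul_smul]; norm_num
      rw [h2]
      push_cast
      module

/-- Weyl-ordered monomials, indexed by integers. -/
def weylInt (x y : B) (m n : ℤ) : B := weyl x y m.toNat n.toNat

theorem x_mul_weylInt (hxy : y * x = x * y + 1) {m n : ℤ} (hm : 0 ≤ m) (hn : 0 ≤ n) :
    x * weylInt x y m n =
      weylInt x y (m + 1) n - ((2 : ℝ)⁻¹ * n) • weylInt x y m (n - 1) := by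
  obtain ⟨m, rfl⟩ := Int.eq_ofNat_of_zero_le hm
  obtain ⟨n, rfl⟩ := Int.eq_ofNat_of_zero_le hn
  rw [weylInt, weylInt, weylInt, Int.toNat_natCast, Int.toNat_natCast, x_mul_weyl hxy,
    show ((m : ℤ) + 1).toNat = m + 1 by omega, show ((n : ℤ) - 1).toNat = n - 1 by omega,
    Int.cast_natCast]

theorem y_mul_weylInt (hxy : y * x = x * y + 1) {m n : ℤ} (hm : 0 ≤ m) (hn : 0 ≤ n) :
    y * weylInt x y m n =
      weylInt x y m (n + 1) + ((2 : ℝ)⁻¹ * m) • weylInt x y (m - 1) n := by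
  obtain ⟨m, rfl⟩ := Int.eq_ofNat_of_zero_le hm
  obtain ⟨n, rfl⟩ := Int.eq_ofNat_of_zero_le hn
  rw [weylInt, weylInt, weylInt, Int.toNat_natCast, Int.toNat_natCast, y_mul_weyl hxy,
    show ((n : ℤ) + 1).toNat = n + 1 by omega, show ((m : ℤ) - 1).toNat = m - 1 by omega,
    Int.cast_natCast]

/-- Divided Weyl-ordered monomials. -/
def weylDiv (x y : B) (m n : ℤ) : B := (invFact m * invFact n) • weylInt x y m n

theorem weylDiv_succ_left (hxy : y * x = x * y + 1) {m n : ℤ} (hm : 0 ≤ m) (hn : 0 ≤ n) :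
    ((m : ℝ) + 1) • weylDiv x y (m + 1) n =
      x * weylDiv x y m n + (2 : ℝ)⁻¹ • weylDiv x y m (n - 1) := by
  have h1 := mul_invFact (m + 1)
  rw [add_sub_cancel_right] at h1
  push_cast at h1
  rw [weylDiv, weylDiv, weylDiv, mul_smul_comm, x_mul_weylInt hxy hm hn, ← mul_invFact n, ← h1]
  module

theorem weylDiv_succ_right (hxy : y * x = x * y + 1) {m n : ℤ} (hm : 0 ≤ m) (hn : 0 ≤ n) :
    ((n : ℝ) + 1) • weylDiv x y m (n + 1) =
      y * weylDiv x y m n - (2 : ℝ)⁻¹ • weylDiv x y (m - 1) n := by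
  have h1 := mul_invFact (n + 1)
  rw [add_sub_cancel_right] at h1
  push_cast at h1
  rw [weylDiv, weylDiv, weylDiv, mul_smul_comm, y_mul_weylInt hxy hm hn, ← mul_invFact m, ← h1]
  module

/-- The coefficient `2^{-s} / s!` of the Moyal product. -/
def moyalCoeff (s : ℕ) : ℝ := (2 : ℝ)⁻¹ ^ s * ((s.factorial : ℝ))⁻¹

theorem moyalCoeff_succ (s : ℕ) : ((s : ℝ) + 1) * moyalCoeff (s + 1) = (2 : ℝ)⁻¹ * moyalCoeff s := by
  have := Nat.factorial_ne_zero s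
  rw [moyalCoeff, moyalCoeff, Nat.factorial_succ, pow_succ]
  push_cast
  field_simp

/-- The truncated Moyal product. -/
def moyal (x y : B) (N : ℕ) (l b i d : ℤ) : B :=
  ∑ s ∈ Finset.range N, (moyalCoeff s * transvect s l b i d) •
    weylInt x y (l + i - s) (b + d - s)

/-- One `x` is peeled off the left factor. The Leibniz rule absorbs one correction by `∂_y`, and the
rest matches orders `s` and `s + 1` through the commutator of `Ω` with `x ⊗ 1`. -/
theorem moyal_succ_left (hxy : y * x = x * y + 1) {N : ℕ} {l b i d : ℤ} (hN : l + b < N) :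
    ((l : ℝ) + 1) • moyal x y (N + 1) (l + 1) b i d =
      x * moyal x y N l b i d + (2 : ℝ)⁻¹ • moyal x y N l (b - 1) i d := by
  have h1 : x * moyal x y N l b i d + (2 : ℝ)⁻¹ • moyal x y N l (b - 1) i d =
      ∑ s ∈ Finset.range N, (moyalCoeff s * transvect s l b i d) •
        weylInt x y (l + 1 + i - s) (b + d - s) -
      ∑ s ∈ Finset.range N, ((2 : ℝ)⁻¹ * moyalCoeff s * transvect s l b i (d - 1)) •
        weylInt x y (l + i - s) (b + d - s - 1) := by
    rw [moyal, moyal, Finset.mul_sum, Finset.smul_sum, ← Finset.sum_add_distrib,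
      ← Finset.sum_sub_distrib]
    refine Finset.sum_congr rfl fun s _ => ?_
    have hl := transvect_leibniz s l b i d
    have hl' : transvect s l b i (d - 1) =
      ((b : ℝ) + d - s) * transvect s l b i d - transvect s l (b - 1) i d := by linarith
    rw [hl', show b - 1 + d - (s : ℤ) = b + d - s - 1 by ring]
    -- `weylInt` truncates negative exponents to zero, so the product rule for it fails there; but
    -- then the coefficient vanishes.
    by_cases h : l + i - s < 0 ∨ b + d - s < 0
    · rw [transvect_eq_zero (l := l) (b := b) (i := i) (d := d) (by omega)]
      simp only [mul_zero, zero_smul, zero_sub, zero_add]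
      module
    · rw [mul_smul_comm, x_mul_weylInt hxy (by omega) (by omega),
        show l + i - (s : ℤ) + 1 = l + 1 + i - s by ring]
      push_cast
      module
  have h2 : ∑ s ∈ Finset.range N, (moyalCoeff s * transvect s l b i d) •
        weylInt x y (l + 1 + i - s) (b + d - s) = ∑ s ∈ Finset.range (N + 1),
        (moyalCoeff s * transvect s l b i d) • weylInt x y (l + 1 + i - s) (b + d - s) := by
    rw [Finset.sum_range_succ, transvect_eq_zero (s := N) (by omega), mul_zero, zero_smul, add_zero]
  have hcomb : ∀ u v w : B, u + v - w = u - w + v := fun _ _ _ => by abel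
  rw [h1, h2, moyal, Finset.sum_range_succ', Finset.sum_range_succ', smul_add, hcomb,
    ← Finset.sum_sub_distrib, Finset.smul_sum]
  congr 1
  · refine Finset.sum_congr rfl fun s _ => ?_
    rw [show l + i - (s : ℤ) = l + 1 + i - (s + 1 : ℕ) by push_cast; ring,
      show b + d - (s : ℤ) - 1 = b + d - (s + 1 : ℕ) by push_cast; ring, smul_smul, ← sub_smul]
    congr 1
    linear_combination moyalCoeff (s + 1) * transvect_succ_left s l b i d -
      transvect s l b i (d - 1) * moyalCoeff_succ s
  · rw [smul_smul]
    congr 1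
    linear_combination moyalCoeff 0 * transvect_zero_succ_left l b i d

theorem moyal_succ_right (hxy : y * x = x * y + 1) {N : ℕ} {l b i d : ℤ} (hN : l + b < N) :
    ((b : ℝ) + 1) • moyal x y (N + 1) l (b + 1) i d =
      y * moyal x y N l b i d - (2 : ℝ)⁻¹ • moyal x y N (l - 1) b i d := by
  have h1 : y * moyal x y N l b i d - (2 : ℝ)⁻¹ • moyal x y N (l - 1) b i d =
      ∑ s ∈ Finset.range N, (moyalCoeff s * transvect s l b i d) •
        weylInt x y (l + i - s) (b + 1 + d - s) +
      ∑ s ∈ Finset.range N, ((2 : ℝ)⁻¹ * moyalCoeff s * transvect s l b (i - 1) d) •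
        weylInt x y (l + i - s - 1) (b + d - s) := by
    rw [moyal, moyal, Finset.mul_sum, Finset.smul_sum, ← Finset.sum_add_distrib,
      ← Finset.sum_sub_distrib]
    refine Finset.sum_congr rfl fun s _ => ?_
    have hl := transvect_leibniz_left s l b i d
    have hl' : transvect s l b (i - 1) d =
      ((l : ℝ) + i - s) * transvect s l b i d - transvect s (l - 1) b i d := by linarith
    rw [hl', show l - 1 + i - (s : ℤ) = l + i - s - 1 by ring]
    by_cases h : l + i - s < 0 ∨ b + d - s < 0
    · rw [transvect_eq_zero (l := l) (b := b) (i := i) (d := d) (by omega)]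
      simp only [mul_zero, zero_smul, zero_sub, zero_add]
      module
    · rw [mul_smul_comm, y_mul_weylInt hxy (by omega) (by omega),
        show b + d - (s : ℤ) + 1 = b + 1 + d - s by ring]
      push_cast
      module
  have h2 : ∑ s ∈ Finset.range N, (moyalCoeff s * transvect s l b i d) •
        weylInt x y (l + i - s) (b + 1 + d - s) = ∑ s ∈ Finset.range (N + 1),
        (moyalCoeff s * transvect s l b i d) • weylInt x y (l + i - s) (b + 1 + d - s) := by
    rw [Finset.sum_range_succ, transvect_eq_zero (s := N) (by omega), mul_zero, zero_smul, add_zero]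
  have hcomb : ∀ u v w : B, u + v + w = u + w + v := fun _ _ _ => by abel
  rw [h1, h2, moyal, Finset.sum_range_succ', Finset.sum_range_succ', smul_add, hcomb,
    ← Finset.sum_add_distrib, Finset.smul_sum]
  congr 1
  · refine Finset.sum_congr rfl fun s _ => ?_
    rw [show l + i - (s : ℤ) - 1 = l + i - (s + 1 : ℕ) by push_cast; ring,
      show b + d - (s : ℤ) = b + 1 + d - (s + 1 : ℕ) by push_cast; ring, smul_smul, ← add_smul]
    congr 1
    linear_combination moyalCoeff (s + 1) * transvect_succ_right s l b i d +
      transvect s l b (i - 1) d * moyalCoeff_succ s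
  · rw [smul_smul]
    congr 1
    linear_combination moyalCoeff 0 * transvect_zero_succ_right l b i d

/-- The Moyal product formula for Weyl-ordered monomials. -/
theorem weylDiv_mul_weylDiv (hxy : y * x = x * y + 1) (l b : ℕ) (i d : ℤ) {N : ℕ}
    (hN : l + b < N) : weylDiv x y l b * weylDiv x y i d = moyal x y N l b i d := by
  have cancel : ∀ (n : ℕ) (u v : B), ((n : ℝ) + 1) • u = ((n : ℝ) + 1) • v → u = v := by
    intro n u v h
    have h1 := congrArg (fun w => ((n : ℝ) + 1)⁻¹ • w) h
    have h2 : ((n : ℝ) + 1) ≠ 0 := by positivity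
    simpa [smul_smul, inv_mul_cancel₀ h2] using h1
  have neg_left : ∀ n : ℤ, weylDiv x y (-1) n = 0 := by
    intro n
    rw [weylDiv, invFact_of_neg (by omega), zero_mul, zero_smul]
  have neg_right : ∀ n : ℤ, weylDiv x y n (-1) = 0 := by
    intro n
    rw [weylDiv, invFact_of_neg (z := -1) (by omega), mul_zero, zero_smul]
  have moyal_neg : ∀ (N : ℕ) (l b : ℤ), l < 0 ∨ b < 0 → moyal x y N l b i d = 0 := by
    intro N l b h
    refine Finset.sum_eq_zero fun s _ => ?_
    rw [transvect_eq_zero (by omega), mul_zero, zero_smul]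
  -- The left factor is built up from 1, first by powers of `y` and then by powers of `x`.
  induction l generalizing b N with
  | zero =>
    induction b generalizing N with
    | zero =>
      obtain ⟨N, rfl⟩ : ∃ M, N = M + 1 := ⟨N - 1, by omega⟩
      rw [moyal, Finset.sum_range_succ', Finset.sum_eq_zero, zero_add]
      · simp [weylDiv, weylInt, weyl, moyalCoeff, transvect, invFact]
      · intro s _
        rw [transvect_eq_zero (by push_cast; omega), mul_zero, zero_smul]
    | succ b ih =>
      obtain ⟨N, rfl⟩ : ∃ M, N = M + 1 := ⟨N - 1, by omega⟩
      apply cancel b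
      have e1 := weylDiv_succ_right hxy (m := (0 : ℕ)) (n := b) (by omega) (by omega)
      have e2 := moyal_succ_right hxy (N := N) (l := (0 : ℕ)) (b := b) (i := i) (d := d)
        (by push_cast; omega)
      rw [show ((0 : ℕ) : ℤ) - 1 = -1 by rfl, neg_left, smul_zero, sub_zero] at e1
      rw [moyal_neg N (((0 : ℕ) : ℤ) - 1) b (by omega), smul_zero, sub_zero,
        ← ih (by omega)] at e2
      push_cast at e1 e2 ⊢
      rw [e2, ← smul_mul_assoc, e1, mul_assoc]
  | succ l ih =>
    obtain ⟨N, rfl⟩ : ∃ M, N = M + 1 := ⟨N - 1, by omega⟩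
    apply cancel l
    have e1 := weylDiv_succ_left hxy (m := l) (n := b) (by omega) (by omega)
    have e2 := moyal_succ_left hxy (N := N) (l := l) (b := b) (i := i) (d := d) (by omega)
    have e3 : weylDiv x y l ((b : ℤ) - 1) * weylDiv x y i d = moyal x y N l ((b : ℤ) - 1) i d := by
      rcases b with _ | b
      · rw [show ((0 : ℕ) : ℤ) - 1 = -1 by rfl, neg_right, zero_mul, moyal_neg _ _ _ (by omega)]
      · rw [show ((b + 1 : ℕ) : ℤ) - 1 = b by push_cast; ring]
        exact ih b (by omega)
    rw [← ih b (by omega), ← e3] at e2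
    push_cast at e1 e2 ⊢
    rw [e2, ← smul_mul_assoc, e1, add_mul, mul_assoc, smul_mul_assoc]

end Weyl

end
end Jordanian

namespace Jordanian
open scoped Kronecker PowerSeries Matrix
noncomputable section

/-! ### The symplecton of `sl(2)` -/

section Weyl

variable {B : Type*} [Ring B] [Algebra ℝ B] {x y : B}

/-- On symmetrized monomials the commutator with a quadratic element is exactly a first-order
differential operator, with no lower-order terms. Hence each homogeneous degree carries an
irreducible representation. -/
theorem commutator_sq_x_weyl (hxy : y * x = x * y + 1) (m n : ℕ) :
    x ^ 2 * weyl x y m n - weyl x y m n * x ^ 2 = (-2 * n : ℝ) • weyl x y (m + 1) (n - 1) := by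
  have h := weyl_mul_x hxy m n
  have h1 : x ^ 2 * weyl x y m n - weyl x y m n * x ^ 2 =
      -(x * (weyl x y m n * x - x * weyl x y m n) + (weyl x y m n * x - x * weyl x y m n) * x) := by
    noncomm_ring
  rw [h1, h, add_sub_cancel_left, weyl_succ, mul_smul_comm, smul_mul_assoc]
  module

theorem commutator_y_weyl (hxy : y * x = x * y + 1) (m n : ℕ) :
    y * weyl x y m n - weyl x y m n * y = (m : ℝ) • weyl x y (m - 1) n := by
  rw [y_mul_weyl hxy, weyl_mul_y hxy]
  module

theorem commutator_sq_y_weyl (hxy : y * x = x * y + 1) (m n : ℕ) :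
    y ^ 2 * weyl x y m n - weyl x y m n * y ^ 2 = (2 * m : ℝ) • weyl x y (m - 1) (n + 1) := by
  have h1 : y ^ 2 * weyl x y m n - weyl x y m n * y ^ 2 =
      y * (y * weyl x y m n - weyl x y m n * y) + (y * weyl x y m n - weyl x y m n * y) * y := by
    noncomm_ring
  rw [h1, commutator_y_weyl hxy, mul_smul_comm, smul_mul_assoc, y_mul_weyl hxy, weyl_mul_y hxy]
  module

theorem commutator_sym_weyl (hxy : y * x = x * y + 1) (m n : ℕ) :
    (x * y + y * x) * weyl x y m n - weyl x y m n * (x * y + y * x) =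
      (2 * m - 2 * n : ℝ) • weyl x y m n := by
  have h := weyl_mul_x hxy m n
  have h1 : (x * y + y * x) * weyl x y m n - weyl x y m n * (x * y + y * x) =
      x * (y * weyl x y m n - weyl x y m n * y) + (y * weyl x y m n - weyl x y m n * y) * x -
      (y * (weyl x y m n * x - x * weyl x y m n) + (weyl x y m n * x - x * weyl x y m n) * y) := by
    noncomm_ring
  rw [h1, h, add_sub_cancel_left, commutator_y_weyl hxy, mul_smul_comm, smul_mul_assoc,
    mul_smul_comm, smul_mul_assoc, y_mul_weyl hxy, weyl_mul_y hxy]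
  have h2 : (m : ℝ) • (x * weyl x y (m - 1) n) + (m : ℝ) • (weyl x y (m - 1) n * x) =
      (2 * m : ℝ) • weyl x y m n := by
    rcases m with _ | m
    · simp
    · rw [Nat.add_sub_cancel, weyl_succ]
      module
  rw [h2]
  rcases n with _ | n
  · simp
  · rw [Nat.add_sub_cancel]
    module

/-- Commutators with `x` and with `y` lower the two degrees one at a time with nonzero factors, down
to 1. -/
theorem weyl_ne_zero [Nontrivial B] (hxy : y * x = x * y + 1) (m n : ℕ) : weyl x y m n ≠ 0 := by
  have cancel : ∀ (n : ℕ) (u : B), ((n + 1 : ℕ) : ℝ) • u = 0 → u = 0 := fun n u h =>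
    (smul_eq_zero_iff_right (show ((n + 1 : ℕ) : ℝ) ≠ 0 by positivity)).1 h
  induction m with
  | zero =>
    induction n with
    | zero => simp [weyl]
    | succ n ih =>
      intro h
      have h1 := weyl_mul_x hxy 0 (n + 1)
      rw [h, zero_mul, mul_zero, zero_add, Nat.add_sub_cancel] at h1
      exact ih (cancel n _ h1.symm)
  | succ m ih =>
    intro h
    have h1 := commutator_y_weyl hxy (m + 1) n
    rw [h, zero_mul, mul_zero, sub_zero, Nat.add_sub_cancel] at h1
    exact ih (cancel m _ h1.symm)


/-- The symplecton of `sl(2)`. -/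
def symp (x y : B) (n i : ℕ) : B := (wt n i)⁻¹ • weyl x y i (n - i)

theorem symp_ne_zero [Nontrivial B] (hxy : y * x = x * y + 1) (n i : ℕ) : symp x y n i ≠ 0 :=
  smul_ne_zero (inv_ne_zero (wt_pos n i).ne') (weyl_ne_zero hxy _ _)

theorem commutator_Jp_symp (hxy : y * x = x * y + 1) (n : ℕ) (i : Fin (n + 1)) :
    -((2 : ℝ)⁻¹ • x ^ 2) * symp x y n i - symp x y n i * -((2 : ℝ)⁻¹ • x ^ 2) =
      ∑ k, (spin ℝ n).Jp k i • symp x y n k := by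
  have h := commutator_sq_x_weyl hxy i (n - i)
  have h1 : -((2 : ℝ)⁻¹ • x ^ 2) * symp x y n i - symp x y n i * -((2 : ℝ)⁻¹ • x ^ 2) =
      (-(2 : ℝ)⁻¹ * (wt n i)⁻¹) • (x ^ 2 * weyl x y i (n - i) -
        weyl x y i (n - i) * x ^ 2) := by
    rw [symp]
    simp only [neg_mul, mul_neg, smul_mul_assoc, mul_smul_comm]
    module
  rw [h1, h]
  by_cases hi : (i : ℕ) = n
  · rw [Finset.sum_eq_zero, hi, Nat.sub_self, Nat.cast_zero, mul_zero, zero_smul, smul_zero]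
    intro k _
    have := k.2
    simp only [spin, Matrix.of_apply]
    rw [if_neg (by omega), zero_smul]
  · have h2 := i.2
    rw [Finset.sum_eq_single (⟨i + 1, by omega⟩ : Fin (n + 1))]
    · simp only [spin, Matrix.of_apply, if_true, symp, smul_smul, Algebra.algebraMap_self,
        RingHom.id_apply, Nat.sub_sub]
      congr 1
      have h3 := wt_raise (n := n) (k := i) (by omega)
      have h4 := (wt_pos n i).ne'
      have h5 := (wt_pos n (i + 1)).ne'
      rw [Nat.cast_sub (by omega)]
      field_simp
      linear_combination -h3
    · intro k _ hk
      simp only [spin, Matrix.of_apply]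
      rw [if_neg (fun h => hk (Fin.ext h)), zero_smul]
    · simp

theorem commutator_Jm_symp (hxy : y * x = x * y + 1) (n : ℕ) (i : Fin (n + 1)) :
    ((2 : ℝ)⁻¹ • y ^ 2) * symp x y n i - symp x y n i * ((2 : ℝ)⁻¹ • y ^ 2) =
      ∑ k, (spin ℝ n).Jm k i • symp x y n k := by
  have h := commutator_sq_y_weyl hxy i (n - i)
  have h1 : ((2 : ℝ)⁻¹ • y ^ 2) * symp x y n i - symp x y n i * ((2 : ℝ)⁻¹ • y ^ 2) =
      ((2 : ℝ)⁻¹ * (wt n i)⁻¹) • (y ^ 2 * weyl x y i (n - i) -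
        weyl x y i (n - i) * y ^ 2) := by
    rw [symp]
    simp only [smul_mul_assoc, mul_smul_comm]
    module
  rw [h1, h]
  by_cases hi : (i : ℕ) = 0
  · rw [Finset.sum_eq_zero, hi, Nat.cast_zero, mul_zero, zero_smul, smul_zero]
    intro k _
    simp only [spin, Matrix.of_apply]
    rw [if_neg (by omega), zero_smul]
  · have h2 := i.2
    rw [Finset.sum_eq_single (⟨i - 1, by omega⟩ : Fin (n + 1))]
    · simp only [spin, Matrix.of_apply, symp, smul_smul, Algebra.algebraMap_self,
        RingHom.id_apply]
      rw [if_pos (by omega), show n - (i : ℕ) + 1 = n - (i - 1) by omega]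
      congr 1
      obtain ⟨k, hk⟩ : ∃ k, (i : ℕ) = k + 1 := ⟨i - 1, by omega⟩
      have h3 := wt_lower (n := n) (k := k) (by omega)
      have h4 := (wt_pos n k).ne'
      have h5 := (wt_pos n (k + 1)).ne'
      rw [hk, Nat.add_sub_cancel]
      rw [show ((n : ℝ) - k) * (k + 1) = (((k + 1 : ℕ) : ℝ) * (n - (k + 1 : ℕ) + 1)) by
        push_cast; ring] at h3
      push_cast at h3 ⊢
      field_simp
      linear_combination -h3
    · intro k _ hk
      simp only [spin, Matrix.of_apply]
      rw [if_neg (fun h => hk (Fin.ext (by simp only; omega))), zero_smul]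
    · simp

theorem commutator_J0_symp (hxy : y * x = x * y + 1) (n : ℕ) (i : Fin (n + 1)) :
    ((2 : ℝ)⁻¹ • (x * y + y * x)) * symp x y n i -
      symp x y n i * ((2 : ℝ)⁻¹ • (x * y + y * x)) =
      (2 * (i : ℝ) - n) • symp x y n i := by
  have h := commutator_sym_weyl hxy i (n - i)
  rw [symp, smul_mul_smul_comm, smul_mul_smul_comm, mul_comm (wt n i)⁻¹, ← smul_sub, h,
    smul_smul, smul_smul, Nat.cast_sub (by omega)]
  congr 1
  ring

/-- This is the origin of `∇`: it cancels the normalization of the Clebsch-Gordan coefficients and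
leaves the `1/s!` of the Moyal product. -/
theorem inv_sqrt_mul_nabla_mul_cgNorm {k j j' : ℕ} (h : Triad k j j') :
    (Real.sqrt ((k : ℝ) + 1))⁻¹ * nabla k j j' * cgNorm j' j k =
      ((((j + j' - k) / 2).factorial : ℝ))⁻¹ := by
  obtain ⟨p, q, s, rfl, rfl, rfl⟩ := h.rotate.exists_eq
  have hT : Triad (q + s) (p + s) (p + q) := h.rotate.swap
  rw [nabla, cgNorm, if_pos h, if_pos hT, show (p + s + (q + s) - (p + q)) / 2 = s by omega,
    show (q + s + (p + s) - (p + q)) / 2 = s by omega,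
    show (p + q + (q + s) - (p + s)) / 2 = q by omega,
    show (p + q + (p + s) - (q + s)) / 2 = p by omega,
    show (p + q + (p + s) + (q + s)) / 2 = p + q + s by omega,
    show (q + s + (p + s) + (p + q)) / 2 = p + q + s by omega, ← mul_assoc,
    ← Real.sqrt_inv, ← Real.sqrt_mul (by positivity), ← Real.sqrt_mul (by positivity)]
  have h1 : ((p + q : ℕ) : ℝ) + 1 ≠ 0 := by positivity
  have h2 := Nat.factorial_ne_zero p
  have h3 := Nat.factorial_ne_zero q
  have h4 := Nat.factorial_ne_zero s
  have h5 := Nat.factorial_ne_zero (p + q + s + 1)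
  have h6 : (((p + q : ℕ) : ℝ) + 1)⁻¹ * (((p + q + s + 1).factorial : ℝ) /
      (p.factorial * q.factorial * s.factorial)) *
      (((p + q + 1 : ℕ) : ℝ) * (q.factorial * p.factorial * s.factorial) /
        (p + q + s + 1).factorial) = 1 := by
    rw [Nat.cast_add (p + q) 1, Nat.cast_one]
    field_simp
  rw [h6, Real.sqrt_one, one_mul]

/-- The term of order `s` in the Moyal product is the component with `k = j + j' - 2s` in doubled
spins, and its coefficient is a transvectant, that is, a Clebsch-Gordan coefficient. -/
theorem symp_mul_symp (hxy : y * x = x * y + 1) {j j' m m' : ℕ} (hm : m ≤ j) (hm' : m' ≤ j') :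
    symp x y j m * symp x y j' m' =
      ∑ k ∈ (Finset.range (j + j' + 1)).filter (fun k => Triad k j j'), ∑ r : Fin (k + 1),
        ((2 : ℝ)⁻¹ ^ ((j + j' - k) / 2) * (Real.sqrt ((k : ℝ) + 1))⁻¹ * nabla k j j' *
          cg j' j k ⟨m', by omega⟩ ⟨m, by omega⟩ r) • symp x y k r := by
  have hw : ∀ n i : ℕ, i ≤ n → symp x y n i = wt n i • weylDiv x y i ((n : ℤ) - i) := by
    intro n i hi
    have h1 := wt_sq n i
    have h2 := (wt_pos n i).ne'
    rw [symp, weylDiv, weylInt, show (n : ℤ) - i = (n - i : ℕ) by omega, invFact_natCast,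
      invFact_natCast, Int.toNat_natCast, Int.toNat_natCast, smul_smul]
    congr 1
    rw [← mul_inv, ← h1]
    field_simp
  have hterm : ∀ s ≤ min j j', (wt j m * wt j' m' * (moyalCoeff s *
      transvect s m ((j : ℤ) - m) m' ((j' : ℤ) - m'))) •
        weylInt x y ((m : ℤ) + m' - s) ((j : ℤ) - m + (j' - m') - s) =
      ∑ r : Fin (j + j' - 2 * s + 1),
        ((2 : ℝ)⁻¹ ^ s * (Real.sqrt (((j + j' - 2 * s : ℕ) : ℝ) + 1))⁻¹ *
          nabla (j + j' - 2 * s) j j' *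
          cg j' j (j + j' - 2 * s) ⟨m', by omega⟩ ⟨m, by omega⟩ r) • symp x y (j + j' - 2 * s) r := by
    intro s hs
    have hT : Triad (j + j' - 2 * s) j j' := ⟨⟨j + j' - s, by omega⟩, by omega, by omega, by omega⟩
    have hc := inv_sqrt_mul_nabla_mul_cgNorm hT
    rw [show (j + j' - (j + j' - 2 * s)) / 2 = s by omega] at hc
    by_cases hr : s ≤ m + m' ∧ m + m' - s < j + j' - 2 * s + 1
    · rw [Finset.sum_eq_single ⟨m + m' - s, hr.2⟩]
      · rw [cg_eq, cgPoly, if_pos (by simp only; omega), symp, weylInt, smul_smul, moyalCoeff, ← hc,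
          show (j' + j - (j + j' - 2 * s)) / 2 = s by omega,
          show ((m : ℤ) + m' - s).toNat = m + m' - s by omega,
          show ((j : ℤ) - m + (j' - m') - s).toNat = j + j' - 2 * s - (m + m' - s) by omega]
        congr 1
        have := (wt_pos (j + j' - 2 * s) (m + m' - s)).ne'
        simp only
        field_simp
      · intro r _ hr'
        rw [cg_eq, cgPoly, if_neg, mul_zero, mul_zero, mul_zero, zero_smul]
        intro h
        apply hr'
        ext
        simp only at h ⊢
        omega
      · simp
    · rw [transvect_eq_zero (by omega), mul_zero, mul_zero, zero_smul, Finset.sum_eq_zero]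
      intro r _
      have := r.2
      rw [cg_eq, cgPoly, if_neg (by simp only; omega), mul_zero, mul_zero, mul_zero, zero_smul]
  have hmul := weylDiv_mul_weylDiv hxy m (j - m) m' ((j' : ℤ) - m') (N := j + 1) (by omega)
  rw [show ((j - m : ℕ) : ℤ) = j - m by omega] at hmul
  rw [hw j m hm, hw j' m' hm', smul_mul_smul_comm, hmul, moyal, Finset.smul_sum]
  have hsub : (Finset.range (min j j' + 1)) ⊆ Finset.range (j + 1) := by
    intro s hs
    rw [Finset.mem_range] at *
    omega
  rw [← Finset.sum_subset hsub]
  · refine Finset.sum_nbij' (fun s => j + j' - 2 * s) (fun k => (j + j' - k) / 2) ?_ ?_ ?_ ?_ ?_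
    · intro s hs
      rw [Finset.mem_range] at hs
      rw [Finset.mem_filter, Finset.mem_range]
      exact ⟨by omega, ⟨j + j' - s, by omega⟩, by omega, by omega, by omega⟩
    · intro k hk
      obtain ⟨h1, ⟨q, h2⟩, h3, h4, h5⟩ := Finset.mem_filter.1 hk
      rw [Finset.mem_range]
      omega
    · intro s hs
      rw [Finset.mem_range] at hs
      omega
    · intro k hk
      obtain ⟨h1, ⟨q, h2⟩, h3, h4, h5⟩ := Finset.mem_filter.1 hk
      omega
    · intro s hs
      rw [Finset.mem_range] at hs
      rw [smul_smul, hterm s (by omega), show (j + j' - (j + j' - 2 * s)) / 2 = s by omega]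
  · intro s _ hs
    rw [Finset.mem_range] at hs
    rw [transvect_eq_zero (by omega), mul_zero, zero_smul, smul_zero]

end Weyl

/-! ### The boson algebra -/

theorem abar_mul_a : Boson.abar * Boson.a = Boson.a * Boson.abar + 1 := by
  have := RingQuot.mkAlgHom_rel ℂ BosonRel.comm
  rwa [map_mul, map_add, map_mul, map_one] at this

instance : Nontrivial Boson := by
  -- The algebra is nonzero because it acts on polynomials: `a` by multiplication with the variable,
  -- `ā` by differentiation.
  let X : Module.End ℂ (Polynomial ℂ) := LinearMap.mulLeft ℂ Polynomial.X
  let D : Module.End ℂ (Polynomial ℂ) := Polynomial.derivative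
  let f : FreeAlgebra ℂ Bool →ₐ[ℂ] Module.End ℂ (Polynomial ℂ) :=
    FreeAlgebra.lift ℂ fun t => if t then X else D
  have hf : ∀ ⦃u v : FreeAlgebra ℂ Bool⦄, BosonRel u v → f u = f v := by
    intro u v h
    cases h
    simp only [f, map_mul, map_add, map_one, FreeAlgebra.lift_ι_apply]
    refine LinearMap.ext fun p => ?_
    simp [X, D, add_comm]
  let F : Boson →ₐ[ℂ] Module.End ℂ (Polynomial ℂ) := RingQuot.liftAlgHom ℂ ⟨f, hf⟩
  exact F.toRingHom.domain_nontrivial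

end
end Jordanian

namespace Jordanian
open scoped Kronecker PowerSeries Matrix
noncomputable section

/-! ### Powers of the twisting series -/

section Abstract

variable {D : Type*} [Ring D] [Algebra ℝ D] {h J0 Jp Jm t : D} {E : ℝ → D} {m : ℝ}

/-- In this section `E s` stands for `e^{sσ}` and `t` for a vector of weight `m` of the undeformed
action. For `s = m` the first term drops out, which is why the twisting exponent is the weight. -/
theorem adJ0_aux (h0 : ∀ s, J0 * E s - E s * J0 = (-2 * s) • (E s - E (s + 1)))
    (ht : J0 * t - t * J0 = (2 * m) • t) (s : ℝ) :
    J0 * (t * E s) - t * E s * J0 = (2 * (m - s)) • (t * E s) + (2 * s) • (t * E (s + 1)) := by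
  have h1 : J0 * (t * E s) - t * E s * J0 = (J0 * t - t * J0) * E s + t * (J0 * E s - E s * J0) := by
    noncomm_ring
  rw [h1, ht, h0, smul_mul_assoc, mul_smul_comm, mul_sub]
  module

theorem adJ0_eq (hE : ∀ s u, E (s + u) = E s * E u)
    (h0 : ∀ s, J0 * E s - E s * J0 = (-2 * s) • (E s - E (s + 1)))
    (ht : J0 * t - t * J0 = (2 * m) • t) :
    (J0 * (t * E m) - t * E m * J0) * E (-1) = (2 * m) • (t * E m) := by
  rw [adJ0_aux h0 ht, smul_eq_zero_of_left (by ring), zero_add, smul_mul_assoc, mul_assoc, ← hE,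
    add_neg_cancel_right]

theorem adJp_eq (hE : ∀ s u, E (s + u) = E s * E u) (hE0 : E 0 = 1)
    (hn : E (-1) = 1 - (2 : ℝ) • (h * Jp)) (hh : ∀ z, h * z = z * h)
    (hJ : ∀ s, Jp * E s = E s * Jp) {u : D} (ht : Jp * t - t * Jp = u) :
    E (-1) * (Jp * E 1 * (t * E m) - t * E m * (Jp * E 1)) = u * E (m + 1) := by
  have h1 : E (-1) * E 1 = 1 := by rw [← hE, neg_add_cancel, hE0]
  -- From `e^{-σ} = 1 - 2hJ₊`: this is `e^σ = 1 + 2hJ₊e^σ`, which raises the exponent from `m` to `m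
  -- + 1`.
  have h2 : E 1 = 1 + (2 : ℝ) • (h * (Jp * E 1)) := by
    have h3 : E (-1) * E 1 = E 1 - (2 : ℝ) • (h * (Jp * E 1)) := by
      rw [hn, sub_mul, one_mul, smul_mul_assoc, mul_assoc]
    rw [h1] at h3
    rw [h3, sub_add_cancel]
  have hG : E (-1) * t = t * E (-1) - (2 : ℝ) • (h * u) := by
    rw [hn, sub_mul, mul_sub, one_mul, mul_one, smul_mul_assoc, mul_smul_comm, ← ht, ← mul_assoc t,
      ← hh t, mul_sub]
    simp only [mul_assoc]
    module
  have hc : E m * (Jp * E 1) = Jp * E 1 * E m := by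
    rw [← mul_assoc, ← hJ, mul_assoc, mul_assoc, ← hE, ← hE, add_comm]
  have h4 : E (-1) * (Jp * E 1) = Jp := by rw [← mul_assoc, ← hJ, mul_assoc, h1, mul_one]
  have hA : E (-1) * (Jp * E 1 * (t * E m)) = Jp * t * E m := by
    rw [← mul_assoc, h4, mul_assoc]
  have hB : E (-1) * (t * E m * (Jp * E 1)) =
      t * Jp * E m - (2 : ℝ) • (h * (u * (Jp * E 1)) * E m) := by
    rw [mul_assoc t, hc, ← mul_assoc, hG, sub_mul, smul_mul_assoc, ← mul_assoc (t * E (-1)),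
      mul_assoc t, h4]
    simp only [mul_assoc]
  have hC : u * E (m + 1) = u * E m + (2 : ℝ) • (h * (u * (Jp * E 1)) * E m) := by
    rw [add_comm m, hE]
    conv_lhs => rw [h2]
    rw [add_mul, one_mul, mul_add, smul_mul_assoc, mul_smul_comm, ← mul_assoc h u, hh u]
    simp only [mul_assoc]
  rw [mul_sub, hA, hB, hC, ← ht]
  noncomm_ring

theorem adJm_eq (hE : ∀ s u, E (s + u) = E s * E u)
    (h0 : ∀ s, J0 * E s - E s * J0 = (-2 * s) • (E s - E (s + 1)))
    (hm : ∀ s, Jm * E s - E s * Jm = (-2 * s) • (h * (E (s + 1) * J0)) +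
      (2 * (s * (s + 1))) • (h * (E (s + 1) - E (s + 2))))
    (hh : ∀ z, h * z = z * h) {u : D}
    (ht0 : J0 * t - t * J0 = (2 * m) • t) (ht : Jm * t - t * Jm = u) :
    ((Jm + h * J0 + (2 : ℝ)⁻¹ • (h * J0 ^ 2)) * (t * E m) -
      (t * E m) * (Jm + h * J0 + (2 : ℝ)⁻¹ • (h * J0 ^ 2))) * E (-1) -
      h * (J0 * (t * E m) - t * E m * J0) * E (-1) ^ 2 -
      (2 : ℝ)⁻¹ • (h * (J0 * (J0 * (t * E m) - t * E m * J0) -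
        (J0 * (t * E m) - t * E m * J0) * J0) * E (-1) ^ 2) = u * E (m - 1) := by
  set X := t * E m with hX
  have c0 : J0 * X - X * J0 = (2 * m) • (t * E (m + 1)) := by
    rw [hX, adJ0_aux h0 ht0, smul_eq_zero_of_left (by ring), zero_add]
  have c1 : J0 * (J0 * X - X * J0) - (J0 * X - X * J0) * J0 =
      (2 * m) • ((-2 : ℝ) • (t * E (m + 1)) + (2 * (m + 1)) • (t * E (m + 2))) := by
    rw [c0, mul_smul_comm, smul_mul_assoc, ← smul_sub, adJ0_aux h0 ht0,
      show m + 1 + 1 = m + 2 by ring]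
    congr 3
    ring
  have c2 : Jm * X - X * Jm = u * E m + (-2 * m) • (h * (t * E (m + 1) * J0)) +
      (2 * (m * (m + 1))) • (h * (t * E (m + 1) - t * E (m + 2))) := by
    have h1 : Jm * X - X * Jm = (Jm * t - t * Jm) * E m + t * (Jm * E m - E m * Jm) := by
      rw [hX]; noncomm_ring
    rw [h1, ht, hm, mul_add, mul_smul_comm, mul_smul_comm, ← mul_assoc t h, ← hh t, mul_assoc h t,
      ← mul_assoc t h, ← hh t, mul_assoc h t, mul_sub, mul_assoc t, add_assoc]
  have c3 : (Jm + h * J0 + (2 : ℝ)⁻¹ • (h * J0 ^ 2)) * X -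
      X * (Jm + h * J0 + (2 : ℝ)⁻¹ • (h * J0 ^ 2)) = (Jm * X - X * Jm) + h * (J0 * X - X * J0) +
      (2 : ℝ)⁻¹ • (h * (J0 * (J0 * X - X * J0) - (J0 * X - X * J0) * J0)) +
      h * ((J0 * X - X * J0) * J0) := by
    have h1 : ∀ z, X * (h * z) = h * (X * z) := fun z => by rw [← mul_assoc, ← hh X, mul_assoc]
    simp only [add_mul, mul_add, smul_mul_assoc, mul_smul_comm, h1, pow_two, mul_sub, sub_mul,
      mul_assoc]
    module
  -- The additions `hJ₀ + ½hJ₀²` to `J₋` cancel the terms ending in `J₀` and those with `E (m + 2)`.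
  -- The rest is cancelled by the two terms subtracted in the deformed action.
  have c4 : (Jm + h * J0 + (2 : ℝ)⁻¹ • (h * J0 ^ 2)) * X -
      X * (Jm + h * J0 + (2 : ℝ)⁻¹ • (h * J0 ^ 2)) =
      u * E m + (2 * (m * (m + 1))) • (h * (t * E (m + 1))) := by
    rw [c3, c2, c1, c0]
    simp only [mul_add, mul_sub, mul_smul_comm, smul_mul_assoc]
    module
  have hs : ∀ (z : D) (s r : ℝ), z * E s * E r = z * E (s + r) := fun z s r => by
    rw [mul_assoc, ← hE]
  rw [c4, c1, c0, pow_two (E (-1)), ← hE]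
  simp only [mul_add, add_mul, mul_smul_comm, smul_mul_assoc, ← mul_assoc h t, hs]
  rw [show m + 1 + -1 = m by ring, show m + 1 + (-1 + -1) = m - 1 by ring,
    show m + 2 + (-1 + -1) = m by ring, ← sub_eq_add_neg]
  module

end Abstract

section Series

variable {B : Type*} [Ring B] [Algebra ℝ B] {x y : B}

theorem succ_mul_choose_succ (r : ℝ) (n : ℕ) :
    ((n : ℝ) + 1) * Ring.choose r (n + 1) = r * Ring.choose (r - 1) n := by
  have h := Ring.choose_smul_choose r (n := n + 1) (k := 1) (by omega)
  simpa [nsmul_eq_mul] using h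

theorem mul_choose (r : ℝ) (n : ℕ) :
    (n : ℝ) * Ring.choose r n = r * (Ring.choose r n - Ring.choose (r - 1) n) := by
  rcases n with _ | n
  · simp
  · have h := Ring.choose_succ_succ (r - 1) n
    rw [sub_add_cancel] at h
    push_cast
    rw [succ_mul_choose_succ, h]
    ring

/-- The series `(1 + h x²)^{-s}`. -/
def sigmaPow (x : B) (s : ℝ) : B⟦X⟧ := PowerSeries.mk fun n => Ring.choose (-s) n • (x ^ 2) ^ n

theorem coeff_sigmaPow (s : ℝ) (n : ℕ) :
    PowerSeries.coeff n (sigmaPow x s) = Ring.choose (-s) n • (x ^ 2) ^ n :=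
  PowerSeries.coeff_mk _ _

theorem sigmaPow_zero : sigmaPow x 0 = 1 := by
  ext n
  rw [coeff_sigmaPow, neg_zero, PowerSeries.coeff_one]
  rcases n with _ | n
  · simp
  · simp [Ring.choose_zero_succ]

/-- Chu-Vandermonde for binomial coefficients with real upper argument; real exponents are needed
for half-integral weights. -/
theorem sigmaPow_add (s u : ℝ) : sigmaPow x (s + u) = sigmaPow x s * sigmaPow x u := by
  ext n
  rw [coeff_sigmaPow, PowerSeries.coeff_mul, neg_add, Ring.add_choose_eq n (Commute.all _ _),
    Finset.sum_smul]
  refine Finset.sum_congr rfl fun p hp => ?_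
  rw [coeff_sigmaPow, coeff_sigmaPow, smul_mul_smul_comm, ← pow_add,
    Finset.HasAntidiagonal.mem_antidiagonal.1 hp]

theorem coeff_sigmaPow_one (n : ℕ) :
    PowerSeries.coeff n (sigmaPow x 1) = (-(x ^ 2)) ^ n := by
  rw [coeff_sigmaPow, neg_pow (x ^ 2)]
  have : Ring.choose (-1 : ℝ) n = (-1) ^ n := by
    induction n with
    | zero => simp
    | succ n ih =>
      have h := succ_mul_choose_succ 0 n
      have h2 := Ring.choose_succ_succ (-1 : ℝ) n
      rw [neg_add_cancel, Ring.choose_zero_succ] at h2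
      rw [pow_succ, ← ih]
      linarith
  rw [this, Algebra.smul_def, map_pow, map_neg, map_one]

theorem sigmaPow_neg_one : sigmaPow x (-1) = 1 + PowerSeries.X * PowerSeries.C (x ^ 2) := by
  ext n
  rw [coeff_sigmaPow, neg_neg, map_add, PowerSeries.coeff_one]
  rcases n with _ | n
  · simp
  · rw [PowerSeries.coeff_succ_X_mul, PowerSeries.coeff_C]
    rcases n with _ | n
    · simp
    · have : Ring.choose (1 : ℝ) (n + 1 + 1) = 0 := by
        have := Ring.choose_natCast (R := ℝ) 1 (n + 1 + 1)
        rw [Nat.cast_one] at this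
        rw [this, Nat.choose_eq_zero_of_lt (by omega), Nat.cast_zero]
      simp [this]

theorem sym_mul_sq (hxy : y * x = x * y + 1) :
    ((2 : ℝ)⁻¹ • (x * y + y * x)) * x ^ 2 =
      x ^ 2 * ((2 : ℝ)⁻¹ • (x * y + y * x)) + (2 : ℝ) • x ^ 2 := by
  have h : (x * y + y * x) * x ^ 2 = x ^ 2 * (x * y + y * x) + (x ^ 2 + x ^ 2) + (x ^ 2 + x ^ 2) := by
    linear_combination (norm := noncomm_ring)
      x * hxy * x + hxy * (x * x) + x * x * hxy + x * hxy * x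
  rw [smul_mul_assoc, mul_smul_comm, h]
  module

theorem sq_y_mul_sq (hxy : y * x = x * y + 1) :
    ((2 : ℝ)⁻¹ • y ^ 2) * x ^ 2 =
      x ^ 2 * ((2 : ℝ)⁻¹ • y ^ 2) + (2 : ℝ) • ((2 : ℝ)⁻¹ • (x * y + y * x)) := by
  have h : y ^ 2 * x ^ 2 = x ^ 2 * y ^ 2 + (x * y + y * x) + (x * y + y * x) := by
    linear_combination (norm := noncomm_ring)
      y * hxy * x + hxy * (y * x) + x * y * hxy + x * hxy * y
  rw [smul_mul_assoc, mul_smul_comm, h]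
  module

theorem commutator_sym_pow (hxy : y * x = x * y + 1) (n : ℕ) :
    ((2 : ℝ)⁻¹ • (x * y + y * x)) * (x ^ 2) ^ n - (x ^ 2) ^ n * ((2 : ℝ)⁻¹ • (x * y + y * x)) =
      (2 * n : ℝ) • (x ^ 2) ^ n := by
  have h1 := sym_mul_sq hxy
  generalize (2 : ℝ)⁻¹ • (x * y + y * x) = j at *
  induction n with
  | zero => simp
  | succ n ih =>
    rw [pow_succ, ← mul_assoc, sub_eq_iff_eq_add.1 ih, add_mul, mul_assoc _ _ (x ^ 2), h1, mul_add,
      smul_mul_assoc, mul_smul_comm, ← mul_assoc]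
    push_cast
    module

theorem commutator_sq_y_pow (hxy : y * x = x * y + 1) (n : ℕ) :
    ((2 : ℝ)⁻¹ • y ^ 2) * (x ^ 2) ^ (n + 1) - (x ^ 2) ^ (n + 1) * ((2 : ℝ)⁻¹ • y ^ 2) =
      (2 * (n + 1) : ℝ) • ((x ^ 2) ^ n * ((2 : ℝ)⁻¹ • (x * y + y * x))) +
        (2 * ((n + 1) * n) : ℝ) • (x ^ 2) ^ n := by
  have h1 := sq_y_mul_sq hxy
  have h3 := sym_mul_sq hxy
  generalize (2 : ℝ)⁻¹ • (x * y + y * x) = j at *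
  generalize (2 : ℝ)⁻¹ • y ^ 2 = k at *
  induction n with
  | zero =>
    rw [zero_add, pow_one, h1]
    simp
  | succ n ih =>
    rw [pow_succ _ (n + 1), ← mul_assoc, sub_eq_iff_eq_add.1 ih, add_mul, mul_assoc _ _ (x ^ 2), h1,
      add_mul, smul_mul_assoc, mul_assoc ((x ^ 2) ^ n), h3]
    simp only [mul_add, mul_smul_comm, smul_mul_assoc, ← mul_assoc, ← pow_succ]
    push_cast
    module

theorem commutator_C_sigmaPow_sym (hxy : y * x = x * y + 1) (s : ℝ) :
    PowerSeries.C ((2 : ℝ)⁻¹ • (x * y + y * x)) * sigmaPow x s -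
      sigmaPow x s * PowerSeries.C ((2 : ℝ)⁻¹ • (x * y + y * x)) =
      (-2 * s) • (sigmaPow x s - sigmaPow x (s + 1)) := by
  ext n
  have key := commutator_sym_pow hxy n
  generalize (2 : ℝ)⁻¹ • (x * y + y * x) = j at *
  rw [map_sub, PowerSeries.coeff_C_mul, PowerSeries.coeff_mul_C, PowerSeries.coeff_smul, map_sub,
    coeff_sigmaPow, coeff_sigmaPow, mul_smul_comm, smul_mul_assoc, ← smul_sub, key, smul_smul, ← sub_smul, smul_smul]
  congr 1
  have h := mul_choose (-s) n
  rw [neg_add']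
  linear_combination 2 * h

theorem commutator_C_sigmaPow_sq (hxy : y * x = x * y + 1) (s : ℝ) :
    PowerSeries.C ((2 : ℝ)⁻¹ • y ^ 2) * sigmaPow x s -
      sigmaPow x s * PowerSeries.C ((2 : ℝ)⁻¹ • y ^ 2) =
      (-2 * s) • (PowerSeries.X * (sigmaPow x (s + 1) *
        PowerSeries.C ((2 : ℝ)⁻¹ • (x * y + y * x)))) +
      (2 * (s * (s + 1))) • (PowerSeries.X * (sigmaPow x (s + 1) - sigmaPow x (s + 2))) := by
  ext n
  have key := commutator_sq_y_pow hxy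
  generalize (2 : ℝ)⁻¹ • (x * y + y * x) = j at *
  generalize (2 : ℝ)⁻¹ • y ^ 2 = k at *
  rw [map_sub, map_add, PowerSeries.coeff_C_mul, PowerSeries.coeff_mul_C, PowerSeries.coeff_smul,
    PowerSeries.coeff_smul, coeff_sigmaPow, mul_smul_comm, smul_mul_assoc, ← smul_sub]
  rcases n with _ | n
  · simp
  · rw [PowerSeries.coeff_succ_X_mul, PowerSeries.coeff_succ_X_mul, map_sub,
      PowerSeries.coeff_mul_C, coeff_sigmaPow, coeff_sigmaPow, key,
      smul_mul_assoc]
    have h1 := succ_mul_choose_succ (-s) n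
    have h2 := mul_choose (-s - 1) n
    rw [neg_add', show -(s + 2) = -s - 1 - 1 by ring, ← sub_smul, smul_add, smul_smul, smul_smul,
      smul_smul, smul_smul]
    congr 2
    · linear_combination 2 * h1
    · linear_combination 2 * (n : ℝ) * h1 - 2 * s * h2

end Series

end
end Jordanian

namespace Jordanian
open scoped Kronecker PowerSeries Matrix
noncomputable section

/-! ### The h-symplecton -/

theorem C_sq_mul_sigmaPow {B : Type*} [Ring B] [Algebra ℝ B] {x : B} (s : ℝ) :
    PowerSeries.C (-((2 : ℝ)⁻¹ • x ^ 2)) * sigmaPow x s =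
      sigmaPow x s * PowerSeries.C (-((2 : ℝ)⁻¹ • x ^ 2)) := by
  ext n
  rw [PowerSeries.coeff_C_mul, PowerSeries.coeff_mul_C, coeff_sigmaPow, mul_smul_comm,
    smul_mul_assoc, neg_mul, mul_neg, mul_smul_comm, smul_mul_assoc, ← pow_succ, ← pow_succ']

theorem inv_two_smul (z : Boson) : (2 : ℂ)⁻¹ • z = (2 : ℝ)⁻¹ • z := by
  have h := algebraMap_smul ℂ (2 : ℝ)⁻¹ z
  rwa [map_inv₀, map_ofNat] at h

theorem inv_two_smul' (z : BosonH) : (2 : ℂ)⁻¹ • z = (2 : ℝ)⁻¹ • z :=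
  PowerSeries.ext fun n => inv_two_smul (PowerSeries.coeff n z)

theorem scalar_algebraMap_mul (r : ℝ) (z : BosonH) : scalar (algebraMap ℝ ℂ⟦X⟧ r) * z = r • z := by
  have h : scalar (algebraMap ℝ ℂ⟦X⟧ r) = PowerSeries.C (algebraMap ℂ Boson (r : ℂ)) := by
    rw [PowerSeries.algebraMap_apply]
    exact PowerSeries.map_C _ _
  rw [h]
  ext n
  rw [PowerSeries.coeff_C_mul, ← Algebra.smul_def]
  exact algebraMap_smul ℂ r (PowerSeries.coeff n z)

theorem spin_Jp_algebraMap (n : ℕ) (k i : Fin (n + 1)) :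
    (spin ℂ⟦X⟧ n).Jp k i = algebraMap ℝ ℂ⟦X⟧ ((spin ℝ n).Jp k i) := by
  simp only [spin, Matrix.of_apply]
  split_ifs
  · rfl
  · rw [map_zero]

theorem spin_Jm_algebraMap (n : ℕ) (k i : Fin (n + 1)) :
    (spin ℂ⟦X⟧ n).Jm k i = algebraMap ℝ ℂ⟦X⟧ ((spin ℝ n).Jm k i) := by
  simp only [spin, Matrix.of_apply]
  split_ifs
  · rfl
  · rw [map_zero]

theorem Jp_eq : Jp = PowerSeries.C (-((2 : ℝ)⁻¹ • Boson.a ^ 2)) := by rw [Jp, inv_two_smul]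

theorem Jm_eq : Jm = PowerSeries.C ((2 : ℝ)⁻¹ • Boson.abar ^ 2) := by rw [Jm, inv_two_smul]

theorem J0_eq :
    J0 = PowerSeries.C ((2 : ℝ)⁻¹ • (Boson.a * Boson.abar + Boson.abar * Boson.a)) := by
  rw [J0, inv_two_smul]

theorem sigmaPow_a_neg_one : sigmaPow Boson.a (-1) = 1 - (2 : ℝ) • (hh * Jp) := by
  have h : PowerSeries.C (Boson.a ^ 2) = (-2 : ℝ) • Jp := by
    rw [Jp_eq]
    ext n
    rw [PowerSeries.coeff_smul, PowerSeries.coeff_C, PowerSeries.coeff_C]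
    split_ifs
    · have : ∀ (B : Type) [Ring B] [Algebra ℝ B] (z : B), z = (-2 : ℝ) • -((2 : ℝ)⁻¹ • z) :=
        fun B _ _ z => by module
      exact this _ _
    · rw [smul_zero]
  rw [sigmaPow_neg_one, h, hh, mul_smul_comm, neg_smul, sub_eq_add_neg]

theorem expNegSigma_eq : expNegSigma = sigmaPow Boson.a (-1) := by
  rw [sigmaPow_a_neg_one, expNegSigma, mul_assoc, two_mul, two_smul]

theorem expSigma_eq : expSigma = sigmaPow Boson.a 1 := by
  ext n
  rw [coeff_sigmaPow_one, expSigma, PowerSeries.coeff_mk]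

theorem hh_mul (z : BosonH) : hh * z = z * hh := (PowerSeries.commute_X z).symm.eq

/-- The magnetic number `m = i - n / 2`. -/
def magnetic (n i : ℕ) : ℝ := i - n / 2

/-- The h-symplecton `e^{m σ}`-twisting the symplecton of `sl(2)`. -/
def hSymp (n : ℕ) (i : Fin (n + 1)) : BosonH :=
  PowerSeries.C (symp Boson.a Boson.abar n i) * sigmaPow Boson.a (magnetic n i)

theorem constantCoeff_hSymp (n : ℕ) (i : Fin (n + 1)) :
    PowerSeries.coeff 0 (hSymp n i) = symp Boson.a Boson.abar n i := by
  rw [hSymp, PowerSeries.coeff_C_mul, coeff_sigmaPow, Ring.choose_zero_right, one_smul, pow_zero,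
    mul_one]

theorem C_real_smul (r : ℝ) (z : Boson) :
    (PowerSeries.C (r • z) : BosonH) = r • PowerSeries.C z := by
  ext n
  rw [PowerSeries.coeff_smul, PowerSeries.coeff_C, PowerSeries.coeff_C]
  split_ifs
  · rfl
  · rw [smul_zero]

theorem adJ0_hSymp (n : ℕ) (i : Fin (n + 1)) :
    adJ0 (hSymp n i) = (2 * magnetic n i) • hSymp n i := by
  rw [adJ0, commutator, expNegSigma_eq, hSymp]
  refine adJ0_eq sigmaPow_add (fun s => ?_) ?_
  · rw [J0_eq]
    exact commutator_C_sigmaPow_sym abar_mul_a s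
  · rw [J0_eq, ← map_mul, ← map_mul, ← map_sub]
    have h := commutator_J0_symp abar_mul_a n i
    rw [h, C_real_smul, magnetic]
    congr 1
    ring

theorem Jp_mul_sigmaPow (s : ℝ) : Jp * sigmaPow Boson.a s = sigmaPow Boson.a s * Jp := by
  rw [Jp_eq]
  exact C_sq_mul_sigmaPow s

/-- A ladder operator reaches only vectors of one weight, so a single power of `e^σ` is the right
one for the whole sum. -/
theorem sum_spin_smul (n : ℕ) (c : Fin (n + 1) → ℝ) (s : ℝ)
    (hc : ∀ k, c k ≠ 0 → magnetic n k = s) :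
    PowerSeries.C (∑ k, c k • symp Boson.a Boson.abar n k) * sigmaPow Boson.a s =
      ∑ k, scalar (algebraMap ℝ ℂ⟦X⟧ (c k)) * hSymp n k := by
  rw [map_sum, Finset.sum_mul]
  refine Finset.sum_congr rfl fun k _ => ?_
  rw [scalar_algebraMap_mul, C_real_smul, smul_mul_assoc, hSymp]
  by_cases h : c k = 0
  · rw [h, zero_smul, zero_smul]
  · rw [hc k h]

theorem adJp_hSymp (n : ℕ) (i : Fin (n + 1)) :
    adJp (hSymp n i) = ∑ k, scalar ((spin ℂ⟦X⟧ n).Jp k i) * hSymp n k := by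
  simp only [spin_Jp_algebraMap]
  rw [← sum_spin_smul n (fun k => (spin ℝ n).Jp k i) (magnetic n i + 1), adJp, commutator,
    expNegSigma_eq, expSigma_eq, hSymp]
  · refine adJp_eq (h := hh) sigmaPow_add sigmaPow_zero sigmaPow_a_neg_one hh_mul
      Jp_mul_sigmaPow ?_
    have h := commutator_Jp_symp abar_mul_a n i
    rw [Jp_eq, ← map_mul, ← map_mul, ← map_sub, ← h]
  · intro k hk
    simp only [spin, Matrix.of_apply] at hk
    have h : (k : ℕ) = i + 1 := by
      by_contra h
      exact hk (if_neg h)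
    rw [magnetic, magnetic, h]
    push_cast
    ring

theorem adJm_hSymp (n : ℕ) (i : Fin (n + 1)) :
    adJm (hSymp n i) = ∑ k, scalar ((spin ℂ⟦X⟧ n).Jm k i) * hSymp n k := by
  simp only [spin_Jm_algebraMap]
  rw [← sum_spin_smul n (fun k => (spin ℝ n).Jm k i) (magnetic n i - 1), adJm]
  · simp only [commutator, inv_two_smul']
    rw [expNegSigma_eq, hSymp]
    refine adJm_eq sigmaPow_add (fun s => ?_) (fun s => ?_) hh_mul ?_ ?_
    · rw [J0_eq]
      exact commutator_C_sigmaPow_sym abar_mul_a s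
    · rw [J0_eq, Jm_eq]
      exact commutator_C_sigmaPow_sq abar_mul_a s
    · rw [J0_eq, ← map_mul, ← map_mul, ← map_sub]
      have h := commutator_J0_symp abar_mul_a n i
      rw [h, C_real_smul, magnetic]
      congr 1
      ring
    · have h := commutator_Jm_symp abar_mul_a n i
      rw [Jm_eq, ← map_mul, ← map_mul, ← map_sub, ← h]
  · intro k hk
    simp only [spin, Matrix.of_apply] at hk
    have h : (i : ℕ) = k + 1 := by
      by_contra h
      exact hk (if_neg h)
    rw [magnetic, magnetic, h]
    push_cast
    ring

theorem isHSymplecton_hSymp : IsHSymplecton hSymp := by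
  intro n i
  refine ⟨fun h => ?_, adJp_hSymp n i, adJm_hSymp n i, ?_⟩
  · have h0 := constantCoeff_hSymp n i
    rw [h, map_zero] at h0
    exact symp_ne_zero abar_mul_a n i h0.symm
  · rw [adJ0_hSymp, Finset.sum_eq_single i]
    · have h : (spin ℂ⟦X⟧ n).J0 i i = algebraMap ℝ ℂ⟦X⟧ (2 * magnetic n i) := by
        rw [magnetic, mul_sub, mul_div_cancel₀ _ two_ne_zero, map_sub, map_mul]
        simp [spin, map_ofNat]
      rw [h, scalar_algebraMap_mul]
    · intro k _ hk
      simp only [spin]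
      rw [Matrix.diagonal_apply_ne _ hk, map_zero, zero_mul]
    · simp

end
end Jordanian

namespace Jordanian
open scoped Kronecker PowerSeries Matrix
noncomputable section

/-! ### The product law of the h-symplecton -/

/-! ### Lowest-order coefficients of products of power series -/

section Coeff

variable {B : Type*} [Ring B]

theorem coeff_mul_left_of_low (f : B⟦X⟧) {q : B⟦X⟧} {n : ℕ}
    (h : ∀ j < n, PowerSeries.coeff j q = 0) {j : ℕ} (hj : j ≤ n) :
    PowerSeries.coeff j (f * q) = PowerSeries.coeff 0 f * PowerSeries.coeff j q := by
  rw [PowerSeries.coeff_mul, Finset.sum_eq_single (0, j)]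
  · intro p hp hne
    have h1 := Finset.HasAntidiagonal.mem_antidiagonal.1 hp
    rw [h p.2, mul_zero]
    by_contra h2
    exact hne (Prod.ext (by simp only; omega) (by simp only; omega))
  · intro hp
    exact absurd (Finset.HasAntidiagonal.mem_antidiagonal.2 (zero_add j)) hp

theorem coeff_mul_right_of_low (f : B⟦X⟧) {q : B⟦X⟧} {n : ℕ}
    (h : ∀ j < n, PowerSeries.coeff j q = 0) {j : ℕ} (hj : j ≤ n) :
    PowerSeries.coeff j (q * f) = PowerSeries.coeff j q * PowerSeries.coeff 0 f := by
  rw [PowerSeries.coeff_mul, Finset.sum_eq_single (j, 0)]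
  · intro p hp hne
    have h1 := Finset.HasAntidiagonal.mem_antidiagonal.1 hp
    rw [h p.1, zero_mul]
    by_contra h2
    exact hne (Prod.ext (by simp only; omega) (by simp only; omega))
  · intro hp
    exact absurd (Finset.HasAntidiagonal.mem_antidiagonal.2 (add_zero j)) hp

end Coeff

/-! ### Conjugation of tensor operators by powers of `e^σ` -/

section Conj

variable {ι : Type*} [Fintype ι] {Q : ι → BosonH}

/-- Conjugation by `Z` acts on the operators `Q` through the matrix `M`. -/
def ConjBy (Q : ι → BosonH) (Z : BosonH) (M : Matrix ι ι ℂ⟦X⟧) : Prop :=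
  ∀ i, Z * Q i = (∑ k, scalar (M k i) * Q k) * Z

theorem mul_sum_scalar (Z : BosonH) (c : ι → ℂ⟦X⟧) (q : ι → BosonH) :
    Z * ∑ k, scalar (c k) * q k = ∑ k, scalar (c k) * (Z * q k) := by
  rw [Finset.mul_sum]
  refine Finset.sum_congr rfl fun k _ => ?_
  rw [← mul_assoc, ← scalar_commute, mul_assoc]

theorem sum_scalar_mul (M M' : Matrix ι ι ℂ⟦X⟧) (q : ι → BosonH) (i : ι) :
    ∑ k, scalar (M' k i) * ∑ l, scalar (M l k) * q l = ∑ l, scalar ((M * M') l i) * q l := by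
  simp only [Finset.mul_sum, scalar_mul_scalar_mul, Matrix.mul_apply, map_sum, Finset.sum_mul]
  rw [Finset.sum_comm]
  refine Finset.sum_congr rfl fun l _ => Finset.sum_congr rfl fun k _ => ?_
  rw [mul_comm (M' k i)]

theorem ConjBy.mul {Z Z' : BosonH} {M M' : Matrix ι ι ℂ⟦X⟧} (h : ConjBy Q Z M)
    (h' : ConjBy Q Z' M') : ConjBy Q (Z * Z') (M * M') := by
  intro i
  rw [mul_assoc, h' i, ← mul_assoc, mul_sum_scalar]
  simp only [h _]
  rw [← sum_scalar_mul M M' Q i, ← mul_assoc, Finset.sum_mul _ _ Z]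
  simp only [mul_assoc]

variable [DecidableEq ι]

theorem sum_scalar_one (q : ι → BosonH) (i : ι) :
    ∑ k, scalar ((1 : Matrix ι ι ℂ⟦X⟧) k i) * q k = q i := by
  rw [Finset.sum_eq_single i]
  · rw [Matrix.one_apply_eq, map_one, one_mul]
  · intro k _ hk
    rw [Matrix.one_apply_ne hk, map_zero, zero_mul]
  · simp

theorem ConjBy.inv {Z Z' : BosonH} {M M' : Matrix ι ι ℂ⟦X⟧} (h : ConjBy Q Z M) (hZ : Z * Z' = 1)
    (hZ' : Z' * Z = 1) (hM : M * M' = 1) : ConjBy Q Z' M' := by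
  intro i
  have h1 : Q i = ∑ k, scalar (M' k i) * (Z * Q k * Z') := by
    conv_lhs => rw [← sum_scalar_one Q i, ← hM, ← sum_scalar_mul M M' Q i]
    refine Finset.sum_congr rfl fun k _ => ?_
    rw [h k, mul_assoc _ Z Z', hZ, mul_one]
  conv_lhs => rw [h1]
  rw [mul_sum_scalar, Finset.sum_mul]
  refine Finset.sum_congr rfl fun k _ => ?_
  rw [← mul_assoc Z', ← mul_assoc Z', hZ', one_mul, mul_assoc]

/-- A unipotent square root of a conjugation is unique. -/
theorem ConjBy.of_sq {Z : BosonH} {M : Matrix ι ι ℂ⟦X⟧} (h : ConjBy Q (Z * Z) (M * M))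
    (hZ : PowerSeries.coeff 0 Z = 1) (hM : M.map (PowerSeries.constantCoeff) = 1) :
    ConjBy Q Z M := by
  -- The defect `q` satisfies `Z q + (q M) Z = 0`. As `Z` and `M` are the identity at order zero,
  -- the lowest coefficient of `q` would be killed by 2, so by induction all coefficients vanish.
  set q : ι → BosonH := fun i => Z * Q i - (∑ k, scalar (M k i) * Q k) * Z with hq
  have key : ∀ i, Z * q i + (∑ k, scalar (M k i) * q k) * Z = 0 := by
    intro i
    have h1 : (∑ k, scalar (M k i) * q k) = Z * (∑ k, scalar (M k i) * Q k) -
        (∑ l, scalar ((M * M) l i) * Q l) * Z := by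
      rw [mul_sum_scalar, ← sum_scalar_mul M M Q i, Finset.sum_mul, ← Finset.sum_sub_distrib]
      refine Finset.sum_congr rfl fun k _ => ?_
      rw [hq, mul_sub, mul_assoc (scalar (M k i))]
    rw [h1, hq, mul_sub, sub_mul, mul_assoc _ Z Z, ← h i, ← mul_assoc, ← mul_assoc,
      sub_add_sub_cancel, sub_self]
  have hs : ∀ k i, PowerSeries.coeff 0 (scalar (M k i)) = if k = i then 1 else 0 := by
    intro k i
    have h1 := congrFun (congrFun hM k) i
    rw [Matrix.map_apply, Matrix.one_apply] at h1
    rw [scalar, PowerSeries.coeff_map, PowerSeries.coeff_zero_eq_constantCoeff_apply, h1]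
    split_ifs
    · exact map_one _
    · exact map_zero _
  have hz : ∀ n i, PowerSeries.coeff n (q i) = 0 := by
    intro n
    induction n using Nat.strong_induction_on with
    | _ n ih =>
      intro i
      have h1 := congrArg (PowerSeries.coeff n) (key i)
      have hlow : ∀ j ≤ n, PowerSeries.coeff j (∑ k, scalar (M k i) * q k) =
          PowerSeries.coeff j (q i) := by
        intro j hj
        rw [map_sum, Finset.sum_eq_single i]
        · rw [coeff_mul_left_of_low _ (fun l hl => ih l hl i) hj, hs, if_pos rfl, one_mul]
        · intro k _ hk
          rw [coeff_mul_left_of_low _ (fun l hl => ih l hl k) hj, hs, if_neg hk, zero_mul]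
        · simp
      rw [map_add, coeff_mul_left_of_low _ (fun l hl => ih l hl i) le_rfl,
        coeff_mul_right_of_low _ (fun l hl => (hlow l hl.le).trans (ih l hl i)) le_rfl,
        hlow n le_rfl, hZ, one_mul, mul_one, map_zero] at h1
      have h2 : (2 : ℝ) • PowerSeries.coeff n (q i) = 0 := by rw [two_smul]; exact h1
      exact (smul_eq_zero_iff_right (two_ne_zero (α := ℝ))).1 h2
  intro i
  refine sub_eq_zero.1 (PowerSeries.ext fun n => ?_)
  rw [map_zero]
  exact hz n i

end Conj

/-- The action of `J₊` is a conjugation in disguise: since `2hJ₊e^σ = e^σ - 1`, one has `2h · ad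
J₊(t) = t - e^{-σ} t e^σ`. -/
theorem conjBy_expNegSigma (n : ℕ) : ConjBy (hSymp n) expNegSigma
    (1 - (2 * (PowerSeries.X : ℂ⟦X⟧)) • (spin ℂ⟦X⟧ n).Jp) := by
  intro i
  have hG : expNegSigma * expSigma = 1 := by
    rw [expNegSigma_eq, expSigma_eq, ← sigmaPow_add, neg_add_cancel, sigmaPow_zero]
  have hG' : expSigma * expNegSigma = 1 := by
    rw [expNegSigma_eq, expSigma_eq, ← sigmaPow_add, add_neg_cancel, sigmaPow_zero]
  have hJ : 2 * hh * (Jp * expSigma) = expSigma - 1 := by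
    rw [← hG, expNegSigma, sub_mul, one_mul, ← mul_assoc]
    abel
  have hX : scalar (2 * PowerSeries.X) = 2 * hh := by
    rw [map_mul, map_ofNat, scalar, PowerSeries.map_X, hh]
  have hsum : (∑ k, scalar ((1 - (2 * (PowerSeries.X : ℂ⟦X⟧)) • (spin ℂ⟦X⟧ n).Jp) k i) * hSymp n k) =
      hSymp n i - 2 * hh * adJp (hSymp n i) := by
    rw [adJp_hSymp, ← hX, Finset.mul_sum, ← sum_scalar_one (hSymp n) i, ← Finset.sum_sub_distrib]
    refine Finset.sum_congr rfl fun k _ => ?_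
    rw [scalar_mul_scalar_mul, ← sub_mul, ← map_sub]
    rfl
  have hcomm : ∀ z, 2 * hh * z = z * (2 * hh) := fun z => by rw [← hX, scalar_commute]
  have h2 : 2 * hh * adJp (hSymp n i) = hSymp n i - expNegSigma * hSymp n i * expSigma := by
    rw [adJp, commutator, ← mul_assoc, hcomm, mul_assoc, mul_sub, ← mul_assoc (2 * hh), hJ,
      ← mul_assoc (2 * hh), hcomm (hSymp n i), mul_assoc (hSymp n i), hJ, sub_mul, mul_sub (hSymp n i), one_mul,
      mul_one, sub_sub_sub_cancel_right, mul_sub, ← mul_assoc, hG, one_mul, mul_assoc]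
  rw [hsum, h2, sub_sub_cancel, mul_assoc _ expSigma, hG', mul_one]

theorem map_constantCoeff_exp (n : ℕ) (c : ℚ) :
    (IsNilpotent.exp (c • sigma (PowerSeries.X : ℂ⟦X⟧) (spin ℂ⟦X⟧ n).Jp)).map
      PowerSeries.constantCoeff = 1 := by
  let φ : Matrix (Fin (n + 1)) (Fin (n + 1)) ℂ⟦X⟧ →+* Matrix (Fin (n + 1)) (Fin (n + 1)) ℂ :=
    (PowerSeries.constantCoeff (R := ℂ)).mapMatrix
  have h0 : φ (c • sigma (PowerSeries.X : ℂ⟦X⟧) (spin ℂ⟦X⟧ n).Jp) = 0 := by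
    rw [map_rat_smul, sigma, map_sum, Finset.sum_eq_zero, smul_zero]
    intro k _
    have : φ ((2 * (PowerSeries.X : ℂ⟦X⟧)) • (spin ℂ⟦X⟧ n).Jp) = 0 := by
      ext i l
      simp [φ]
    rw [map_rat_smul, map_pow, this, zero_pow (by omega), smul_zero]
  have h1 := IsNilpotent.map_exp
    ((isNilpotent_sigma (PowerSeries.X : ℂ⟦X⟧) (isNilpotent_spin_Jp _ n)).smul c) φ
  rw [h0, IsNilpotent.exp_zero] at h1
  exact h1

/-- Half-integral weights require `e^{-σ/2}`, obtained from `e^{-σ}` by uniqueness of unipotent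
square roots. Its inverse and products of the two give every integer `w`. -/
theorem conjBy_sigmaPow (n : ℕ) (w : ℤ) : ConjBy (hSymp n) (sigmaPow Boson.a (w / 2))
    (IsNilpotent.exp (w • ((2 : ℚ)⁻¹ • sigma (PowerSeries.X : ℂ⟦X⟧) (spin ℂ⟦X⟧ n).Jp))) := by
  have hnil := isNilpotent_sigma (PowerSeries.X : ℂ⟦X⟧) (isNilpotent_spin_Jp _ n)
  set N := (2 : ℚ)⁻¹ • sigma (PowerSeries.X : ℂ⟦X⟧) (spin ℂ⟦X⟧ n).Jp with hN
  have hN' : IsNilpotent N := hnil.smul _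
  have hadd : ∀ u v : ℤ, IsNilpotent.exp ((u + v) • N) =
      IsNilpotent.exp (u • N) * IsNilpotent.exp (v • N) := by
    intro u v
    rw [add_smul]
    exact IsNilpotent.exp_add_of_commute (((Commute.refl N).smul_left u).smul_right v)
      (hN'.smul u) (hN'.smul v)
  have hneg : ConjBy (hSymp n) (sigmaPow Boson.a ((-1 : ℤ) / 2)) (IsNilpotent.exp ((-1 : ℤ) • N)) := by
    refine ConjBy.of_sq ?_ ?_ ?_
    · rw [← sigmaPow_add, ← hadd]
      have e1 : ((-1 : ℤ) : ℝ) / 2 + ((-1 : ℤ) : ℝ) / 2 = -1 := by norm_num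
      have e2 : ((-1 : ℤ) + -1) • N = -sigma (PowerSeries.X : ℂ⟦X⟧) (spin ℂ⟦X⟧ n).Jp := by
        rw [hN]
        module
      rw [e1, e2, ← expNegSigma_eq, exp_neg_sigma _ (isNilpotent_spin_Jp _ n)]
      exact conjBy_expNegSigma n
    · rw [coeff_sigmaPow, Ring.choose_zero_right, one_smul, pow_zero]
    · have e : (-1 : ℤ) • N = (-(2 : ℚ)⁻¹) • sigma (PowerSeries.X : ℂ⟦X⟧) (spin ℂ⟦X⟧ n).Jp := by
        rw [hN]
        module
      rw [e]
      exact map_constantCoeff_exp n _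
  have hpos : ConjBy (hSymp n) (sigmaPow Boson.a ((1 : ℤ) / 2)) (IsNilpotent.exp ((1 : ℤ) • N)) := by
    refine hneg.inv ?_ ?_ ?_
    · rw [← sigmaPow_add, ← sigmaPow_zero]
      congr 1
      norm_num
    · rw [← sigmaPow_add, ← sigmaPow_zero]
      congr 1
      norm_num
    · rw [← hadd, neg_add_cancel, zero_smul, IsNilpotent.exp_zero]
  induction w using Int.induction_on with
  | zero =>
    intro i
    rw [Int.cast_zero, zero_div, sigmaPow_zero, zero_smul, IsNilpotent.exp_zero, sum_scalar_one,
      one_mul, mul_one]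
  | succ w ih =>
    have h := ih.mul hpos
    rwa [← sigmaPow_add, ← hadd, ← add_div, ← Int.cast_add] at h
  | pred w ih =>
    have h := ih.mul hneg
    rwa [← sigmaPow_add, ← hadd, ← add_div, ← Int.cast_add] at h

/-- With all twisting factors on the right the exponents add to `m + n'`, the weight of every
component in the undeformed product. -/
theorem C_symp_mul_sigmaPow {j j' : ℕ} (m : Fin (j + 1)) (n' : Fin (j' + 1)) :
    PowerSeries.C (symp Boson.a Boson.abar j m) * (hSymp j' n' * sigmaPow Boson.a (magnetic j m)) =
      ∑ k ∈ (Finset.range (j + j' + 1)).filter (fun k => Triad k j j'), ∑ r : Fin (k + 1),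
        scalar (algebraMap ℝ ℂ⟦X⟧ ((2 : ℝ)⁻¹ ^ ((j + j' - k) / 2) * (Real.sqrt ((k : ℝ) + 1))⁻¹ *
          nabla k j j' * cg j' j k n' m r)) * hSymp k r := by
  have h := symp_mul_symp abar_mul_a (Nat.lt_succ_iff.1 m.2) (Nat.lt_succ_iff.1 n'.2)
  rw [hSymp, mul_assoc, ← sigmaPow_add, ← mul_assoc, ← map_mul, h, map_sum, Finset.sum_mul]
  refine Finset.sum_congr rfl fun k hk => ?_
  refine sum_spin_smul k _ _ fun r hr => ?_
  obtain ⟨-, ⟨q, hq⟩, h1, h2, h3⟩ := Finset.mem_filter.1 hk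
  have hr2 : (r : ℕ) + (j' + j - k) / 2 = n' + m := by
    by_contra hc
    apply hr
    rw [cg, if_neg (fun h => hc h.2), mul_zero]
  have h4 : 2 * (r : ℕ) + j' + j = 2 * (n' + m) + k := by omega
  have h5 : 2 * ((r : ℕ) : ℝ) + j' + j = 2 * (n' + m) + k := by exact_mod_cast h4
  simp only [magnetic]
  linarith

theorem hasProductLaw_hSymp :
    HasProductLaw hSymp (fun a b c => algebraMap ℝ ℂ⟦X⟧ (nabla a b c)) := by
  intro j j' m m'
  -- The factor `e^{mσ}` of the first operator is moved past the second one; the matrix that appears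
  -- is the block of `𝓕⁻¹` belonging to `m`.
  have h1 := conjBy_sigmaPow j' (2 * (m : ℤ) - j) m'
  have hw : (((2 * (m : ℤ) - j : ℤ) : ℝ)) / 2 = magnetic j m := by
    rw [magnetic]
    push_cast
    ring
  rw [hw] at h1
  set M := IsNilpotent.exp ((2 * (m : ℤ) - j : ℤ) •
    ((2 : ℚ)⁻¹ • sigma (PowerSeries.X : ℂ⟦X⟧) (spin ℂ⟦X⟧ j').Jp)) with hMdef
  have hM : ∀ n n', twistInv (PowerSeries.X : ℂ⟦X⟧) (spin ℂ⟦X⟧ j) (spin ℂ⟦X⟧ j') (n, n') (m, m') =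
      if n = m then M n' m' else 0 := by
    intro n n'
    rw [twistInv_spin_apply]
    by_cases h : n = m
    · rw [if_pos h, if_pos h, h, hMdef, ← Int.cast_smul_eq_zsmul ℂ⟦X⟧]
      push_cast
      rfl
    · rw [if_neg h, if_neg h]
  have hL : hSymp j m * hSymp j' m' = ∑ n', scalar (M n' m') *
      (PowerSeries.C (symp Boson.a Boson.abar j m) *
        (hSymp j' n' * sigmaPow Boson.a (magnetic j m))) := by
    rw [hSymp, mul_assoc, h1, ← mul_assoc, mul_sum_scalar, Finset.sum_mul]
    simp only [mul_assoc]
  rw [hL]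
  simp only [C_symp_mul_sigmaPow, Finset.mul_sum, hM]
  rw [Finset.sum_comm]
  refine Finset.sum_congr rfl fun k _ => ?_
  rw [Finset.sum_eq_single m]
  · refine Finset.sum_congr rfl fun n' _ => Finset.sum_congr rfl fun r _ => ?_
    rw [if_pos rfl, scalar_mul_scalar_mul]
    congr 2
    simp only [map_mul]
    ring
  · intro n _ hn
    refine Finset.sum_eq_zero fun n' _ => Finset.sum_eq_zero fun r _ => ?_
    rw [if_neg hn, mul_zero, zero_mul, map_zero, zero_mul]
  · simp

end
end Jordanian

/-! ### Symmetries of `∇` and the final relation -/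

namespace Jordanian

theorem Triad.rev {a b c : ℕ} (h : Triad a b c) : Triad c b a := h.rotate.swap

theorem nabla_rotate (a b c : ℕ) : nabla a b c = nabla b c a := by
  by_cases h : Triad a b c
  · obtain ⟨p, q, s, rfl, rfl, rfl⟩ := h.exists_eq
    rw [nabla, nabla, if_pos h, if_pos h.rotate,
      show (p + s + (q + s) + (p + q)) / 2 = p + q + s by omega,
      show (q + s + (p + q) + (p + s)) / 2 = p + q + s by omega,
      show (p + s + (q + s) - (p + q)) / 2 = s by omega,
      show (p + s + (p + q) - (q + s)) / 2 = p by omega,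
      show (q + s + (p + q) - (p + s)) / 2 = q by omega,
      show (q + s + (p + s) - (p + q)) / 2 = s by omega,
      show (p + q + (p + s) - (q + s)) / 2 = p by omega]
    congr 2
    ring
  · rw [nabla, nabla, if_neg h, if_neg fun h' => h h'.rotate.rotate]

theorem nabla_rev (a b c : ℕ) : nabla a b c = nabla c b a := by
  by_cases h : Triad a b c
  · obtain ⟨p, q, s, rfl, rfl, rfl⟩ := h.exists_eq
    rw [nabla, nabla, if_pos h, if_pos h.rev,
      show (p + s + (q + s) + (p + q)) / 2 = p + q + s by omega,
      show (p + q + (q + s) + (p + s)) / 2 = p + q + s by omega,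
      show (p + s + (q + s) - (p + q)) / 2 = s by omega,
      show (p + s + (p + q) - (q + s)) / 2 = p by omega,
      show (q + s + (p + q) - (p + s)) / 2 = q by omega,
      show (p + q + (q + s) - (p + s)) / 2 = q by omega,
      show (p + q + (p + s) - (q + s)) / 2 = p by omega,
      show (q + s + (p + s) - (p + q)) / 2 = s by omega]
    congr 2
    ring
  · rw [nabla, nabla, if_neg h, if_neg fun h' => h h'.rev]

theorem nabla_relation {W : ℕ → ℕ → ℕ → ℕ → ℕ → ℕ → PowerSeries ℂ}
    (hW : IsRacah (PowerSeries.X : PowerSeries ℂ) W) (a b c d f : ℕ) :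
    algebraMap ℝ (PowerSeries ℂ) (nabla a c f * nabla b d f) = ((f : PowerSeries ℂ) + 1) *
      ∑ e ∈ (Finset.range (a + b + 1)).filter (fun e => Triad a b e ∧ Triad c d e),
        W a b c d e f * algebraMap ℝ (PowerSeries ℂ) (nabla a b e * nabla c d e) := by
  by_cases h : Triad a c f ∧ Triad b d f
  · have key := hasProductLaw_hSymp.triangle_relation hW (fun n => (isHSymplecton_hSymp n 0).1)
      h.1 h.2
    rw [map_mul, nabla_rotate a c f, nabla_rev b d f, key]
    congr 1
    refine Finset.sum_congr rfl fun e _ => ?_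
    rw [map_mul, nabla_rev a b e, mul_assoc]
  -- Without the two triads both sides vanish, the right one because the Racah coefficients are
  -- supported on triads.
  · have hz : nabla a c f * nabla b d f = 0 := by
      rw [nabla, nabla]
      by_cases h1 : Triad a c f
      · rw [if_neg (fun h2 : Triad b d f => h ⟨h1, h2⟩), mul_zero]
      · rw [if_neg h1, zero_mul]
    rw [hz, map_zero, Finset.sum_eq_zero, mul_zero]
    intro e _
    rw [hW.1 a b c d e f (fun h' => h h'.2.2), zero_mul]

end Jordanian

open Jordanian in
theorem corollary1 :
    -- the Racah coefficients of sl(2) and of U_h(sl(2)) exist and are unique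
    (∃! W : ℕ → ℕ → ℕ → ℕ → ℕ → ℕ → ℝ, IsRacah (0 : ℝ) W) ∧
    (∃! Wh : ℕ → ℕ → ℕ → ℕ → ℕ → ℕ → PowerSeries ℂ,
      IsRacah (PowerSeries.X : PowerSeries ℂ) Wh) ∧
    -- the explicit function nabla is the triangle function of the product law of an h-symplecton
    (∃ P : (n : ℕ) → Fin (n + 1) → BosonH, IsHSymplecton P ∧
      HasProductLaw P (fun a b c => algebraMap ℝ (PowerSeries ℂ) (nabla a b c))) ∧
    ∀ (W : ℕ → ℕ → ℕ → ℕ → ℕ → ℕ → ℝ) (Wh : ℕ → ℕ → ℕ → ℕ → ℕ → ℕ → PowerSeries ℂ),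
      IsRacah (0 : ℝ) W → IsRacah (PowerSeries.X : PowerSeries ℂ) Wh →
      -- the triangle function of the product law of any h-symplecton, in any normalization
      (∀ (P : (n : ℕ) → Fin (n + 1) → BosonH) (T : ℕ → ℕ → ℕ → PowerSeries ℂ),
        IsHSymplecton P → HasProductLaw P T →
        ∀ a b c d f : ℕ, Triad a c f → Triad b d f →
          T c f a * T f d b =
            ((f : PowerSeries ℂ) + 1) *
              ∑ e ∈ (Finset.range (a + b + 1)).filter (fun e => Triad a b e ∧ Triad c d e),
                Wh a b c d e f * T e b a * T c d e) ∧
      -- the relation for nabla with the Racah coefficients of U_h(sl(2))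
      (∀ a b c d f : ℕ,
        algebraMap ℝ (PowerSeries ℂ) (nabla a c f * nabla b d f) =
          ((f : PowerSeries ℂ) + 1) *
            ∑ e ∈ (Finset.range (a + b + 1)).filter (fun e => Triad a b e ∧ Triad c d e),
              Wh a b c d e f * algebraMap ℝ (PowerSeries ℂ) (nabla a b e * nabla c d e)) ∧
      -- these coincide with the Racah coefficients of sl(2), so the relation is the same
      (∀ a b c d e f : ℕ, Wh a b c d e f = algebraMap ℝ (PowerSeries ℂ) (W a b c d e f)) ∧
      (∀ a b c d f : ℕ,
        nabla a c f * nabla b d f =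
          ((f : ℝ) + 1) *
            ∑ e ∈ (Finset.range (a + b + 1)).filter (fun e => Triad a b e ∧ Triad c d e),
              W a b c d e f * nabla a b e * nabla c d e) := by
  refine ⟨⟨_, isRacah_racahCoeff 0, fun W hW => isRacah_unique 0 hW⟩,
    ⟨_, isRacah_racahCoeff _, fun W hW => isRacah_unique _ hW⟩,
    ⟨hSymp, isHSymplecton_hSymp, hasProductLaw_hSymp⟩, fun W Wh hW hWh => ?_⟩
  have hEq : ∀ a b c d e f : ℕ,
      Wh a b c d e f = algebraMap ℝ (PowerSeries ℂ) (W a b c d e f) := by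
    intro a b c d e f
    rw [isRacah_unique _ hWh, isRacah_unique _ hW]
    rfl
  refine ⟨fun P T hP hT a b c d f h1 h2 => hT.triangle_relation hWh (fun n => (hP n 0).1) h1 h2,
    nabla_relation hWh, hEq, fun a b c d f => ?_⟩
  have h := nabla_relation hWh a b c d f
  simp only [hEq, ← map_mul, ← map_sum, ← map_natCast (algebraMap ℝ (PowerSeries ℂ)),
    ← map_one (algebraMap ℝ (PowerSeries ℂ)), ← map_add] at h
  -- Once the deformed coefficients are known to be real constants, the relation over `ℂ⟦h⟧`
  -- descends to `ℝ`.
  rw [FaithfulSMul.algebraMap_injective ℝ (PowerSeries ℂ) h]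
  simp only [mul_assoc]
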